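/- Conventions. A computable structure is a first-order structure in a computable language (relation and function symbols) whose universe is a computable subset of $\omega$ and whose relations and functions are uniformly computable; an index of it is an index of a partial computable function computing all this data, and $\mathcal M_i$ is the structure with index $i$ (if there is one). A degree is the Turing degree of a subset of $\omega$. $\Sigma_0=\Pi_0$ formulas are the finitary quantifier-free formulas; for an ordinal $\beta>0$ a $\Sigma_\beta$ (respectively $\Pi_\beta$) formula of $L_{\omega_1\omega}$ is a countable disjunction of formulas $\exists\bar u\,\psi$ with $\psi$ in $\Pi_\gamma$ for some $\gamma<\beta$ (respectively a countable conjunction of formulas $\forall\bar u\,\psi$ with $\psi$ in $\Sigma_\gamma$ for some $\gamma<\beta$). A $\Sigma_\beta$-elementary embedding $h:\mathcal A\to\mathcal B$ is an embedding such that $\mathcal A\models\varphi(\bar a)\iff\mathcal B\models\varphi(h(\bar a))$ for all $\Sigma_\beta$ formulas $\varphi$ and all tuples $\bar a$. An ordinal is computable if it is the order type of a computable well-order of a computable subset of $\omega$; an index of it is an index of such a well-order; $\omega_1^{CK}$ is the least non-computable ordinal. A degree $\mathbf d$ is high for isomorphism if for all computable structures $\mathcal A\cong\mathcal B$, $\mathbf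 d$ computes an isomorphism from $\mathcal A$ to $\mathcal B$. It is $\alpha$-collegiate if for every $\beta\le\alpha$ and all computable structures $\mathcal A,\mathcal B$ such that there is a $\Sigma_\beta$-elementary embedding of $\mathcal A$ into $\mathcal B$, $\mathbf d$ computes such an embedding. It is computably collegiate if it is $\alpha$-collegiate for every computable ordinal $\alpha$. Uniform versions. $\mathbf d$ is uniformly high for isomorphism if there are $D\in\mathbf d$ and a total computable $f$ such that $\{f(i,j)\}^D$ is an isomorphism from $\mathcal M_i$ to $\mathcal M_j$ whenever $\mathcal M_i\cong\mathcal M_j$ are computable structures. $\mathbf d$ is uniformly $\alpha$-collegiate if there are $D\in\mathbf d$ and a total computable $f$ such that for every index $b$ of an ordinal $\beta\le\alpha$ and all computable structures $\mathcal M_i,\mathcal M_j$ for which there is a $\Sigma_\beta$-elementary embedding of $\mathcal M_i$ into $\mathcal M_j$, $\{f(b,i,j)\}^D$ is such an embedding. $\mathbf d$ is uniformly computably collegiate if one pair $D,f$ has this property for all computable ordinals $\beta$. $\mathbf d$ is levelwise uniformly $\alpha$-collegiate if for each $\beta\le\alpha$ there are $D\in\mathbf d$ and a total computable $f$ such that $\{f(i,j)\}^D$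 is a $\Sigma_\beta$-elementary embedding of $\mathcal M_i$ into $\mathcal M_j$ whenever $\mathcal M_i,\mathcal M_j$ are computable structures for which there is one. Theorem. (a) Let $\alpha$ be a computable ordinal and $\mathbf d$ a degree. The following are equivalent: (1) $\mathbf d$ is $\alpha$-collegiate; (2) $\mathbf d$ is computably collegiate; (3) $\mathbf d$ is high for isomorphism. (b) The same holds for the uniform versions: for $\alpha$ and $\mathbf d$ as in (a), the following are equivalent: $\mathbf d$ is uniformly $\alpha$-collegiate; $\mathbf d$ is levelwise uniformly $\alpha$-collegiate; $\mathbf d$ is uniformly computably collegiate; $\mathbf d$ is uniformly $\gamma$-collegiate for every computable ordinal $\gamma$; $\mathbf d$ is levelwise uniformly $\gamma$-collegiate for every computable ordinal $\gamma$; $\mathbf d$ is uniformly high for isomorphism. (c) Let $\mathcal A,\mathcal B$ be computable structures in the same language with $\mathcal A\equiv_{\omega_1^{CK}}\mathcal B$, i.e. $\mathcal A\le_{\omega_1^{CK}}\mathcal B$ and $\mathcal B\le_{\omega_1^{CK}}\mathcal A$, where $\le_\delta$ ($\delta\ge 1$) are the standard back-and-forth relations: $(\mathcal A,\bar a)\le_1(\mathcal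 B,\bar b)$ if all $\Pi_1$ formulas true of $\bar a$ in $\mathcal A$ are true of $\bar b$ in $\mathcal B$, and for $\delta>1$, $(\mathcal A,\bar a)\le_\delta(\mathcal B,\bar b)$ if for all $1\le\gamma<\delta$ and every finite tuple $\bar d$ in $\mathcal B$ there is a tuple $\bar c$ in $\mathcal A$ with $(\mathcal B,\bar b,\bar d)\le_\gamma(\mathcal A,\bar a,\bar c)$. Then $\mathcal A\cong\mathcal B$. -/

import Mathlib

open FirstOrder

noncomputable section

namespace Collegiate

/-! ### Oracle computations and Turing degrees -/

/-- Programs for oracle computations: the constructors are those of `Nat.RecursiveIn` with a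
single oracle. -/
inductive OCode : Type
  | zero : OCode
  | succ : OCode
  | left : OCode
  | right : OCode
  | oracle : OCode
  | pair : OCode → OCode → OCode
  | comp : OCode → OCode → OCode
  | prec : OCode → OCode → OCode
  | rfind : OCode → OCode

namespace OCode

/-- The partial function computed by a program with oracle `g`. -/
def eval (g : ℕ →. ℕ) : OCode → ℕ →. ℕ
  | zero => fun _ => Part.some 0
  | succ => fun n => Part.some (n + 1)
  | left => fun n => Part.some n.unpair.1
  | right => fun n => Part.some n.unpair.2
  | oracle => g
  | pair cf ch => fun n => Nat.pair <$> eval g cf n <*> eval g ch n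
  | comp cf ch => fun n => eval g ch n >>= eval g cf
  | prec cf ch => fun p =>
      let (a, n) := Nat.unpair p
      n.rec (eval g cf a) fun y IH => do
        let i ← IH
        eval g ch (Nat.pair a (Nat.pair y i))
  | rfind cf => fun a => Nat.rfind fun n => (fun m => m = 0) <$> eval g cf (Nat.pair a n)

/-- The numbering of the programs. -/
def encodeOCode : OCode → ℕ
  | zero => 0
  | succ => 1
  | left => 2
  | right => 3
  | oracle => 4
  | pair cf ch => 2 * (2 * Nat.pair (encodeOCode cf) (encodeOCode ch)) + 5
  | comp cf ch => 2 * (2 * Nat.pair (encodeOCode cf) (encodeOCode ch) + 1) + 5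
  | prec cf ch => (2 * (2 * Nat.pair (encodeOCode cf) (encodeOCode ch)) + 1) + 5
  | rfind cf => (2 * (2 * encodeOCode cf + 1) + 1) + 5

/-- The program with a given number. -/
def ofNatOCode : ℕ → OCode
  | 0 => zero
  | 1 => succ
  | 2 => left
  | 3 => right
  | 4 => oracle
  | n + 5 =>
    let m := n.div2.div2
    have hm : m < n + 5 := by
      simp only [m, Nat.div2_val]
      lia
    have _m1 : m.unpair.1 < n + 5 := lt_of_le_of_lt m.unpair_left_le hm
    have _m2 : m.unpair.2 < n + 5 := lt_of_le_of_lt m.unpair_right_le hm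
    match n.bodd, n.div2.bodd with
    | false, false => pair (ofNatOCode m.unpair.1) (ofNatOCode m.unpair.2)
    | false, true => comp (ofNatOCode m.unpair.1) (ofNatOCode m.unpair.2)
    | true, false => prec (ofNatOCode m.unpair.1) (ofNatOCode m.unpair.2)
    | true, true => rfind (ofNatOCode m)
termination_by n => n
decreasing_by all_goals assumption

theorem ofNat_encodeOCode (c : OCode) : ofNatOCode (encodeOCode c) = c := by
  induction c <;> simp [encodeOCode, ofNatOCode, Nat.div2_val, *]

theorem encode_ofNatOCode : ∀ n, encodeOCode (ofNatOCode n) = n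
  | 0 => by simp [ofNatOCode, encodeOCode]
  | 1 => by simp [ofNatOCode, encodeOCode]
  | 2 => by simp [ofNatOCode, encodeOCode]
  | 3 => by simp [ofNatOCode, encodeOCode]
  | 4 => by simp [ofNatOCode, encodeOCode]
  | n + 5 => by
    let m := n.div2.div2
    have hm : m < n + 5 := by
      simp only [m, Nat.div2_val]
      lia
    have _m1 : m.unpair.1 < n + 5 := lt_of_le_of_lt m.unpair_left_le hm
    have _m2 : m.unpair.2 < n + 5 := lt_of_le_of_lt m.unpair_right_le hm
    have IH := encode_ofNatOCode m
    have IH1 := encode_ofNatOCode m.unpair.1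
    have IH2 := encode_ofNatOCode m.unpair.2
    conv_rhs => rw [← Nat.bit_bodd_div2 n, ← Nat.bit_bodd_div2 n.div2]
    simp only [ofNatOCode.eq_6]
    cases n.bodd <;> cases n.div2.bodd <;>
      simp [m, encodeOCode, IH, IH1, IH2, Nat.bit_val]
termination_by n => n
decreasing_by all_goals assumption

instance instDenumerable : Denumerable OCode :=
  Denumerable.mk' ⟨encodeOCode, ofNatOCode, ofNat_encodeOCode, encode_ofNatOCode⟩

/-- The programs compute exactly the partial functions that are recursive in the oracle. -/
theorem exists_eval_iff {g f : ℕ →. ℕ} : (∃ c : OCode, c.eval g = f) ↔ RecursiveIn {g} f := by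
  rw [RecursiveIn.iff_nat]
  constructor
  · rintro ⟨c, rfl⟩
    induction c with
    | zero => exact .zero
    | succ => exact .succ
    | left => exact .left
    | right => exact .right
    | oracle => exact .oracle g rfl
    | pair _ _ h₁ h₂ => exact .pair h₁ h₂
    | comp _ _ h₁ h₂ => exact .comp h₁ h₂
    | prec _ _ h₁ h₂ => exact .prec h₁ h₂
    | rfind _ h => exact .rfind h
  · intro h
    induction h with
    | zero => exact ⟨zero, rfl⟩
    | succ => exact ⟨succ, rfl⟩
    | left => exact ⟨left, rfl⟩
    | right => exact ⟨right, rfl⟩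
    | oracle h hh => exact ⟨oracle, (Set.mem_singleton_iff.1 hh).symm⟩
    | pair _ _ h₁ h₂ =>
      obtain ⟨c₁, rfl⟩ := h₁
      obtain ⟨c₂, rfl⟩ := h₂
      exact ⟨pair c₁ c₂, rfl⟩
    | comp _ _ h₁ h₂ =>
      obtain ⟨c₁, rfl⟩ := h₁
      obtain ⟨c₂, rfl⟩ := h₂
      exact ⟨comp c₁ c₂, rfl⟩
    | prec _ _ h₁ h₂ =>
      obtain ⟨c₁, rfl⟩ := h₁
      obtain ⟨c₂, rfl⟩ := h₂
      exact ⟨prec c₁ c₂, rfl⟩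
    | rfind _ h =>
      obtain ⟨c, rfl⟩ := h
      exact ⟨rfind c, rfl⟩

end OCode

open Classical in
/-- The characteristic function of a set of natural numbers, as an oracle. -/
def charFun (D : Set ℕ) : ℕ →. ℕ := fun n => Part.some (if n ∈ D then 1 else 0)

/-- The Turing degree of a set of natural numbers. -/
def degreeOf (D : Set ℕ) : TuringDegree := toAntisymmetrization TuringReducible (charFun D)

/-- `{e}^D`: the partial function computed by the `e`-th program with oracle `D`. -/
def oracleEval (e : ℕ) (D : Set ℕ) : ℕ →. ℕ := (Denumerable.ofNat OCode e).eval (charFun D)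

/-- The `e`-th partial computable function (without oracle). -/
def phi (e : ℕ) : ℕ →. ℕ := (Denumerable.ofNat Nat.Partrec.Code e).eval

/-! ### Computable ordinals -/

open Classical in
/-- `b` is an index of a computable well-order, on a computable set `S` of natural numbers, of
order type `β`. -/
def CodesOrdinal (b : ℕ) (β : Ordinal.{0}) : Prop :=
  ∃ (S : Set ℕ) (r : S → S → Prop) (_ : IsWellOrder S r), Ordinal.type r = β ∧
    (∀ x : ℕ, phi b (Nat.pair 0 x) = Part.some (if x ∈ S then 1 else 0)) ∧
    ∀ x y : S, phi b (Nat.pair 1 (Nat.pair x y)) = Part.some (if r x y then 1 else 0)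

/-- Computable ordinals. -/
def IsComputableOrdinal (β : Ordinal.{0}) : Prop := ∃ b, CodesOrdinal b β

/-- The Church-Kleene ordinal, the least ordinal that is not computable. -/
def omegaOneCK : Ordinal.{0} := sInf {β | ¬ IsComputableOrdinal β}

/-! ### Computable structures -/

/-- A language whose symbols are natural numbers: `rel k = some n` says that `k` is a relation
symbol of arity `n`, and `rel k = none` that `k` is not a relation symbol; likewise `fn` for
function symbols (constants are function symbols of arity `0`). -/
structure Signature where
  rel : ℕ → Option ℕ
  fn : ℕ → Option ℕ

/-- The first-order language given by a signature. -/
def Signature.lang (S : Signature) : FirstOrder.Language.{0, 0} where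
  Functions n := {k : ℕ // S.fn k = some n}
  Relations n := {k : ℕ // S.rel k = some n}

/-- A structure whose universe is a set of natural numbers. -/
structure NatStructure (S : Signature) where
  carrier : Set ℕ
  str : S.lang.Structure carrier

instance (S : Signature) : CoeSort (NatStructure S) Type := ⟨fun A => A.carrier⟩

instance (S : Signature) (A : NatStructure S) : S.lang.Structure A := A.str

open Classical in
/-- `e` is an index of the structure `A`, that is, `A` is the `e`-th computable structure:
the `e`-th partial computable function decides the universe, computes the language
(which numbers are symbols, and their arities), and computes all relations and functions of `A`
uniformly in the symbol. -/
def IsIndex {S : Signature} (e : ℕ) (A : NatStructure S) : Prop :=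
  (∀ x : ℕ, phi e (Nat.pair 0 x) = Part.some (if x ∈ A.carrier then 1 else 0)) ∧
  (∀ k : ℕ, phi e (Nat.pair 1 k) = Part.some (Encodable.encode (S.rel k))) ∧
  (∀ k : ℕ, phi e (Nat.pair 2 k) = Part.some (Encodable.encode (S.fn k))) ∧
  (∀ (n : ℕ) (R : S.lang.Relations n) (v : Fin n → A),
    phi e (Nat.pair 3 (Nat.pair R.1 (Encodable.encode (List.ofFn fun i => (v i : ℕ))))) =
      Part.some (if FirstOrder.Language.Structure.RelMap R v then 1 else 0)) ∧
  (∀ (n : ℕ) (F : S.lang.Functions n) (v : Fin n → A),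
    phi e (Nat.pair 4 (Nat.pair F.1 (Encodable.encode (List.ofFn fun i => (v i : ℕ))))) =
      Part.some (FirstOrder.Language.Structure.funMap F v : A).1)

/-- Computable structures. -/
def IsComputableStructure {S : Signature} (A : NatStructure S) : Prop := ∃ e, IsIndex e A

/-! ### Infinitary formulas -/

/-- Infinitary formulas in normal form, with free variables among `n` variables: finitary
quantifier-free formulas, countable disjunctions of formulas `∃ u, ψ`, and countable conjunctions
of formulas `∀ u, ψ`, where `u` is a finite (possibly empty) tuple of variables. -/
inductive InfFormula (L : FirstOrder.Language.{0, 0}) : ℕ → Type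
  | qf {n : ℕ} (φ : L.Formula (Fin n)) (h : φ.IsQF) : InfFormula L n
  | iSupEx {n : ℕ} (k : ℕ → ℕ) (ψ : ∀ i : ℕ, InfFormula L (n + k i)) : InfFormula L n
  | iInfAll {n : ℕ} (k : ℕ → ℕ) (ψ : ∀ i : ℕ, InfFormula L (n + k i)) : InfFormula L n

namespace InfFormula

variable {L : FirstOrder.Language.{0, 0}}

/-- Truth of an infinitary formula in a structure. -/
def Realize {M : Type} [L.Structure M] : {n : ℕ} → InfFormula L n → (Fin n → M) → Prop
  | _, qf φ _, v => φ.Realize v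
  | _, iSupEx k ψ, v => ∃ i, ∃ u : Fin (k i) → M, (ψ i).Realize (Fin.append v u)
  | _, iInfAll k ψ, v => ∀ i, ∀ u : Fin (k i) → M, (ψ i).Realize (Fin.append v u)

mutual

/-- `Σ_α` formulas: `Σ_0` is finitary quantifier-free; for `α > 0`, a `Σ_α` formula is a countable
disjunction of formulas `∃ u, ψ` with `ψ` a `Π_β` formula for some `β < α`. -/
def IsSigma : {n : ℕ} → InfFormula L n → Ordinal.{0} → Prop
  | _, qf _ _, α => α = 0
  | _, iSupEx _ ψ, α => ∀ i, ∃ β < α, (ψ i).IsPi β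
  | _, iInfAll _ _, _ => False

/-- `Π_α` formulas: `Π_0` is finitary quantifier-free; for `α > 0`, a `Π_α` formula is a countable
conjunction of formulas `∀ u, ψ` with `ψ` a `Σ_β` formula for some `β < α`. -/
def IsPi : {n : ℕ} → InfFormula L n → Ordinal.{0} → Prop
  | _, qf _ _, α => α = 0
  | _, iSupEx _ _, _ => False
  | _, iInfAll _ ψ, α => ∀ i, ∃ β < α, (ψ i).IsSigma β

end

end InfFormula

/-- `f` is a `Σ_β`-elementary embedding. -/
def IsSigmaElementary {L : FirstOrder.Language.{0, 0}} {M N : Type} [L.Structure M] [L.Structure N]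
    (β : Ordinal.{0}) (f : M ↪[L] N) : Prop :=
  ∀ (n : ℕ) (φ : InfFormula L n), φ.IsSigma β →
    ∀ v : Fin n → M, φ.Realize v ↔ φ.Realize (f ∘ v)

/-! ### Back-and-forth relations -/

/-- The standard back-and-forth relations `(M, a) ≤_α (N, b)`, for `α ≥ 1`: `(M, a) ≤_1 (N, b)` if
all `Π_1` formulas true of `a` in `M` are true of `b` in `N`; for `α > 1`, `(M, a) ≤_α (N, b)` if
for all `1 ≤ β < α` and every finite tuple `d` in `N` there is a tuple `c` in `M` with
`(N, b, d) ≤_β (M, a, c)`. (At `α = 0`, which is not used, it refers to `Π_0` formulas.) -/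
def BackForthLE (L : FirstOrder.Language.{0, 0}) (α : Ordinal.{0}) (M N : Type) [L.Structure M]
    [L.Structure N] {n : ℕ} (a : Fin n → M) (b : Fin n → N) : Prop :=
  (α ≤ 1 → ∀ φ : InfFormula L n, φ.IsPi α → φ.Realize a → φ.Realize b) ∧
  (1 < α → ∀ (β : Ordinal.{0}) (_ : 1 ≤ β) (_ : β < α) (m : ℕ) (d : Fin m → N),
    ∃ c : Fin m → M, BackForthLE L β N M (Fin.append b d) (Fin.append a c))
termination_by α

/-- `M ≡_α N`. -/
def BackForthEquiv (L : FirstOrder.Language.{0, 0}) (α : Ordinal.{0}) (M N : Type) [L.Structure M]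
    [L.Structure N] : Prop :=
  BackForthLE L α M N (Fin.elim0 : Fin 0 → M) (Fin.elim0 : Fin 0 → N) ∧
  BackForthLE L α N M (Fin.elim0 : Fin 0 → N) (Fin.elim0 : Fin 0 → M)

/-! ### Highness notions -/

/-- The partial function `g` on the natural numbers agrees on `A` with `h : A → B`. -/
def Extends {S : Signature} {A B : NatStructure S} (g : ℕ →. ℕ) (h : A → B) : Prop :=
  ∀ x : A, g x.1 = Part.some (h x).1

/-- The degree `d` computes the function `h : A → B`. -/
def Computes {S : Signature} {A B : NatStructure S} (d : TuringDegree) (h : A → B) : Prop :=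
  ∃ D : Set ℕ, degreeOf D = d ∧ ∃ g : ℕ →. ℕ, TuringReducible g (charFun D) ∧ Extends g h

/-- `d` is high for isomorphism. -/
def HighForIsomorphism (d : TuringDegree) : Prop :=
  ∀ (S : Signature) (A B : NatStructure S), IsComputableStructure A → IsComputableStructure B →
    Nonempty (A ≃[S.lang] B) → ∃ h : A ≃[S.lang] B, Computes d h

/-- `d` is `α`-collegiate. -/
def IsCollegiate (α : Ordinal.{0}) (d : TuringDegree) : Prop :=
  ∀ β ≤ α, ∀ (S : Signature) (A B : NatStructure S),
    IsComputableStructure A → IsComputableStructure B →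
    (∃ h : A ↪[S.lang] B, IsSigmaElementary β h) →
    ∃ h : A ↪[S.lang] B, IsSigmaElementary β h ∧ Computes d h

/-- `d` is computably collegiate. -/
def IsComputablyCollegiate (d : TuringDegree) : Prop :=
  ∀ α, IsComputableOrdinal α → IsCollegiate α d

/-- `d` is uniformly high for isomorphism. -/
def UniformlyHighForIsomorphism (d : TuringDegree) : Prop :=
  ∃ D : Set ℕ, degreeOf D = d ∧ ∃ f : ℕ → ℕ → ℕ, Computable₂ f ∧
    ∀ (S : Signature) (A B : NatStructure S) (i j : ℕ), IsIndex i A → IsIndex j B →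
      Nonempty (A ≃[S.lang] B) →
      ∃ h : A ≃[S.lang] B, Extends (oracleEval (f i j) D) h

/-- `f i j` is, from indices `i`, `j` of computable structures `A`, `B`, an index relative to `D` of
a `Σ_β`-elementary embedding of `A` into `B` if there is one. -/
def FindsElementary (D : Set ℕ) (β : Ordinal.{0}) (f : ℕ → ℕ → ℕ) : Prop :=
  ∀ (S : Signature) (A B : NatStructure S) (i j : ℕ), IsIndex i A → IsIndex j B →
    (∃ h : A ↪[S.lang] B, IsSigmaElementary β h) →
    ∃ h : A ↪[S.lang] B, IsSigmaElementary β h ∧ Extends (oracleEval (f i j) D) h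

/-- `d` is uniformly `α`-collegiate: one procedure handles all pairs of computable structures and
all `β ≤ α`, where `β` is given by an index of a computable well-order. -/
def UniformlyCollegiate (α : Ordinal.{0}) (d : TuringDegree) : Prop :=
  ∃ D : Set ℕ, degreeOf D = d ∧ ∃ f : ℕ → ℕ → ℕ → ℕ,
    Computable (fun p : ℕ × ℕ × ℕ => f p.1 p.2.1 p.2.2) ∧
    ∀ β ≤ α, ∀ b, CodesOrdinal b β → FindsElementary D β (f b)

/-- `d` is uniformly computably collegiate: one procedure handles all pairs of computable structures
and all computable ordinals `β`. -/
def UniformlyComputablyCollegiate (d : TuringDegree) : Prop :=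
  ∃ D : Set ℕ, degreeOf D = d ∧ ∃ f : ℕ → ℕ → ℕ → ℕ,
    Computable (fun p : ℕ × ℕ × ℕ => f p.1 p.2.1 p.2.2) ∧
    ∀ β, ∀ b, CodesOrdinal b β → FindsElementary D β (f b)

/-- The weaker form of uniformity, in the structures only: for each `β ≤ α` separately there is a
procedure that handles all pairs of computable structures. -/
def LevelwiseUniformlyCollegiate (α : Ordinal.{0}) (d : TuringDegree) : Prop :=
  ∀ β ≤ α, ∃ D : Set ℕ, degreeOf D = d ∧ ∃ f : ℕ → ℕ → ℕ,
    Computable₂ f ∧ FindsElementary D β f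

end Collegiate

end

/-!
The members of the `Π⁰₁` classes of functions on the natural numbers are the infinite paths of the
computable trees. All the properties of a degree in (a) amount to computing a path of every
computable tree that has one, and those in (b) to doing so uniformly.

To get paths from embeddings, code a tree by the vector spaces over the field with two elements that
have the levels of the tree as bases, with predicates for the levels, for the projections from each
level to the previous one, and for the sums of an even number of nodes. A second structure has a
predicate for the sums of an odd number of nodes instead. Adding the nodes of a path is an
isomorphism between the two. Any embedding of the first into the second maps the zero vectors to a
sequence of odd sets of nodes that project to each other, in which a path can be chosen step by
step.

Conversely, an embedding `g` is `Σ_β`-elementary if the tuples `a` and `g a` are in the `β`-th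
back-and-forth relation in both directions. Pairs of such a `g` and a strategy that witnesses these
relations are the members of a `Π⁰₁` class: the strategy claims to win from certain positions, and
each of its responses has to preserve more and more atomic formulas and to lead to a position of
lower level that is claimed again. Isomorphisms are paired with their inverses instead.

For (c), the recursion theorem gives a tree whose paths are the strategies for the back-and-forth
game with levels in the Kleene-Brouwer order of the same tree. If it had no path, this order would
be a computable well-order, and equivalence up to `ω₁^CK` would provide a strategy, which is a path.
So it has a path, that is, there is a strategy, and the path is also an infinite descending sequence
of levels. Playing along this sequence yields an isomorphism.
-/

noncomputable section

namespace Collegiate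

open FirstOrder.Language

/-! ### Infinitary formulas and the relations `≤_γ` -/

namespace InfFormula

variable {L : FirstOrder.Language.{0, 0}} {n : ℕ}

attribute [simp] Realize IsSigma IsPi

/-- The negation of an infinitary formula, in normal form. -/
@[simp]
def neg : {n : ℕ} → InfFormula L n → InfFormula L n
  | _, qf φ h => qf φ.not h.not
  | _, iSupEx k ψ => iInfAll k fun i => (ψ i).neg
  | _, iInfAll k ψ => iSupEx k fun i => (ψ i).neg

theorem realize_neg {M : Type} [L.Structure M] (φ : InfFormula L n) (v : Fin n → M) :
    φ.neg.Realize v ↔ ¬ φ.Realize v := by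
  induction φ with
  | qf φ h => simp
  | iSupEx k ψ ih => simp [ih]
  | iInfAll k ψ ih => simp [ih]

theorem isPi_neg_and_isSigma_neg (φ : InfFormula L n) (α : Ordinal.{0}) :
    (φ.neg.IsPi α ↔ φ.IsSigma α) ∧ (φ.neg.IsSigma α ↔ φ.IsPi α) := by
  induction φ generalizing α with
  | qf φ h => simp
  | iSupEx k ψ ih => simp [ih]
  | iInfAll k ψ ih => simp [ih]

theorem isPi_neg {φ : InfFormula L n} {α : Ordinal.{0}} : φ.neg.IsPi α ↔ φ.IsSigma α :=
  (isPi_neg_and_isSigma_neg φ α).1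

theorem isSigma_neg {φ : InfFormula L n} {α : Ordinal.{0}} : φ.neg.IsSigma α ↔ φ.IsPi α :=
  (isPi_neg_and_isSigma_neg φ α).2

theorem IsPi.exists_qf {φ : InfFormula L n} (h : φ.IsPi 0) :
    ∃ (θ : L.Formula (Fin n)) (hθ : θ.IsQF), φ = qf θ hθ := by
  cases φ with
  | qf θ hθ => exact ⟨θ, hθ, rfl⟩
  | iSupEx k ψ => simp at h
  | iInfAll k ψ => simp at h

theorem IsPi.exists_iInfAll {φ : InfFormula L n} {α : Ordinal.{0}} (h : φ.IsPi α) (hα : α ≠ 0) :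
    ∃ (k : ℕ → ℕ) (ψ : ∀ i, InfFormula L (n + k i)), φ = iInfAll k ψ ∧
      ∀ i, ∃ β < α, (ψ i).IsSigma β := by
  cases φ with
  | qf θ hθ => exact absurd (by simpa using h) hα
  | iSupEx k ψ => simp at h
  | iInfAll k ψ => exact ⟨k, ψ, rfl, by simpa using h⟩

theorem exists_isPi_realize_iff_forall {ι : Type*} [Countable ι] {α : Ordinal.{0}} (hα : α ≠ 0)
    (φ : ι → InfFormula L n) (h : ∀ i, (φ i).IsPi α) :
    ∃ Φ : InfFormula L n, Φ.IsPi α ∧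
      ∀ (M : Type) [L.Structure M] (v : Fin n → M), Φ.Realize v ↔ ∀ i, (φ i).Realize v := by
  choose k ψ hφ hψ using fun i => (h i).exists_iInfAll hα
  rcases isEmpty_or_nonempty ι with hι | hι
  · refine ⟨iInfAll (fun _ => 0) fun _ => qf ⊤ BoundedFormula.IsQF.top, ?_, fun M _ v => ?_⟩
    · simp [pos_iff_ne_zero, hα]
    · simp
  · obtain ⟨g, hg⟩ := exists_surjective_nat (ι × ℕ)
    refine ⟨iInfAll (fun j => k (g j).1 (g j).2) fun j => ψ (g j).1 (g j).2, ?_, fun M _ v => ?_⟩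
    · simpa using fun j => hψ _ _
    · simp only [hφ, Realize]
      exact (hg.forall (p := fun x => ∀ u, (ψ x.1 x.2).Realize (Fin.append v u))).symm.trans
        Prod.forall

end InfFormula

/-- All `Π_γ` formulas true of `a` in `M` are true of `b` in `N`; for `γ ≥ 1` this is implied by
the back-and-forth relation `(M, a) ≤_γ (N, b)`. -/
def PiLE (L : FirstOrder.Language.{0, 0}) {M N : Type} [L.Structure M] [L.Structure N]
    (γ : Ordinal.{0}) {n : ℕ} (a : Fin n → M) (b : Fin n → N) : Prop :=
  ∀ φ : InfFormula L n, φ.IsPi γ → φ.Realize a → φ.Realize b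

section PiLE

variable {L : FirstOrder.Language.{0, 0}} {M N : Type} [L.Structure M] [L.Structure N]
variable {γ δ : Ordinal.{0}} {n m : ℕ} {a : Fin n → M} {b : Fin n → N}

theorem append_fin_zero {α : Type*} (v : Fin n → α) (u : Fin 0 → α) :
    (Fin.append v u : Fin (n + 0) → α) = v :=
  funext fun i => Fin.append_left v u i

theorem PiLE.mono (h : PiLE L γ a b) (hδ : δ ≤ γ) : PiLE L δ a b := by
  rcases hδ.eq_or_lt with rfl | hlt
  · exact h
  intro φ hφ ha
  rcases eq_or_ne δ 0 with rfl | hδ0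
  · obtain ⟨θ, hθ, rfl⟩ := hφ.exists_qf
    have := h (.iInfAll (fun _ => 0) fun _ => .qf (n := n + 0) θ hθ) (by simpa using hlt)
      (by simpa [append_fin_zero] using ha)
    simpa [append_fin_zero] using this
  · obtain ⟨k, ψ, rfl, hψ⟩ := hφ.exists_iInfAll hδ0
    refine h _ ?_ ha
    simpa using fun i => (hψ i).imp fun β hβ => ⟨hβ.1.trans hlt, hβ.2⟩

theorem PiLE.realize_qf (h : PiLE L γ a b) {θ : L.Formula (Fin n)} (hθ : θ.IsQF) :
    θ.Realize a ↔ θ.Realize b := by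
  have transfer {θ : L.Formula (Fin n)} (hθ : θ.IsQF) : θ.Realize a → θ.Realize b := by
    simpa using h.mono (zero_le (a := γ)) (.qf θ hθ) (by simp)
  exact ⟨transfer hθ, not_imp_not.1 (by simpa using transfer hθ.not)⟩

theorem PiLE.exists_realize (h : PiLE L γ a b) (hδ : δ < γ) {φ : InfFormula L (n + m)}
    (hφ : φ.IsPi δ) {d : Fin m → N} (hd : φ.Realize (Fin.append b d)) :
    ∃ c : Fin m → M, φ.Realize (Fin.append a c) := by
  by_contra! hc
  have := h (.iInfAll (fun _ => m) fun _ => φ.neg)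
    (by simpa using ⟨δ, hδ, InfFormula.isSigma_neg.2 hφ⟩)
    (by simpa [InfFormula.realize_neg] using hc)
  simp only [InfFormula.Realize, InfFormula.realize_neg] at this
  exact this 0 d hd

theorem PiLE.exists_response [Countable M] (h : PiLE L γ a b) (hδ : δ < γ) (hδ0 : δ ≠ 0)
    (d : Fin m → N) : ∃ c : Fin m → M, PiLE L δ (Fin.append b d) (Fin.append a c) := by
  by_contra! hc
  simp only [PiLE, not_forall] at hc
  choose ψ hψ hψd hψc using hc
  obtain ⟨Φ, hΦ, hreal⟩ := InfFormula.exists_isPi_realize_iff_forall hδ0 ψ hψ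
  obtain ⟨c, hc⟩ := h.exists_realize hδ hΦ ((hreal N _).2 hψd)
  exact hψc c ((hreal M _).1 hc c)

theorem piLE_of_exists_realize (hγ : γ ≠ 0)
    (h : ∀ δ < γ, ∀ (m : ℕ) (d : Fin m → N) (φ : InfFormula L (n + m)), φ.IsPi δ →
      φ.Realize (Fin.append b d) → ∃ c : Fin m → M, φ.Realize (Fin.append a c)) :
    PiLE L γ a b := by
  intro φ hφ ha
  obtain ⟨k, ψ, rfl, hψ⟩ := hφ.exists_iInfAll hγ
  simp only [InfFormula.Realize] at ha ⊢
  intro i d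
  by_contra hd
  obtain ⟨δ, hδ, hσ⟩ := hψ i
  obtain ⟨c, hc⟩ := h δ hδ _ d _ (InfFormula.isPi_neg.2 hσ) ((InfFormula.realize_neg _ _).2 hd)
  exact (InfFormula.realize_neg _ _).1 hc (ha i c)

theorem piLE_of_exists_response (hγ : γ ≠ 0)
    (h0 : ∀ (m : ℕ) (d : Fin m → N) (θ : L.Formula (Fin (n + m))), θ.IsQF →
      θ.Realize (Fin.append b d) → ∃ c : Fin m → M, θ.Realize (Fin.append a c))
    (h : ∀ δ < γ, δ ≠ 0 → ∀ (m : ℕ) (d : Fin m → N),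
      ∃ c : Fin m → M, PiLE L δ (Fin.append b d) (Fin.append a c)) : PiLE L γ a b := by
  refine piLE_of_exists_realize hγ fun δ hδ m d φ hφ hd => ?_
  rcases eq_or_ne δ 0 with rfl | hδ0
  · obtain ⟨θ, hθ, rfl⟩ := hφ.exists_qf
    simpa using h0 m d θ hθ (by simpa using hd)
  · obtain ⟨c, hc⟩ := h δ hδ hδ0 m d
    exact ⟨c, hc φ hφ hd⟩

theorem BackForthLE.piLE (hγ : γ ≠ 0) (h : BackForthLE L γ M N a b) : PiLE L γ a b := by
  induction γ using WellFoundedLT.induction generalizing M N n with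
  | ind γ ih =>
    rw [BackForthLE] at h
    rcases le_or_gt γ 1 with h1 | h1
    · exact h.1 h1
    have response (δ : Ordinal.{0}) (hδ : δ < γ) (hδ0 : δ ≠ 0) (m : ℕ) (d : Fin m → N) :
        ∃ c : Fin m → M, PiLE L δ (Fin.append b d) (Fin.append a c) := by
      obtain ⟨c, hc⟩ := h.2 h1 δ (Order.one_le_iff_ne_zero.2 hδ0) hδ m d
      exact ⟨c, ih δ hδ hδ0 hc⟩
    refine piLE_of_exists_response hγ (fun m d θ hθ hd => ?_) response
    obtain ⟨c, hc⟩ := response 1 h1 one_ne_zero m d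
    exact ⟨c, (hc.realize_qf hθ).1 hd⟩

theorem isSigmaElementary_iff_piLE (f : M ↪[L] N) :
    IsSigmaElementary γ f ↔
      ∀ (n : ℕ) (v : Fin n → M), PiLE L γ v (f ∘ v) ∧ PiLE L γ (f ∘ v) v := by
  have isSigma_iff_isPi : IsSigmaElementary γ f ↔
      ∀ (n : ℕ) (φ : InfFormula L n), φ.IsPi γ → ∀ v : Fin n → M,
        (φ.Realize v ↔ φ.Realize (f ∘ v)) := by
    constructor
    · intro h n φ hφ v
      simpa [InfFormula.realize_neg, not_iff_not] using h n φ.neg (InfFormula.isSigma_neg.2 hφ) v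
    · intro h n φ hφ v
      simpa [InfFormula.realize_neg, not_iff_not] using h n φ.neg (InfFormula.isPi_neg.2 hφ) v
  rw [isSigma_iff_isPi]
  exact ⟨fun h n v => ⟨fun φ hφ => (h n φ hφ v).1, fun φ hφ => (h n φ hφ v).2⟩,
    fun h n φ hφ v => ⟨(h n v).1 φ hφ, (h n v).2 φ hφ⟩⟩

theorem isSigmaElementary_zero (f : M ↪[L] N) : IsSigmaElementary 0 f := by
  have realize_iff {n : ℕ} {θ : L.Formula (Fin n)} (hθ : θ.IsQF) (v : Fin n → M) :
      θ.Realize v ↔ θ.Realize (f ∘ v) := by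
    rw [Formula.Realize, Formula.Realize, ← hθ.realize_embedding f (v := v) (xs := default)]
    congr!
  rw [isSigmaElementary_iff_piLE]
  refine fun n v => ⟨fun φ hφ => ?_, fun φ hφ => ?_⟩ <;>
    obtain ⟨θ, hθ, rfl⟩ := hφ.exists_qf
  · simpa using (realize_iff hθ v).1
  · simpa using (realize_iff hθ v).2

end PiLE

/-! ### Atomic tests on finite lists of elements -/

/-- A test on a list of elements of a structure: `(0, k, w, _)` asks whether the entries `k` and
`w` are equal, `(1, k, _, l)` whether the relation symbol `k` holds of the entries listed in `l`,
and `(_, k, w, l)` whether the function symbol `k` maps the entries listed in `l` to the entry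
`w`. -/
abbrev Test : Type := ℕ × ℕ × ℕ × List ℕ

/-- The entries of `u` at the positions listed in `l`; positions beyond the end of `u` are
skipped. -/
def select {M : Type*} (u : List M) (l : List ℕ) : List M := l.filterMap (u[·]?)

theorem select_map {M M' : Type*} (f : M → M') (u : List M) (l : List ℕ) :
    select (u.map f) l = (select u l).map f := by
  simp [select, List.map_filterMap]

theorem length_select_eq_iff {M : Type*} {u : List M} {l : List ℕ} :
    (select u l).length = l.length ↔ ∀ i ∈ l, i < u.length := by
  simp [select, List.filterMap_length_eq_length]

theorem select_ofFn {M : Type*} {u : List M} {k : ℕ} {j : Fin k → ℕ} {v : Fin k → M}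
    (h : ∀ i, u[j i]? = some (v i)) : select u (List.ofFn j) = List.ofFn v := by
  induction k with
  | zero => simp [select]
  | succ k ih =>
    have := ih (j := fun i => j i.succ) (v := fun i => v i.succ) fun i => h _
    simp only [select] at this
    simp [List.ofFn_succ, select, h, this]

theorem ofFn_select {M : Type*} {n : ℕ} (v : Fin n → M) {l : List ℕ} (hl : ∀ i ∈ l, i < n) :
    select (List.ofFn v) l =
      List.ofFn fun i : Fin l.length => v ⟨l.get i, hl _ (l.get_mem i)⟩ := by
  conv_lhs => rw [← List.ofFn_get l]
  refine select_ofFn fun i => ?_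
  have hi : l[i] < n := hl _ (l.get_mem i)
  simp only [Fin.getElem_fin] at hi
  simp [hi]

section Tests

variable {S : Signature} {M M' : Type} [S.lang.Structure M] [S.lang.Structure M']

/-- The relation symbol with number `k`. -/
def Signature.relSym {k n : ℕ} (h : S.rel k = some n) : S.lang.Relations n := ⟨k, h⟩

/-- The function symbol with number `k`. -/
def Signature.fnSym {k n : ℕ} (h : S.fn k = some n) : S.lang.Functions n := ⟨k, h⟩

/-- The number `k` is a relation symbol of arity `r.length`, and it holds of the list `r`. -/
def RelHolds (S : Signature) {M : Type} [S.lang.Structure M] (k : ℕ) (r : List M) : Prop :=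
  ∃ h : S.rel k = some r.length, Structure.RelMap (Signature.relSym h) r.get

/-- The number `k` is a function symbol of arity `r.length`, and its value at the list `r` is
`p`. -/
def FnValue (S : Signature) {M : Type} [S.lang.Structure M] (k : ℕ) (r : List M) (p : M) : Prop :=
  ∃ h : S.fn k = some r.length, Structure.funMap (Signature.fnSym h) r.get = p

theorem relHolds_iff_of_length {n : ℕ} (R : S.lang.Relations n) (r : List M) (hr : r.length = n) :
    RelHolds S R.1 r ↔ Structure.RelMap R fun i => r.get (i.cast hr.symm) := by
  subst hr
  exact ⟨fun ⟨_, h⟩ => h, fun h => ⟨R.2, h⟩⟩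

theorem fnValue_iff_of_length {n : ℕ} (F : S.lang.Functions n) (r : List M) (hr : r.length = n)
    (p : M) : FnValue S F.1 r p ↔ Structure.funMap F (fun i => r.get (i.cast hr.symm)) = p := by
  subst hr
  exact ⟨fun ⟨_, h⟩ => h, fun h => ⟨F.2, h⟩⟩

theorem relHolds_ofFn {n : ℕ} (R : S.lang.Relations n) (v : Fin n → M) :
    RelHolds S R.1 (List.ofFn v) ↔ Structure.RelMap R v := by
  rw [relHolds_iff_of_length R _ List.length_ofFn]
  simp

theorem fnValue_ofFn {n : ℕ} (F : S.lang.Functions n) (v : Fin n → M) (p : M) :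
    FnValue S F.1 (List.ofFn v) p ↔ Structure.funMap F v = p := by
  rw [fnValue_iff_of_length F _ List.length_ofFn]
  simp

/-- The test succeeds on the list `u`. Two missing entries count as equal, whereas a relation or
function test that refers to a missing entry fails. -/
def Holds (S : Signature) {M : Type} [S.lang.Structure M] (u : List M) : Test → Prop
  | (0, k, w, _) => u[k]? = u[w]?
  | (1, k, _, l) => (∀ i ∈ l, i < u.length) ∧ RelHolds S k (select u l)
  | (_ + 2, k, w, l) =>
    (∀ i ∈ l, i < u.length) ∧ ∃ p, u[w]? = some p ∧ FnValue S k (select u l) p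

theorem holds_rel_iff {u : List M} {n : ℕ} {j : Fin n → ℕ} {v : Fin n → M}
    (h : ∀ i, u[j i]? = some (v i)) (R : S.lang.Relations n) (w : ℕ) :
    Holds S u (1, R.1, w, List.ofFn j) ↔ Structure.RelMap R v := by
  rw [Holds, select_ofFn h, relHolds_ofFn, and_iff_right]
  simpa [List.mem_ofFn] using fun i => (List.getElem?_eq_some_iff.1 (h i)).1

theorem holds_fn_iff {u : List M} {n : ℕ} {j : Fin n → ℕ} {v : Fin n → M}
    (h : ∀ i, u[j i]? = some (v i)) (F : S.lang.Functions n) (w : ℕ) :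
    Holds S u (2, F.1, w, List.ofFn j) ↔ u[w]? = some (Structure.funMap F v) := by
  rw [Holds, select_ofFn h, and_iff_right]
  · simp only [fnValue_ofFn, exists_eq_right']
  · simpa [List.mem_ofFn] using fun i => (List.getElem?_eq_some_iff.1 (h i)).1

/-- The tests with code less than `N` have the same results on both lists. -/
def Agree (S : Signature) {M M' : Type} [S.lang.Structure M] [S.lang.Structure M'] (N : ℕ)
    (u : List M) (u' : List M') : Prop :=
  ∀ t : Test, Encodable.encode t < N → (Holds S u t ↔ Holds S u' t)

theorem Agree.mono {N N' : ℕ} {u : List M} {u' : List M'} (h : Agree S N u u') (hN : N' ≤ N) :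
    Agree S N' u u' := fun t ht => h t (ht.trans_le hN)

theorem exists_formula_getElem_eq (n k w : ℕ) (l : List ℕ) :
    ∃ θ : S.lang.Formula (Fin n), θ.IsQF ∧ ∀ {M : Type} [S.lang.Structure M] (v : Fin n → M),
      θ.Realize v ↔ Holds S (List.ofFn v) (0, k, w, l) := by
  by_cases hk : k < n <;> by_cases hw : w < n
  · refine ⟨Term.equal (Term.var ⟨k, hk⟩) (Term.var ⟨w, hw⟩),
      (BoundedFormula.IsAtomic.equal _ _).isQF, fun v => ?_⟩
    simp [Holds, hk, hw]
  · exact ⟨⊥, BoundedFormula.isQF_bot, fun v => by simp [Holds, hk, hw]⟩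
  · exact ⟨⊥, BoundedFormula.isQF_bot, fun v => by simp [Holds, hk, hw]⟩
  · exact ⟨⊤, BoundedFormula.IsQF.top, fun v => by simp [Holds, hk, hw]⟩

theorem exists_formula_relHolds (n k w : ℕ) (l : List ℕ) :
    ∃ θ : S.lang.Formula (Fin n), θ.IsQF ∧ ∀ {M : Type} [S.lang.Structure M] (v : Fin n → M),
      θ.Realize v ↔ Holds S (List.ofFn v) (1, k, w, l) := by
  by_cases hl : ∀ i ∈ l, i < n
  · by_cases hS : S.rel k = some l.length
    · refine ⟨Relations.formula (Signature.relSym hS) fun i =>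
        Term.var ⟨l.get i, hl _ (l.get_mem i)⟩, (BoundedFormula.IsAtomic.rel _ _).isQF,
        fun v => ?_⟩
      have := relHolds_ofFn (Signature.relSym hS)
        fun i : Fin l.length => v ⟨l.get i, hl _ (l.get_mem i)⟩
      simp only [Holds, List.length_ofFn, ofFn_select v hl, Formula.realize_rel,
        Term.realize_var, iff_true_intro hl, true_and]
      exact this.symm
    · exact ⟨⊥, BoundedFormula.isQF_bot, fun v => by
        simp [Holds, ofFn_select v hl, RelHolds, hS]⟩
  · exact ⟨⊥, BoundedFormula.isQF_bot, fun v => by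
      simp only [Holds, List.length_ofFn, hl, Formula.realize_bot, false_and]⟩

theorem exists_formula_fnValue (n c k w : ℕ) (l : List ℕ) :
    ∃ θ : S.lang.Formula (Fin n), θ.IsQF ∧ ∀ {M : Type} [S.lang.Structure M] (v : Fin n → M),
      θ.Realize v ↔ Holds S (List.ofFn v) (c + 2, k, w, l) := by
  by_cases hw : w < n; swap
  · exact ⟨⊥, BoundedFormula.isQF_bot, fun v => by simp [Holds, hw]⟩
  by_cases hl : ∀ i ∈ l, i < n
  · by_cases hS : S.fn k = some l.length
    · refine ⟨Term.equal (Term.func (Signature.fnSym hS) fun i =>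
        Term.var ⟨l.get i, hl _ (l.get_mem i)⟩) (Term.var ⟨w, hw⟩),
        (BoundedFormula.IsAtomic.equal _ _).isQF, fun v => ?_⟩
      have := fnValue_ofFn (Signature.fnSym hS)
        (fun i : Fin l.length => v ⟨l.get i, hl _ (l.get_mem i)⟩) (v ⟨w, hw⟩)
      simp only [Holds, List.length_ofFn, ofFn_select v hl, Formula.realize_equal,
        Term.realize_var, Term.realize_func, iff_true_intro hl, true_and, List.getElem?_ofFn, hw,
        dite_true, Option.some.injEq, exists_eq_left']
      exact this.symm
    · exact ⟨⊥, BoundedFormula.isQF_bot, fun v => by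
        simp [Holds, ofFn_select v hl, FnValue, hS]⟩
  · exact ⟨⊥, BoundedFormula.isQF_bot, fun v => by
      simp only [Holds, List.length_ofFn, hl, Formula.realize_bot, false_and]⟩

theorem exists_formula_holds (n : ℕ) :
    ∀ t : Test, ∃ θ : S.lang.Formula (Fin n), θ.IsQF ∧
      ∀ {M : Type} [S.lang.Structure M] (v : Fin n → M), θ.Realize v ↔ Holds S (List.ofFn v) t
  | (0, k, w, l) => exists_formula_getElem_eq n k w l
  | (1, k, w, l) => exists_formula_relHolds n k w l
  | (c + 2, k, w, l) => exists_formula_fnValue n c k w l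

theorem PiLE.agree {γ : Ordinal.{0}} {n : ℕ} {a : Fin n → M} {b : Fin n → M'}
    (h : PiLE S.lang γ a b) (N : ℕ) : Agree S N (List.ofFn a) (List.ofFn b) := by
  intro t _
  obtain ⟨θ, hθ, hiff⟩ := exists_formula_holds (S := S) n t
  rw [← hiff a, ← hiff b, h.realize_qf hθ]

theorem exists_formula_agree (N : ℕ) {n : ℕ} (v : Fin n → M) :
    ∃ θ : S.lang.Formula (Fin n), θ.IsQF ∧ θ.Realize v ∧
      ∀ {M' : Type} [S.lang.Structure M'] (v' : Fin n → M'), θ.Realize v' →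
        Agree S N (List.ofFn v) (List.ofFn v') := by
  induction N with
  | zero =>
    exact ⟨⊤, BoundedFormula.IsQF.top, by simp, fun v' _ t ht => absurd ht (Nat.not_lt_zero _)⟩
  | succ N ih =>
    obtain ⟨θ, hθ, hv, h⟩ := ih
    obtain ⟨χ, hχ, hiff⟩ := exists_formula_holds (S := S) n (Denumerable.ofNat Test N)
    have agree_succ {M' : Type} [S.lang.Structure M'] (v' : Fin n → M') (hv' : θ.Realize v')
        (hχv : χ.Realize v ↔ χ.Realize v') : Agree S (N + 1) (List.ofFn v) (List.ofFn v') := by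
      intro t ht
      rcases Nat.lt_succ_iff_lt_or_eq.1 ht with ht | rfl
      · exact h v' hv' t ht
      · rw [Denumerable.ofNat_encode] at hiff
        rw [← hiff, ← hiff, hχv]
    by_cases hc : χ.Realize v
    · refine ⟨θ ⊓ χ, hθ.inf hχ, by simp [hv, hc], fun v' hv' => ?_⟩
      rw [Formula.realize_inf] at hv'
      exact agree_succ v' hv'.1 (iff_of_true hc hv'.2)
    · refine ⟨θ ⊓ χ.not, hθ.inf hχ.not, by simp [hv, hc], fun v' hv' => ?_⟩
      rw [Formula.realize_inf, Formula.realize_not] at hv'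
      exact agree_succ v' hv'.1 (iff_of_false hc hv'.2)

end Tests

/-! ### Quantifier-free formulas are decided by finitely many tests -/

/-- A forcing condition: a finite list of elements of a structure, to be extended, together with a
number of tests to be passed by the copies of the extensions in other structures. -/
structure Condition (M : Type*) where
  entries : List M
  tests : ℕ

instance {M : Type*} : Preorder (Condition M) where
  le p q := p.entries <+: q.entries ∧ p.tests ≤ q.tests
  le_refl p := ⟨List.prefix_rfl, le_rfl⟩
  le_trans _ _ _ h h' := ⟨h.1.trans h'.1, h.2.trans h'.2⟩

theorem exists_ge_forall_fin {P : Type*} [Preorder P] {k : ℕ} {C : Fin k → P → Prop}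
    (hmono : ∀ i p q, p ≤ q → C i p → C i q) (h : ∀ i p, ∃ q ≥ p, C i q) (p : P) :
    ∃ q ≥ p, ∀ i, C i q := by
  induction k generalizing p with
  | zero => exact ⟨p, le_rfl, fun i => i.elim0⟩
  | succ k ih =>
    obtain ⟨q, hq, hqC⟩ := ih (fun i => hmono i.succ) (fun i => h i.succ) p
    obtain ⟨r, hr, hrC⟩ := h 0 q
    exact ⟨r, hq.trans hr, Fin.cases hrC fun i => hmono _ q r hr (hqC i)⟩

section Determined

variable {S : Signature} {M M' : Type} [S.lang.Structure M] [S.lang.Structure M'] {X : Type}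

/-- `W'` passes the tests of the condition `p` as a copy of some extension `W` of `p`, where the
positions `f` name the values `v` in `W` and the values `v'` in `W'`. -/
def Copies (S : Signature) {M M' : Type} [S.lang.Structure M] [S.lang.Structure M'] {X : Type}
    (f : X → ℕ) (v : X → M) (p : Condition M) (W' : List M') (v' : X → M') : Prop :=
  ∃ W : List M, p.entries <+: W ∧ (∀ x, W[f x]? = some (v x)) ∧ W'.length = W.length ∧
    (∀ x, W'[f x]? = some (v' x)) ∧ Agree S p.tests W W'

variable {f : X → ℕ} {v : X → M} {p q : Condition M} {W' : List M'} {v' : X → M'}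

theorem Copies.mono (h : Copies S f v q W' v') (hpq : p ≤ q) : Copies S f v p W' v' := by
  obtain ⟨W, hW, hv, hl, hv', hA⟩ := h
  exact ⟨W, hpq.1.trans hW, hv, hl, hv', hA.mono hpq.2⟩

theorem copies_self {W : List M} (hW : p.entries <+: W) (hv : ∀ x, W[f x]? = some (v x)) :
    Copies S f v p W v :=
  ⟨W, hW, hv, rfl, hv, fun _ _ => Iff.rfl⟩

/-- The position `j` names the value of the term `t` in every copy of an extension of `p`. -/
def Locates (f : X → ℕ) (v : X → M) (t : S.lang.Term X) (j : ℕ) (p : Condition M) : Prop :=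
  ∀ (M' : Type) [S.lang.Structure M'] (W' : List M') (v' : X → M'), Copies S f v p W' v' →
    W'[j]? = some (t.realize v')

theorem Locates.mono {t : S.lang.Term X} {j : ℕ} (h : Locates f v t j p) (hpq : p ≤ q) :
    Locates f v t j q :=
  fun M' _ W' v' hW' => h M' W' v' (hW'.mono hpq)

theorem exists_locates_of_forall {k : ℕ} {ts : Fin k → S.lang.Term X}
    (h : ∀ i p, ∃ q ≥ p, ∃ j, Locates f v (ts i) j q) (p : Condition M) :
    ∃ q ≥ p, ∃ j : Fin k → ℕ, ∀ i, Locates f v (ts i) (j i) q := by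
  obtain ⟨q, hq, hC⟩ := exists_ge_forall_fin (C := fun i q => ∃ j, Locates f v (ts i) j q)
    (fun i _ _ hpq ⟨j, hj⟩ => ⟨j, hj.mono hpq⟩) h p
  choose j hj using hC
  exact ⟨q, hq, j, hj⟩

theorem exists_locates (t : S.lang.Term X) (p : Condition M) :
    ∃ q ≥ p, ∃ j, Locates f v t j q := by
  induction t generalizing p with
  | var x => exact ⟨p, le_rfl, f x, fun M' _ W' v' ⟨_, _, _, _, hv', _⟩ => hv' x⟩
  | @func k F ts ih =>
    obtain ⟨q, hq, j, hj⟩ := exists_locates_of_forall ih p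
    let T : Test := (2, F.1, q.entries.length, List.ofFn j)
    let r : Condition M := ⟨q.entries ++ [(Term.func F ts).realize v],
      max q.tests (Encodable.encode T + 1)⟩
    have hqr : q ≤ r := ⟨List.prefix_append _ _, le_max_left _ _⟩
    refine ⟨r, hq.trans hqr, q.entries.length, fun M' _ W' v' hW' => ?_⟩
    have hj' := fun i => hj i M' W' v' (hW'.mono hqr)
    obtain ⟨W, hW, hv, -, -, hA⟩ := hW'
    have hjW := fun i => hj i M W v (copies_self (hqr.1.trans hW) hv)
    have hT := hA T (by simp [r])
    rw [holds_fn_iff hjW, holds_fn_iff hj'] at hT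
    refine hT.1 ?_
    obtain ⟨_, rfl⟩ := hW
    simp [r]

/-- The formula `θ` has the same truth value in all copies of extensions of `p`. -/
def Determines (f : X → ℕ) (v : X → M) (θ : S.lang.Formula X) (p : Condition M) : Prop :=
  ∀ (M' : Type) [S.lang.Structure M'] (W' : List M') (v' : X → M'), Copies S f v p W' v' →
    (θ.Realize v ↔ θ.Realize v')

theorem exists_determines_equal (t₁ t₂ : S.lang.Term X) (p : Condition M) :
    ∃ q ≥ p, Determines f v (t₁.equal t₂) q := by
  obtain ⟨q₁, hq₁, j₁, h₁⟩ := exists_locates (f := f) (v := v) t₁ p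
  obtain ⟨q, hq, j₂, h₂⟩ := exists_locates (f := f) (v := v) t₂ q₁
  replace h₁ := h₁.mono hq
  let T : Test := (0, j₁, j₂, [])
  let r : Condition M := ⟨q.entries, max q.tests (Encodable.encode T + 1)⟩
  have hqr : q ≤ r := ⟨List.prefix_rfl, le_max_left _ _⟩
  refine ⟨r, (hq₁.trans hq).trans hqr, fun M' _ W' v' hW' => ?_⟩
  have e₁ := h₁ M' W' v' (hW'.mono hqr)
  have e₂ := h₂ M' W' v' (hW'.mono hqr)
  obtain ⟨W, hW, hv, -, -, hA⟩ := hW'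
  have hT : W[j₁]? = W[j₂]? ↔ W'[j₁]? = W'[j₂]? := hA T (by simp [r])
  rw [e₁, e₂, h₁ M W v (copies_self hW hv), h₂ M W v (copies_self hW hv)] at hT
  simpa using hT

theorem exists_determines_rel {k : ℕ} (R : S.lang.Relations k) (ts : Fin k → S.lang.Term X)
    (p : Condition M) : ∃ q ≥ p, Determines f v (R.formula ts) q := by
  obtain ⟨q, hq, j, hj⟩ := exists_locates_of_forall (f := f) (v := v)
    (fun i => exists_locates (ts i)) p
  let T : Test := (1, R.1, 0, List.ofFn j)
  let r : Condition M := ⟨q.entries, max q.tests (Encodable.encode T + 1)⟩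
  have hqr : q ≤ r := ⟨List.prefix_rfl, le_max_left _ _⟩
  refine ⟨r, hq.trans hqr, fun M' _ W' v' hW' => ?_⟩
  have hj' := fun i => hj i M' W' v' (hW'.mono hqr)
  obtain ⟨W, hW, hv, -, -, hA⟩ := hW'
  have hjW := fun i => hj i M W v (copies_self hW hv)
  have hT := hA T (by simp [r])
  rwa [holds_rel_iff hjW, holds_rel_iff hj', ← Formula.realize_rel, ← Formula.realize_rel] at hT

theorem exists_determines {θ : S.lang.Formula X} (hθ : θ.IsQF) (p : Condition M) :
    ∃ q ≥ p, Determines f v θ q := by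
  let free : X ⊕ Fin 0 → X := Sum.elim id Fin.elim0
  have realize_free {M : Type} [S.lang.Structure M] (t : S.lang.Term (X ⊕ Fin 0)) (v : X → M) :
      (t.relabel free).realize v = t.realize (Sum.elim v default) := by
    have hv : v ∘ free = Sum.elim v default :=
      funext fun x => x.rec (fun _ => rfl) fun i => i.elim0
    rw [Term.realize_relabel, hv]
  induction hθ generalizing p with
  | falsum => exact ⟨p, le_rfl, fun _ _ _ _ _ => Iff.rfl⟩
  | of_isAtomic h =>
    cases h with
    | equal t₁ t₂ =>
      obtain ⟨q, hq, h⟩ := exists_determines_equal (f := f) (v := v)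
        (t₁.relabel free) (t₂.relabel free) p
      refine ⟨q, hq, fun M' _ W' v' hW' => ?_⟩
      have := h M' W' v' hW'
      rw [Formula.realize_equal, Formula.realize_equal] at this
      simpa only [Formula.Realize, BoundedFormula.realize_bdEqual, realize_free] using this
    | rel R ts =>
      obtain ⟨q, hq, h⟩ := exists_determines_rel (f := f) (v := v) R
        (fun i => (ts i).relabel free) p
      refine ⟨q, hq, fun M' _ W' v' hW' => ?_⟩
      have := h M' W' v' hW'
      rw [Formula.realize_rel, Formula.realize_rel] at this
      simpa only [Formula.Realize, BoundedFormula.realize_rel, realize_free] using this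
  | imp _ _ ih₁ ih₂ =>
    obtain ⟨q, hq, h₁⟩ := ih₁ p
    obtain ⟨r, hr, h₂⟩ := ih₂ q
    exact ⟨r, hq.trans hr, fun M' _ W' v' hW' =>
      imp_congr (h₁ M' W' v' (hW'.mono hr)) (h₂ M' W' v' hW')⟩

end Determined

/-! ### Primitive recursive functions -/

section Primrec

variable {α β γ σ : Type*} [Primcodable α] [Primcodable β] [Primcodable γ] [Primcodable σ]

attribute [fun_prop] Primrec PrimrecPred Primrec.id Primrec.const Primrec.comp

@[fun_prop] theorem primrec_fst {f : α → β × γ} (hf : Primrec f) : Primrec fun a => (f a).1 :=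
  Primrec.fst.comp hf

@[fun_prop] theorem primrec_snd {f : α → β × γ} (hf : Primrec f) : Primrec fun a => (f a).2 :=
  Primrec.snd.comp hf

@[fun_prop] theorem primrec_mk {f : α → β} {g : α → γ} (hf : Primrec f) (hg : Primrec g) :
    Primrec fun a => (f a, g a) := hf.pair hg

@[fun_prop] theorem primrec_add {f g : α → ℕ} (hf : Primrec f) (hg : Primrec g) :
    Primrec fun a => f a + g a := Primrec.nat_add.comp hf hg

@[fun_prop] theorem primrec_sub {f g : α → ℕ} (hf : Primrec f) (hg : Primrec g) :
    Primrec fun a => f a - g a := Primrec.nat_sub.comp hf hg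

@[fun_prop] theorem primrec_mul {f g : α → ℕ} (hf : Primrec f) (hg : Primrec g) :
    Primrec fun a => f a * g a := Primrec.nat_mul.comp hf hg

@[fun_prop] theorem primrec_div {f g : α → ℕ} (hf : Primrec f) (hg : Primrec g) :
    Primrec fun a => f a / g a := Primrec.nat_div.comp hf hg

@[fun_prop] theorem primrec_mod {f g : α → ℕ} (hf : Primrec f) (hg : Primrec g) :
    Primrec fun a => f a % g a := Primrec.nat_mod.comp hf hg

@[fun_prop] theorem primrec_pow {f g : α → ℕ} (hf : Primrec f) (hg : Primrec g) :
    Primrec fun a => f a ^ g a := (Primrec₂.unpaired'.1 Nat.Primrec.pow).comp hf hg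

@[fun_prop] theorem primrec_natPair {f g : α → ℕ} (hf : Primrec f) (hg : Primrec g) :
    Primrec fun a => Nat.pair (f a) (g a) := Primrec₂.natPair.comp hf hg

@[fun_prop] theorem primrec_unpair {f : α → ℕ} (hf : Primrec f) :
    Primrec fun a => Nat.unpair (f a) := Primrec.unpair.comp hf

@[fun_prop] theorem primrec_encode {f : α → β} (hf : Primrec f) :
    Primrec fun a => Encodable.encode (f a) := Primrec.encode.comp hf

@[fun_prop] theorem primrec_ofNat {δ : Type*} [Denumerable δ] {f : α → ℕ} (hf : Primrec f) :
    Primrec fun a => Denumerable.ofNat δ (f a) := (Primrec.ofNat δ).comp hf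

@[fun_prop] theorem primrec_some {f : α → β} (hf : Primrec f) : Primrec fun a => some (f a) :=
  Primrec.option_some.comp hf

@[fun_prop] theorem primrec_option_map {f : α → Option β} {g : α → β → γ} (hf : Primrec f)
    (hg : Primrec fun p : α × β => g p.1 p.2) : Primrec fun a => (f a).map (g a) :=
  Primrec.option_map hf hg

@[fun_prop] theorem primrec_toList {f : α → Option β} (hf : Primrec f) :
    Primrec fun a => (f a).toList := Primrec.optionToList.comp hf

@[fun_prop] theorem primrec_list_map {f : α → List β} {g : α → β → γ} (hf : Primrec f)
    (hg : Primrec fun p : α × β => g p.1 p.2) : Primrec fun a => (f a).map (g a) :=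
  Primrec.list_map hf hg

@[fun_prop] theorem primrec_filterMap {f : α → List β} {g : α → β → Option γ} (hf : Primrec f)
    (hg : Primrec fun p : α × β => g p.1 p.2) : Primrec fun a => (f a).filterMap (g a) :=
  Primrec.listFilterMap hf hg

@[fun_prop] theorem primrec_length {f : α → List β} (hf : Primrec f) :
    Primrec fun a => (f a).length := Primrec.list_length.comp hf

@[fun_prop] theorem primrec_reverse {f : α → List β} (hf : Primrec f) :
    Primrec fun a => (f a).reverse := Primrec.list_reverse.comp hf

@[fun_prop] theorem primrec_getElem? {f : α → List β} {g : α → ℕ} (hf : Primrec f)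
    (hg : Primrec g) : Primrec fun a => (f a)[g a]? := Primrec.list_getElem?.comp hf hg

@[fun_prop] theorem primrec_append {f g : α → List β} (hf : Primrec f) (hg : Primrec g) :
    Primrec fun a => f a ++ g a := Primrec.list_append.comp hf hg

@[fun_prop] theorem primrec_cons {f : α → β} {g : α → List β} (hf : Primrec f) (hg : Primrec g) :
    Primrec fun a => f a :: g a := Primrec.list_cons.comp hf hg

@[fun_prop] theorem primrec_range {f : α → ℕ} (hf : Primrec f) :
    Primrec fun a => List.range (f a) := Primrec.list_range.comp hf

@[fun_prop] theorem primrec_tail {f : α → List β} (hf : Primrec f) :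
    Primrec fun a => (f a).tail := Primrec.list_tail.comp hf

@[fun_prop] theorem primrec_headI [Inhabited β] {f : α → List β} (hf : Primrec f) :
    Primrec fun a => (f a).headI := Primrec.list_headI.comp hf

@[fun_prop] theorem primrec_ite {p : α → Prop} [DecidablePred p] {f g : α → β}
    (hp : PrimrecPred p) (hf : Primrec f) (hg : Primrec g) :
    Primrec fun a => if p a then f a else g a := Primrec.ite hp hf hg

@[fun_prop] theorem primrec_not {f : α → Bool} (hf : Primrec f) : Primrec fun a => !(f a) :=
  Primrec.not.comp hf

@[fun_prop] theorem primrecPred_eq {f g : α → β} (hf : Primrec f) (hg : Primrec g) :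
    PrimrecPred fun a => f a = g a := Primrec.eq.comp hf hg

@[fun_prop] theorem primrecPred_lt {f g : α → ℕ} (hf : Primrec f) (hg : Primrec g) :
    PrimrecPred fun a => f a < g a := Primrec.nat_lt.comp hf hg

@[fun_prop] theorem primrecPred_and {p q : α → Prop} (hp : PrimrecPred p) (hq : PrimrecPred q) :
    PrimrecPred fun a => p a ∧ q a := hp.and hq

@[fun_prop] theorem primrecPred_or {p q : α → Prop} (hp : PrimrecPred p) (hq : PrimrecPred q) :
    PrimrecPred fun a => p a ∨ q a := hp.or hq

@[fun_prop] theorem primrecPred_not {p : α → Prop} (hp : PrimrecPred p) :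
    PrimrecPred fun a => ¬ p a := hp.not

@[fun_prop] theorem primrecPred_true : PrimrecPred fun _ : α => True :=
  ⟨inferInstance, Primrec.const _⟩

/-- Universal quantification over a list, as a combinator on predicates, so that `fun_prop` can
decompose it. -/
def AllMem {β : Type*} (l : List β) (P : β → Prop) : Prop := ∀ b ∈ l, P b

@[fun_prop] theorem primrecPred_allMem {f : α → List β} {P : α → β → Prop} (hf : Primrec f)
    (hP : PrimrecPred fun p : α × β => P p.1 p.2) : PrimrecPred fun a => AllMem (f a) (P a) :=
  PrimrecRel.comp (R := fun l a => AllMem l (P a))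
    (PrimrecRel.forall_mem_list
      (hP.comp (f := fun p : β × α => (p.2, p.1)) (Primrec.snd.pair Primrec.fst)))
    hf Primrec.id

end Primrec

/-! ### Partial computable functions -/

open Nat.Partrec (Code)

/-- The result of `st` steps of the computation of the `e`-th partial computable function. -/
def phiSteps (st e n : ℕ) : Option ℕ := Code.evaln st (Denumerable.ofNat Code e) n

@[fun_prop] theorem primrec_phiSteps {α : Type*} [Primcodable α] {f g h : α → ℕ} (hf : Primrec f)
    (hg : Primrec g) (hh : Primrec h) : Primrec fun a => phiSteps (f a) (g a) (h a) :=
  Code.primrec_evaln.comp ((hf.pair ((Primrec.ofNat Code).comp hg)).pair hh)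

theorem phiSteps_mono {st st' e n v : ℕ} (h : phiSteps st e n = some v) (hst : st ≤ st') :
    phiSteps st' e n = some v := Code.evaln_mono hst h

theorem phi_eq_some_iff {e n v : ℕ} : phi e n = Part.some v ↔ ∃ st, phiSteps st e n = some v :=
  Part.eq_some_iff.trans Code.evaln_complete

theorem eventually_phiSteps {e n v : ℕ} (h : phi e n = Part.some v) :
    ∀ᶠ st in Filter.atTop, phiSteps st e n = some v := by
  obtain ⟨k, hk⟩ := phi_eq_some_iff.1 h
  filter_upwards [Filter.eventually_ge_atTop k] with st hst
  exact phiSteps_mono hk hst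

theorem forall_mem_phi_eq_some_iff {β : Type*} {l : List β} {e v : ℕ} {n : β → ℕ} :
    (∀ b ∈ l, phi e (n b) = Part.some v) ↔
      ∃ st, AllMem l fun b => phiSteps st e (n b) = some v := by
  refine ⟨fun h => ?_, fun ⟨st, h⟩ b hb => phi_eq_some_iff.2 ⟨st, h b hb⟩⟩
  induction l with
  | nil => exact ⟨0, fun b hb => absurd hb List.not_mem_nil⟩
  | cons b l ih =>
    obtain ⟨s, hs⟩ := ih fun b hb => h b (List.mem_cons_of_mem _ hb)
    obtain ⟨t, ht⟩ := phi_eq_some_iff.1 (h b List.mem_cons_self)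
    refine ⟨max s t, List.forall_mem_cons.2 ⟨phiSteps_mono ht (le_max_right _ _), ?_⟩⟩
    exact fun b hb => phiSteps_mono (hs b hb) (le_max_left _ _)

/-- The parametrization (s-m-n) theorem. -/
theorem exists_primrec_phi_eq {α : Type*} [Primcodable α] {f : α × ℕ →. ℕ} (hf : Partrec f) :
    ∃ g : α → ℕ, Primrec g ∧ ∀ a n, phi (g a) n = f (a, n) := by
  obtain ⟨c, hc⟩ := Code.exists_code.1 hf
  refine ⟨fun a => Encodable.encode (Code.curry c (Encodable.encode a)),
    Primrec.encode.comp (Code.primrec₂_curry.comp (Primrec.const c) Primrec.encode),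
    fun a n => ?_⟩
  rw [phi, Denumerable.ofNat_encode, Code.eval_curry]
  refine (congrFun hc (Encodable.encode (a, n))).trans ?_
  simp only [Encodable.encodek, Part.coe_some, Part.bind_some]
  exact Part.map_id' (fun _ => rfl) _

/-- Kleene's recursion theorem. -/
theorem exists_phi_eq_phi {g : ℕ → ℕ} (hg : Computable g) : ∃ e, phi (g e) = phi e := by
  obtain ⟨c, hc⟩ := Code.fixed_point (f := fun c => Denumerable.ofNat _ (g (Encodable.encode c)))
    ((Computable.ofNat _).comp (hg.comp Computable.encode))
  exact ⟨Encodable.encode c, by rw [phi, phi, hc, Denumerable.ofNat_encode]⟩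

/-! ### Effectively closed classes -/

/-- `F` satisfies the finite condition `L`. -/
def Satisfies (F : ℕ → ℕ) (L : List (ℕ × ℕ)) : Prop := ∀ p ∈ L, F p.1 = p.2

theorem satisfies_append {F : ℕ → ℕ} {L L' : List (ℕ × ℕ)} :
    Satisfies F (L ++ L') ↔ Satisfies F L ∧ Satisfies F L' :=
  List.forall_mem_append

/-- `F` satisfies none of the finite conditions that are values of the `e`-th partial computable
function. As `e` varies, these are the `Π⁰₁` classes of Baire space. -/
def Avoids (e : ℕ) (F : ℕ → ℕ) : Prop :=
  ∀ k r, phi e k = Part.some r → ¬ Satisfies F (Denumerable.ofNat (List (ℕ × ℕ)) r)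

/-- The classes `{F | R a F}` are `Π⁰₁`, uniformly in `a`: their members are the functions that
satisfy none of the conditions in a primitive recursive list. -/
def IsPiClass {α : Type*} [Primcodable α] (R : α → (ℕ → ℕ) → Prop) : Prop :=
  ∃ V : α × ℕ → Option (List (ℕ × ℕ)), Primrec V ∧
    ∀ a F, R a F ↔ ∀ k L, V (a, k) = some L → ¬ Satisfies F L

namespace IsPiClass

variable {α β δ : Type*} [Primcodable α] [Primcodable β] [Primcodable δ]
  {Q R : α → (ℕ → ℕ) → Prop}

theorem of_primrec {V : α × δ → Option (List (ℕ × ℕ))} (hV : Primrec V)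
    (h : ∀ a F, R a F ↔ ∀ d L, V (a, d) = some L → ¬ Satisfies F L) : IsPiClass R := by
  refine ⟨fun p => (Encodable.decode (α := δ) p.2).bind fun d => V (p.1, d),
    Primrec.option_bind (Primrec.decode.comp Primrec.snd) (hV.comp (by fun_prop)),
    fun a F => (h a F).trans ⟨fun H k L hL => ?_, fun H d L hL => ?_⟩⟩
  · obtain ⟨d, -, hd⟩ := Option.bind_eq_some_iff.1 hL
    exact H d L hd
  · exact H (Encodable.encode d) L (by simpa using hL)

theorem congr (hQ : IsPiClass Q) (h : ∀ a F, R a F ↔ Q a F) : IsPiClass R := by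
  obtain ⟨V, hV, hQV⟩ := hQ
  exact ⟨V, hV, fun a F => (h a F).trans (hQV a F)⟩

theorem comp {R : β → (ℕ → ℕ) → Prop} (hR : IsPiClass R) {f : α → β} (hf : Primrec f) :
    IsPiClass fun a => R (f a) := by
  obtain ⟨V, hV, h⟩ := hR
  exact ⟨fun p => V (f p.1, p.2), hV.comp (by fun_prop), fun a => h (f a)⟩

open Classical in
theorem of_primrecPred {p : α → Prop} (hp : PrimrecPred p) : IsPiClass fun a _ => p a := by
  refine of_primrec (δ := Unit) (V := fun x => if p x.1 then none else some [])
    (Primrec.ite (hp.comp Primrec.fst) (Primrec.const _) (Primrec.const _)) fun a F => ?_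
  by_cases h : p a <;> simp [h, Satisfies]

theorem not_satisfies {L : α → List (ℕ × ℕ)} (hL : Primrec L) :
    IsPiClass fun a F => ¬ Satisfies F (L a) :=
  of_primrec (δ := Unit) (V := fun p => some (L p.1)) (by fun_prop) fun a F => by simp

theorem not_apply_eq {n v : α → ℕ} (hn : Primrec n) (hv : Primrec v) :
    IsPiClass fun a F => ¬ F (n a) = v a :=
  (not_satisfies (L := fun a => [(n a, v a)]) (by fun_prop)).congr fun a F => by simp [Satisfies]

theorem all {R : α → β → (ℕ → ℕ) → Prop} (hR : IsPiClass fun p : α × β => R p.1 p.2) :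
    IsPiClass fun a F => ∀ b, R a b F := by
  obtain ⟨V, hV, h⟩ := hR
  exact of_primrec (δ := β × ℕ) (V := fun p => V ((p.1, p.2.1), p.2.2))
    (hV.comp (by fun_prop)) fun a F => by simp only [h (a, _), Prod.forall]

theorem and (hQ : IsPiClass Q) (hR : IsPiClass R) : IsPiClass fun a F => Q a F ∧ R a F := by
  obtain ⟨V, hV, hQV⟩ := hQ
  obtain ⟨W, hW, hRW⟩ := hR
  refine of_primrec (δ := Bool × ℕ)
    (V := fun p => if p.2.1 = true then V (p.1, p.2.2) else W (p.1, p.2.2)) ?_ fun a F => ?_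
  · exact Primrec.ite (by fun_prop) (hV.comp (by fun_prop)) (hW.comp (by fun_prop))
  · simp [hQV, hRW, and_comm]

theorem or (hQ : IsPiClass Q) (hR : IsPiClass R) : IsPiClass fun a F => Q a F ∨ R a F := by
  obtain ⟨V, hV, hQV⟩ := hQ
  obtain ⟨W, hW, hRW⟩ := hR
  refine of_primrec (δ := ℕ × ℕ) (V := fun p => (V (p.1, p.2.1)).bind fun L =>
    (W (p.1, p.2.2)).map fun L' => L ++ L') ?_ fun a F => ?_
  · refine Primrec.option_bind (hV.comp (by fun_prop)) (Primrec.option_map (hW.comp ?_) ?_)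
    · fun_prop
    · exact Primrec.list_append.comp (by fun_prop) (by fun_prop)
  · rw [hQV, hRW]
    constructor
    · rintro h ⟨k, l⟩ M hM hF
      obtain ⟨L, hL, L', hL', rfl⟩ : ∃ L, V (a, k) = some L ∧ ∃ L', W (a, l) = some L' ∧
          L ++ L' = M := by simpa [Option.bind_eq_some_iff] using hM
      obtain ⟨h₁, h₂⟩ := satisfies_append.1 hF
      exact h.elim (fun h => h k L hL h₁) fun h => h l L' hL' h₂
    · refine fun h => or_iff_not_imp_left.2 fun hn l L' hL' hF' => hn fun k L hL hF => ?_
      exact h (k, l) (L ++ L') (by simp [hL, hL']) (satisfies_append.2 ⟨hF, hF'⟩)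

theorem imp (hQ : IsPiClass fun a F => ¬ Q a F) (hR : IsPiClass R) :
    IsPiClass fun a F => Q a F → R a F :=
  (hQ.or hR).congr fun _ _ => imp_iff_not_or

/-- The value of `F` may be substituted for a variable. -/
theorem apply {R : α → ℕ → (ℕ → ℕ) → Prop} (hR : IsPiClass fun p : α × ℕ => R p.1 p.2)
    {n : α → ℕ} (hn : Primrec n) : IsPiClass fun a F => R a (F (n a)) F :=
  (IsPiClass.all (R := fun a v F => F (n a) = v → R a v F)
    ((not_apply_eq (by fun_prop) (by fun_prop)).imp hR)).congr fun a F => by simp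

theorem map_apply {R : α → List ℕ → (ℕ → ℕ) → Prop}
    (hR : IsPiClass fun p : α × List ℕ => R p.1 p.2) {l : α → List ℕ} (hl : Primrec l) :
    IsPiClass fun a F => R a ((l a).map F) F := by
  refine (IsPiClass.all (R := fun a (L : List (ℕ × ℕ)) F =>
    (L.map fun p => p.1) = l a → Satisfies F L → R a (L.map fun p => p.2) F) ?_).congr
      fun a F => ⟨fun h L hL hF => ?_, fun h => ?_⟩
  · refine imp (of_primrecPred (by fun_prop)) (imp (not_satisfies (by fun_prop)) ?_)
    exact hR.comp (f := fun p : α × List (ℕ × ℕ) => (p.1, p.2.map fun q => q.2)) (by fun_prop)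
  · rw [← hL, List.map_map] at h
    rwa [← List.map_congr_left hF]
  · simpa [Satisfies, Function.comp_def] using h ((l a).map fun n => (n, F n))

theorem exists_avoids_iff (hR : IsPiClass R) :
    ∃ g : α → ℕ, Primrec g ∧ ∀ a F, Avoids (g a) F ↔ R a F := by
  obtain ⟨V, hV, h⟩ := hR
  obtain ⟨g, hg, hgV⟩ := exists_primrec_phi_eq
    (f := fun p => Part.ofOption ((V p).map fun L => Encodable.encode L))
    (Computable.ofOption (by fun_prop : Primrec _).to_comp)
  refine ⟨g, hg, fun a F => Iff.trans ?_ (h a F).symm⟩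
  simp only [Avoids, hgV, Part.eq_some_iff, Part.mem_ofOption, Option.mem_def,
    Option.map_eq_some_iff]
  refine forall_congr' fun k => ⟨fun H L hL => ?_, ?_⟩
  · simpa using H _ ⟨L, hL, rfl⟩
  · rintro H _ ⟨L, hL, rfl⟩
    simpa using H L hL

theorem exists_avoids_self_iff {R : ℕ → (ℕ → ℕ) → Prop} (hR : IsPiClass R) :
    ∃ e, ∀ F, Avoids e F ↔ R e F := by
  obtain ⟨g, hg, h⟩ := hR.exists_avoids_iff
  obtain ⟨e, he⟩ := exists_phi_eq_phi hg.to_comp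
  exact ⟨e, fun F => by rw [← h, Avoids, Avoids, he]⟩

theorem not_phi_eq {e n v : α → ℕ} (he : Primrec e) (hn : Primrec n) (hv : Primrec v) :
    IsPiClass fun a _ => ¬ phi (e a) (n a) = Part.some (v a) := by
  refine (IsPiClass.all (R := fun a st _ => ¬ phiSteps st (e a) (n a) = some (v a))
    (of_primrecPred (by fun_prop))).congr fun a _ => ?_
  simp only [phi_eq_some_iff, not_exists]

end IsPiClass

/-! ### Trees -/

/-- The list of the first `n` values of `F`. -/
def initSeg (F : ℕ → ℕ) (n : ℕ) : List ℕ := (List.range n).map F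

theorem length_initSeg (F : ℕ → ℕ) (n : ℕ) : (initSeg F n).length = n := by simp [initSeg]

theorem initSeg_succ (F : ℕ → ℕ) (n : ℕ) : initSeg F (n + 1) = initSeg F n ++ [F n] := by
  simp [initSeg, List.range_succ]

theorem initSeg_getElem?_eq_some {F : ℕ → ℕ} {n q v : ℕ} :
    (initSeg F n)[q]? = some v ↔ q < n ∧ F q = v := by
  simp [initSeg, List.getElem?_eq_some_iff]

/-- The tree of finite sequences that have not been seen to satisfy a condition of the `e`-th
class. -/
def InTree (e : ℕ) (l : List ℕ) : Prop :=
  AllMem (List.range l.length) fun k => AllMem (phiSteps l.length e k).toList fun r =>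
    ¬ AllMem (Denumerable.ofNat (List (ℕ × ℕ)) r) fun p => l[p.1]? = some p.2

@[fun_prop] theorem primrecPred_inTree {α : Type*} [Primcodable α] {f : α → ℕ} {g : α → List ℕ}
    (hf : Primrec f) (hg : Primrec g) : PrimrecPred fun a => InTree (f a) (g a) := by
  unfold InTree
  fun_prop

theorem inTree_iff {e : ℕ} {l : List ℕ} : InTree e l ↔ ∀ k < l.length, ∀ r,
    phiSteps l.length e k = some r →
      ¬ ∀ p ∈ Denumerable.ofNat (List (ℕ × ℕ)) r, l[p.1]? = some p.2 := by
  simp [InTree, AllMem]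

theorem InTree.of_isPrefix {e : ℕ} {l l' : List ℕ} (h : InTree e l) (hl : l' <+: l) :
    InTree e l' := by
  rw [inTree_iff] at h ⊢
  intro k hk r hr hc
  refine h k (hk.trans_le hl.length_le) r (phiSteps_mono hr hl.length_le) fun p hp => ?_
  obtain ⟨t, rfl⟩ := hl
  have := hc p hp
  rw [List.getElem?_append_left (List.getElem?_eq_some_iff.1 this).1, this]

theorem avoids_iff_inTree {e : ℕ} {F : ℕ → ℕ} : Avoids e F ↔ ∀ n, InTree e (initSeg F n) := by
  simp only [inTree_iff, length_initSeg, initSeg_getElem?_eq_some]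
  constructor
  · intro h n k _ r hr hc
    exact h k r (phi_eq_some_iff.2 ⟨_, hr⟩) fun p hp => (hc p hp).2
  · intro h k r hr hs
    obtain ⟨n, h1, h2, h3⟩ := ((eventually_phiSteps hr).and
      ((Filter.eventually_gt_atTop k).and (Filter.eventually_gt_atTop
        (((Denumerable.ofNat (List (ℕ × ℕ)) r).map Prod.fst).foldr max 0)))).exists
    refine h n k h2 r h1 fun p hp => ⟨lt_of_le_of_lt ?_ h3, hs p hp⟩
    exact List.le_max_of_le (List.mem_map_of_mem hp) le_rfl

/-! ### The Kleene-Brouwer order -/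

/-- The Kleene-Brouwer order of finite sequences. -/
def KB : List ℕ → List ℕ → Prop
  | [], _ => False
  | _ :: _, [] => True
  | a :: l, b :: m => a < b ∨ a = b ∧ KB l m

theorem kb_trichotomous (l m : List ℕ) (h1 : ¬ KB l m) (h2 : ¬ KB m l) : l = m := by
  induction l generalizing m with
  | nil => cases m <;> simp_all [KB]
  | cons a l ih =>
    cases m with
    | nil => simp [KB] at h1
    | cons b m =>
      simp only [KB, not_or, not_and, not_lt] at h1 h2
      obtain rfl := le_antisymm h2.1 h1.1
      rw [ih m (h1.2 rfl) (h2.2 rfl)]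

theorem kb_append_singleton (l : List ℕ) (a : ℕ) : KB (l ++ [a]) l := by
  induction l with
  | nil => simp [KB]
  | cons b l ih => simp [KB, ih]

theorem kb_iff (l m : List ℕ) : KB l m ↔ ¬ AllMem (List.range l.length) fun i =>
    ¬ (AllMem (List.range i) (fun j => l[j]? = m[j]?) ∧
      (m[i]? = none ∨ l[i]?.getD 0 < m[i]?.getD 0)) := by
  simp only [AllMem, List.mem_range, not_forall, not_not, exists_prop]
  induction l generalizing m with
  | nil => simp [KB]
  | cons a l ih =>
    cases m with
    | nil => simpa [KB] using ⟨0, by simp⟩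
    | cons b m =>
      simp only [KB, ih m]
      constructor
      · rintro (h | ⟨rfl, i, hi, hij, h⟩)
        · exact ⟨0, by simp [h]⟩
        · refine ⟨i + 1, by simpa using hi, fun j hj => ?_, by simpa using h⟩
          cases j with
          | zero => simp
          | succ j => simpa using hij j (by lia)
      · rintro ⟨i, hi, hij, h⟩
        cases i with
        | zero => exact Or.inl (by simpa using h)
        | succ i =>
          refine Or.inr ⟨by simpa using hij 0 (by lia), i, by simpa using hi, fun j hj => ?_,
            by simpa using h⟩
          simpa using hij (j + 1) (by lia)

@[fun_prop] theorem primrecPred_kb {α : Type*} [Primcodable α] {f g : α → List ℕ}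
    (hf : Primrec f) (hg : Primrec g) : PrimrecPred fun a => KB (f a) (g a) := by
  have hD : ∀ {β : Type _} [Primcodable β] {h : β → Option ℕ}, Primrec h →
      Primrec fun b => (h b).getD 0 := fun h => Primrec.option_getD.comp h (Primrec.const 0)
  simp only [kb_iff]
  have : PrimrecPred fun p : α × ℕ => (f p.1)[p.2]?.getD 0 < (g p.1)[p.2]?.getD 0 :=
    primrecPred_lt (hD (by fun_prop)) (hD (by fun_prop))
  fun_prop

theorem wellFoundedOn_kb_of_cons {X : Set (List ℕ)}
    (h : ∀ n, {l | n :: l ∈ X}.WellFoundedOn KB) : X.WellFoundedOn KB := by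
  have cons : ∀ n l (hl : n :: l ∈ X), Acc (fun a b : X => KB a b) ⟨n :: l, hl⟩ := by
    intro n
    induction n using Nat.strong_induction_on with
    | _ n ihn =>
      intro l hl
      have key : ∀ p : {l | n :: l ∈ X}, Acc (fun a b : X => KB a b) ⟨n :: p.1, p.2⟩ := by
        intro p
        refine WellFounded.induction (C := fun p : {l | n :: l ∈ X} =>
          Acc (fun a b : X => KB a b) ⟨n :: p.1, p.2⟩) (h n) p fun p ihp => ⟨_, ?_⟩
        rintro ⟨y, hy⟩ hyp
        cases y with
        | nil => simp [KB] at hyp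
        | cons m y =>
          simp only [KB] at hyp
          rcases hyp with hm | ⟨rfl, hyp⟩
          · exact ihn m hm y hy
          · exact ihp ⟨y, hy⟩ hyp
      exact key ⟨l, hl⟩
  refine ⟨?_⟩
  rintro ⟨x, hx⟩
  refine ⟨_, ?_⟩
  rintro ⟨y, hy⟩ hyx
  cases y with
  | nil => simp [KB] at hyx
  | cons m y => exact cons m y hy

theorem exists_path_of_not_wellFoundedOn_kb {X : Set (List ℕ)}
    (hX : ∀ l ∈ X, ∀ l', l' <+: l → l' ∈ X) (h : ¬ X.WellFoundedOn KB) :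
    ∃ F : ℕ → ℕ, ∀ n, initSeg F n ∈ X := by
  let G := {l : List ℕ // ¬ {m | l ++ m ∈ X}.WellFoundedOn KB}
  have step : ∀ l : G, ∃ n, ¬ {m | (l.1 ++ [n]) ++ m ∈ X}.WellFoundedOn KB := by
    intro l
    by_contra hc
    push Not at hc
    refine l.2 (wellFoundedOn_kb_of_cons fun n => ?_)
    simpa using hc n
  choose nx hnx using step
  let g : ℕ → G := fun n => n.rec ⟨[], by simpa using h⟩ fun _ l => ⟨l.1 ++ [nx l], hnx l⟩
  have hg : ∀ n, initSeg (fun k => nx (g k)) n = (g n).1 := by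
    intro n
    induction n with
    | zero => rfl
    | succ n ih => rw [initSeg_succ, ih]
  refine ⟨fun k => nx (g k), fun n => ?_⟩
  rw [hg]
  by_contra hc
  refine (g n).2 ?_
  have : {m | (g n).1 ++ m ∈ X} = ∅ := by
    ext m
    simpa using fun hm => hc (hX _ hm _ (List.prefix_append _ _))
  rw [this]
  exact Set.wellFoundedOn_empty _

/-! ### Initial segments of the computable ordinals -/

theorem partrec_phi : Partrec fun p : ℕ × ℕ => phi p.1 p.2 :=
  Nat.Partrec.Code.eval_part.comp ((Computable.ofNat _).comp Computable.fst) Computable.snd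

/-- The elements of a well-order that precede `x`. -/
def below {S : Set ℕ} (r : S → S → Prop) (x : S) : Set ℕ := {y | ∃ h : y ∈ S, r ⟨y, h⟩ x}

/-- The restriction of `r` to the elements that precede `x`. -/
def belowRel {S : Set ℕ} (r : S → S → Prop) (x : S) (y z : below r x) : Prop :=
  r ⟨y, y.2.1⟩ ⟨z, z.2.1⟩

/-- The elements that precede `x`, as a subset of `ℕ` and as a subtype of the well-order. -/
def belowRelIso {S : Set ℕ} (r : S → S → Prop) (x : S) :
    belowRel r x ≃r Subrel r (r · x) where
  toFun y := ⟨⟨y, y.2.1⟩, y.2.2⟩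
  invFun y := ⟨y.1, y.1.2, y.2⟩
  map_rel_iff' := Iff.rfl

theorem exists_phi_eq_bind_ite (b x : ℕ) : ∃ g, ∀ n, phi g n = (phi b n).bind fun v =>
    phi b (if n.unpair.1 = 0 ∧ v = 1 then Nat.pair 1 (Nat.pair n.unpair.2 x) else n) := by
  have hq : Primrec fun p : (ℕ × ℕ) × ℕ => if p.1.2.unpair.1 = 0 ∧ p.2 = 1 then
      Nat.pair 1 (Nat.pair p.1.2.unpair.2 x) else p.1.2 := by fun_prop
  obtain ⟨g, -, hg⟩ := exists_primrec_phi_eq (α := ℕ)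
    ((partrec_phi.comp ((Computable.const b).pair Computable.snd)).bind
      (partrec_phi.comp ((Computable.const b).pair hq.to_comp)).to₂)
  exact ⟨g 0, hg 0⟩

theorem IsComputableOrdinal.of_lt {α β : Ordinal.{0}} (hβ : IsComputableOrdinal β) (h : α < β) :
    IsComputableOrdinal α := by
  classical
  obtain ⟨b, S, r, _, rfl, hS, hr⟩ := hβ
  obtain ⟨x, rfl⟩ := Ordinal.typein_surj r h
  obtain ⟨g, hg⟩ := exists_phi_eq_bind_ite b x
  have : IsWellOrder (below r x) (belowRel r x) := (belowRelIso r x).toRelEmbedding.isWellOrder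
  refine ⟨g, below r x, belowRel r x, this, ?_, fun y => ?_, fun y z => ?_⟩
  · rw [← Ordinal.type_subrel]
    exact Ordinal.type_eq.2 ⟨belowRelIso r x⟩
  · by_cases hy : y ∈ S
    · simp [hg, hS, hy, below, hr ⟨y, hy⟩ x]
    · simp [hg, hS, hy, below]
  · simp only [hg, hr ⟨y, y.2.1⟩ ⟨z, z.2.1⟩, Part.bind_some, Nat.unpair_pair, one_ne_zero,
      false_and, if_false]
    rfl

theorem IsComputableOrdinal.of_le {α β : Ordinal.{0}} (hβ : IsComputableOrdinal β) (h : α ≤ β) :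
    IsComputableOrdinal α := by
  rcases h.lt_or_eq with h | rfl
  exacts [hβ.of_lt h, hβ]

theorem CodesOrdinal.unique {b : ℕ} {α β : Ordinal.{0}} (hα : CodesOrdinal b α)
    (hβ : CodesOrdinal b β) : α = β := by
  classical
  obtain ⟨S, r, _, rfl, hS, hr⟩ := hα
  obtain ⟨S', r', _, rfl, hS', hr'⟩ := hβ
  obtain rfl : S = S' := by
    ext x
    have := (hS x).symm.trans (hS' x)
    by_cases h : x ∈ S <;> by_cases h' : x ∈ S' <;> simp_all
  obtain rfl : r = r' := by
    funext x y
    have := (hr x y).symm.trans (hr' x y)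
    by_cases h : r x y <;> by_cases h' : r' x y <;> simp_all
  rfl

theorem exists_not_isComputableOrdinal : ∃ β, ¬ IsComputableOrdinal β := by
  by_contra hc
  push Not at hc
  choose c hc using hc
  have hinj : Function.Injective c := fun α β h => (hc α).unique (h ▸ hc β)
  have : Small.{0} Ordinal.{0} := small_of_injective hinj
  have : Small.{0} (Set.univ : Set Ordinal.{0}) := inferInstance
  exact not_bddAbove_univ (Ordinal.bddAbove_of_small (s := Set.univ))

theorem IsComputableOrdinal.lt_omegaOneCK {β : Ordinal.{0}} (h : IsComputableOrdinal β) :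
    β < omegaOneCK := by
  have hm : ¬ IsComputableOrdinal omegaOneCK := csInf_mem exists_not_isComputableOrdinal
  by_contra hc
  exact hm (h.of_le (not_lt.1 hc))

/-! ### The Kleene-Brouwer orders of the trees -/

open Classical in
theorem exists_kbIndex : ∃ b : ℕ → ℕ, Primrec b ∧ ∀ e x,
    phi (b e) (Nat.pair 0 x) = Part.some (if InTree e (Denumerable.ofNat _ x) then 1 else 0) ∧
    ∀ y, phi (b e) (Nat.pair 1 (Nat.pair x y)) =
      Part.some (if KB (Denumerable.ofNat _ x) (Denumerable.ofNat _ y) then 1 else 0) := by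
  have h : Primrec fun p : ℕ × ℕ => if p.2.unpair.1 = 0 then
      (if InTree p.1 (Denumerable.ofNat _ p.2.unpair.2) then 1 else 0)
      else (if KB (Denumerable.ofNat _ p.2.unpair.2.unpair.1)
        (Denumerable.ofNat _ p.2.unpair.2.unpair.2) then 1 else 0) := by fun_prop
  obtain ⟨b, hb, hbe⟩ := exists_primrec_phi_eq (f := _) h.to_comp
  exact ⟨b, hb, fun e x => ⟨by simp [hbe], fun y => by simp [hbe]⟩⟩

/-- An index of the Kleene-Brouwer order of the `e`-th tree. -/
def kbIndex : ℕ → ℕ := exists_kbIndex.choose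

theorem primrec_kbIndex : Primrec kbIndex := exists_kbIndex.choose_spec.1

open Classical in
theorem phi_kbIndex_zero (e x : ℕ) : phi (kbIndex e) (Nat.pair 0 x) =
    Part.some (if InTree e (Denumerable.ofNat _ x) then 1 else 0) :=
  (exists_kbIndex.choose_spec.2 e x).1

open Classical in
theorem phi_kbIndex_one (e x y : ℕ) : phi (kbIndex e) (Nat.pair 1 (Nat.pair x y)) =
    Part.some (if KB (Denumerable.ofNat _ x) (Denumerable.ofNat _ y) then 1 else 0) :=
  (exists_kbIndex.choose_spec.2 e x).2 y

theorem exists_codesOrdinal_kbIndex {e : ℕ} (h : ¬ ∃ F, Avoids e F) :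
    ∃ β, CodesOrdinal (kbIndex e) β := by
  have hwf : {l | InTree e l}.WellFoundedOn KB := by
    by_contra hc
    obtain ⟨F, hF⟩ := exists_path_of_not_wellFoundedOn_kb (fun l hl l' => hl.of_isPrefix) hc
    exact h ⟨F, avoids_iff_inTree.2 hF⟩
  let S : Set ℕ := {x | InTree e (Denumerable.ofNat _ x)}
  let r : S → S → Prop := fun x y => KB (Denumerable.ofNat _ x.1) (Denumerable.ofNat _ y.1)
  have wf : WellFounded r := InvImage.wf (fun x : S => (⟨Denumerable.ofNat _ x.1, x.2⟩ :
    {l | InTree e l})) hwf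
  have : IsWellOrder S r :=
    { wf := wf
      trichotomous := fun x y h1 h2 => by
        have := kb_trichotomous _ _ h1 h2
        exact Subtype.ext ((Denumerable.eqv (List ℕ)).symm.injective this) }
  exact ⟨_, S, r, this, rfl, phi_kbIndex_zero e, fun x y => phi_kbIndex_one e x y⟩

/-! ### Binary digits -/

/-- The binary digit of `x` at `i`. -/
def digit (x i : ℕ) : ℕ := x / 2 ^ i % 2

@[fun_prop] theorem primrec_digit {α : Type*} [Primcodable α] {f g : α → ℕ} (hf : Primrec f)
    (hg : Primrec g) : Primrec fun a => digit (f a) (g a) := by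
  unfold digit
  fun_prop

theorem digit_eq_one_iff {x i : ℕ} : digit x i = 1 ↔ x.testBit i = true := by
  simp [digit, Nat.testBit_eq_decide_div_mod_eq]

theorem lt_of_digit_eq_one {x i : ℕ} (h : digit x i = 1) : i < x :=
  i.lt_two_pow_self.trans_le (Nat.ge_two_pow_of_testBit (digit_eq_one_iff.1 h))

theorem digit_eq_zero_or_one (x i : ℕ) : digit x i = 0 ∨ digit x i = 1 :=
  Nat.mod_two_eq_zero_or_one _

theorem digit_xor_two_pow_eq_one {x p i : ℕ} :
    digit (x ^^^ 2 ^ p) i = 1 ↔ (digit x i = 1 ↔ i ≠ p) := by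
  rw [digit_eq_one_iff, digit_eq_one_iff, Nat.testBit_xor, Nat.testBit_two_pow]
  by_cases h : p = i
  · subst h; simp
  · simp [h, Ne.symm h]

open Classical in
theorem digit_xor_two_pow (x p j : ℕ) :
    digit (x ^^^ 2 ^ p) j = (digit x j + if p = j then 1 else 0) % 2 := by
  have h := digit_xor_two_pow_eq_one (x := x) (p := p) (i := j)
  have h1 := digit_eq_zero_or_one x j
  have h2 := digit_eq_zero_or_one (x ^^^ 2 ^ p) j
  split_ifs with hp
  · subst hp
    simp only [ne_eq, not_true_eq_false, iff_false] at h
    lia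
  · simp only [ne_eq, Ne.symm hp, not_false_eq_true, iff_true] at h
    lia

/-- The number of binary digits `1` of `x` at positions that satisfy `Q`. -/
def digitCount (Q : ℕ → Prop) (x : ℕ) : ℕ := {i | digit x i = 1 ∧ Q i}.ncard

theorem finite_setOf_digit (Q : ℕ → Prop) (x : ℕ) : {i | digit x i = 1 ∧ Q i}.Finite :=
  (Set.finite_lt_nat x).subset fun _ h => lt_of_digit_eq_one h.1

open Classical in
theorem digitCount_eq_length (Q : ℕ → Prop) (x : ℕ) : digitCount Q x =
    ((List.range x).filterMap fun i => if digit x i = 1 ∧ Q i then some i else none).length := by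
  have : {i | digit x i = 1 ∧ Q i} =
      ((Finset.range x).filter fun i => digit x i = 1 ∧ Q i : Finset ℕ) := by
    ext i
    simpa using fun h _ => lt_of_digit_eq_one h
  rw [digitCount, this, Set.ncard_coe_finset, ← Nat.count_eq_card_filter_range, Nat.count,
    List.countP_eq_length_filter, ← List.filterMap_eq_filter]
  simp only [Option.guard, decide_eq_true_eq]

@[fun_prop] theorem primrec_digitCount {α : Type*} [Primcodable α] {Q : α → ℕ → Prop} {f : α → ℕ}
    (hQ : PrimrecPred fun p : α × ℕ => Q p.1 p.2) (hf : Primrec f) :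
    Primrec fun a => digitCount (Q a) (f a) := by
  classical
  simp only [digitCount_eq_length]
  fun_prop

open Classical in
theorem ncard_symmDiff_singleton_mod_two {β : Type*} {s : Set β} (hs : s.Finite) (b : β) :
    (symmDiff s {b}).ncard % 2 = (s.ncard + 1) % 2 := by
  by_cases hb : b ∈ s
  · have : symmDiff s {b} = s \ {b} := symmDiff_of_ge (Set.singleton_subset_iff.2 hb)
    rw [this, ← Set.ncard_sdiff_singleton_add_one hb hs]
    lia
  · have : symmDiff s {b} = insert b s :=
      (Set.disjoint_singleton_right.2 hb).symmDiff_eq_sup.trans Set.union_singleton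
    rw [this, Set.ncard_insert_of_notMem hb hs]

open Classical in
theorem digitCount_xor_two_pow (Q : ℕ → Prop) (x p : ℕ) :
    digitCount Q (x ^^^ 2 ^ p) % 2 = (digitCount Q x + if Q p then 1 else 0) % 2 := by
  simp only [digitCount, digit_xor_two_pow_eq_one]
  split_ifs with hQ
  · rw [← ncard_symmDiff_singleton_mod_two (finite_setOf_digit Q x) p]
    congr 2
    ext i
    rcases eq_or_ne i p with rfl | h <;> simp [Set.mem_symmDiff, *]
  · congr 2
    ext i
    rcases eq_or_ne i p with rfl | h <;> simp [*]

theorem exists_of_digitCount_ne_zero {Q : ℕ → Prop} {x : ℕ} (h : digitCount Q x ≠ 0) :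
    ∃ i, digit x i = 1 ∧ Q i :=
  Set.nonempty_of_ncard_ne_zero h

/-! ### Structures coding a tree

The elements are pairs of a level and a finite set of nodes of that level; the nodes are
represented by the codes of the reversed sequences, and finite sets of numbers by binary digits. -/

/-- The parent of a node. -/
def parent (m : ℕ) : ℕ := Encodable.encode (Denumerable.ofNat (List ℕ) m).tail

@[fun_prop] theorem primrec_parent {α : Type*} [Primcodable α] {f : α → ℕ} (hf : Primrec f) :
    Primrec fun a => parent (f a) := by
  unfold parent
  fun_prop

/-- `m` is a node of level `n` of the `e`-th tree. -/
def IsNode (e n m : ℕ) : Prop :=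
  (Denumerable.ofNat (List ℕ) m).length = n ∧ InTree e (Denumerable.ofNat (List ℕ) m).reverse

/-- `z` is a pair of a level and a finite set of nodes of that level. -/
def IsNodeSet (e z : ℕ) : Prop :=
  AllMem (List.range z.unpair.2) fun m => ¬ digit z.unpair.2 m = 1 ∨ IsNode e z.unpair.1 m

@[fun_prop] theorem primrecPred_isNodeSet {α : Type*} [Primcodable α] {f g : α → ℕ}
    (hf : Primrec f) (hg : Primrec g) : PrimrecPred fun a => IsNodeSet (f a) (g a) := by
  unfold IsNodeSet IsNode
  fun_prop

theorem isNodeSet_iff {e z : ℕ} :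
    IsNodeSet e z ↔ ∀ m, digit z.unpair.2 m = 1 → IsNode e z.unpair.1 m := by
  simp only [IsNodeSet, AllMem, List.mem_range]
  exact ⟨fun h m hm => (h m (lt_of_digit_eq_one hm)).resolve_left (not_not.2 hm),
    fun h m _ => or_iff_not_imp_left.2 fun hm => h m (not_not.1 hm)⟩

/-- Parity (relation `0`), projection to the previous level modulo 2 (relation `1`), and level `n`
(relation `n + 2`). -/
def NodeRel (flip k : ℕ) (r : List ℕ) : Prop :=
  (k = 0 ∧ digitCount (fun _ => True) r.headI.unpair.2 % 2 = flip) ∨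
  (k = 1 ∧ r.headI.unpair.1 = r.tail.headI.unpair.1 + 1 ∧
    AllMem (List.range r.tail.headI.unpair.2) (fun j => digit r.tail.headI.unpair.2 j =
      digitCount (fun i => parent i = j) r.headI.unpair.2 % 2) ∧
    AllMem (List.range r.headI.unpair.2) (fun i => digit r.tail.headI.unpair.2 (parent i) =
      digitCount (fun i' => parent i' = parent i) r.headI.unpair.2 % 2)) ∨
  (1 < k ∧ r.headI.unpair.1 + 2 = k)

@[fun_prop] theorem primrecPred_nodeRel {α : Type*} [Primcodable α] {f g : α → ℕ}
    {h : α → List ℕ} (hf : Primrec f) (hg : Primrec g) (hh : Primrec h) :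
    PrimrecPred fun a => NodeRel (f a) (g a) (h a) := by
  unfold NodeRel
  fun_prop

theorem projection_iff {x y : ℕ} :
    (AllMem (List.range y) (fun j => digit y j = digitCount (fun i => parent i = j) x % 2) ∧
    AllMem (List.range x) (fun i => digit y (parent i) =
      digitCount (fun i' => parent i' = parent i) x % 2)) ↔
    ∀ j, digit y j = digitCount (fun i => parent i = j) x % 2 := by
  simp only [AllMem, List.mem_range]
  refine ⟨fun ⟨h1, h2⟩ j => ?_, fun h => ⟨fun j _ => h j, fun i _ => h _⟩⟩
  rcases digit_eq_zero_or_one y j with hy | hy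
  · rcases Nat.mod_two_eq_zero_or_one (digitCount (fun i => parent i = j) x) with hx | hx
    · rw [hy, hx]
    · obtain ⟨i, hi, rfl⟩ :=
        exists_of_digitCount_ne_zero (Q := fun i => parent i = j) (x := x) (by lia)
      exact h2 i (lt_of_digit_eq_one hi)
  · exact h1 j (lt_of_digit_eq_one hy)

/-- The signature of the structures coding a tree. -/
def treeSig : Signature where
  rel k := if k = 1 then some 2 else some 1
  fn _ := none

instance (n : ℕ) : IsEmpty (treeSig.lang.Functions n) := ⟨fun F => by cases F.2⟩

/-- The structures coding the `e`-th tree, for `flip = 0` and `flip = 1`; the former has the even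
sets as its distinguished elements, the latter the odd sets. -/
def treeStr (flip e : ℕ) : NatStructure treeSig where
  carrier := {z | IsNodeSet e z}
  str :=
    { funMap := fun F => isEmptyElim F
      RelMap := fun R v => NodeRel flip R.1 (List.ofFn fun i => (v i).1) }

theorem treeStr_relMap {flip e n : ℕ} (R : treeSig.lang.Relations n) (v : Fin n → treeStr flip e) :
    Structure.RelMap R v ↔ NodeRel flip R.1 (List.ofFn fun i => (v i).1) := Iff.rfl

open Classical in
theorem exists_treeIndex : ∃ g : ℕ × ℕ → ℕ, Primrec g ∧
    ∀ flip e, IsIndex (g (flip, e)) (treeStr flip e) := by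
  have h : Primrec fun p : (ℕ × ℕ) × ℕ =>
      if p.2.unpair.1 = 0 then (if IsNodeSet p.1.2 p.2.unpair.2 then 1 else 0)
      else if p.2.unpair.1 = 1 then
        Encodable.encode (if p.2.unpair.2 = 1 then some 2 else some 1)
      else if p.2.unpair.1 = 2 then 0
      else (if NodeRel p.1.1 p.2.unpair.2.unpair.1
        (Denumerable.ofNat (List ℕ) p.2.unpair.2.unpair.2) then 1 else 0) := by fun_prop
  obtain ⟨g, hg, hge⟩ := exists_primrec_phi_eq (f := _) h.to_comp
  refine ⟨g, hg, fun flip e => ⟨fun x => ?_, fun k => ?_, fun k => ?_, fun n R v => ?_,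
    fun n F => isEmptyElim F⟩⟩
  · simp only [hge, treeStr, PFun.coe_val, Nat.unpair_pair, if_true]
    congr!
  · simp [hge, treeSig]
  · simp [hge, treeSig]
  · rw [hge]
    simp only [PFun.coe_val, Nat.unpair_pair, OfNat.ofNat_ne_zero, if_false,
      Denumerable.ofNat_encode]
    rfl

/-- The node of level `n` of the path `F`. -/
def pathNode (F : ℕ → ℕ) (n : ℕ) : ℕ := Encodable.encode (initSeg F n).reverse

theorem parent_pathNode (F : ℕ → ℕ) (n : ℕ) : parent (pathNode F (n + 1)) = pathNode F n := by
  simp [parent, pathNode, initSeg_succ]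

/-- Add the node of the path `F` to a set of nodes, modulo 2. -/
def toggle (F : ℕ → ℕ) (z : ℕ) : ℕ :=
  Nat.pair z.unpair.1 (z.unpair.2 ^^^ 2 ^ pathNode F z.unpair.1)

theorem toggle_toggle (F : ℕ → ℕ) (z : ℕ) : toggle F (toggle F z) = z := by
  simp [toggle]

theorem isNodeSet_toggle {e : ℕ} {F : ℕ → ℕ} (hF : Avoids e F) {z : ℕ} (hz : IsNodeSet e z) :
    IsNodeSet e (toggle F z) := by
  rw [isNodeSet_iff] at hz ⊢
  simp only [toggle, Nat.unpair_pair, digit_xor_two_pow_eq_one]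
  intro m hm
  by_cases h : m = pathNode F z.unpair.1
  · subst h
    simp only [IsNode, pathNode, Denumerable.ofNat_encode, List.length_reverse,
      length_initSeg, List.reverse_reverse, true_and]
    exact avoids_iff_inTree.1 hF _
  · exact hz m (hm.2 h)

theorem nodeRel_toggle (F : ℕ → ℕ) {k n : ℕ} (hk : treeSig.rel k = some n) (v : Fin n → ℕ) :
    NodeRel 1 k (List.ofFn fun i => toggle F (v i)) ↔ NodeRel 0 k (List.ofFn v) := by
  rcases eq_or_ne k 1 with rfl | hk1
  · obtain rfl : 2 = n := by simpa [treeSig] using hk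
    simp only [NodeRel, List.ofFn_succ, List.headI_cons, List.tail_cons, projection_iff,
      one_ne_zero, false_and, true_and, false_or, lt_irrefl, or_false]
    simp only [toggle, Nat.unpair_pair]
    refine and_congr_right fun h => forall_congr' fun j => ?_
    rw [digit_xor_two_pow, digitCount_xor_two_pow, h, parent_pathNode]
    have := digit_eq_zero_or_one (v (Fin.succ 0)).unpair.2 j
    split_ifs <;> lia
  · obtain rfl : 1 = n := by simpa [treeSig, hk1] using hk
    simp only [NodeRel, List.ofFn_succ, List.headI_cons, hk1, false_and, false_or]
    simp only [toggle, Nat.unpair_pair, digitCount_xor_two_pow, if_true]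
    refine or_congr (and_congr_right fun _ => ?_) Iff.rfl
    lia

/-- The bijection `toggle`, between the structures coding a tree with a path. -/
def toggleEquiv {e : ℕ} {F : ℕ → ℕ} (hF : Avoids e F) : treeStr 0 e ≃ treeStr 1 e where
  toFun z := ⟨toggle F z.1, isNodeSet_toggle hF z.2⟩
  invFun z := ⟨toggle F z.1, isNodeSet_toggle hF z.2⟩
  left_inv z := Subtype.ext (toggle_toggle F z.1)
  right_inv z := Subtype.ext (toggle_toggle F z.1)

theorem toggleEquiv_val {e : ℕ} {F : ℕ → ℕ} (hF : Avoids e F) (z : treeStr 0 e) :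
    (toggleEquiv hF z).1 = toggle F z.1 := rfl

theorem nonempty_treeStr_equiv {e : ℕ} (h : ∃ F, Avoids e F) :
    Nonempty (treeStr 0 e ≃[treeSig.lang] treeStr 1 e) := by
  obtain ⟨F, hF⟩ := h
  refine ⟨{ toEquiv := toggleEquiv hF, map_fun' := fun G => isEmptyElim G, map_rel' := ?_ }⟩
  intro n R v
  rw [treeStr_relMap, treeStr_relMap]
  have hR : treeSig.rel R.1 = some n := R.2
  have := nodeRel_toggle F hR fun i => (v i).1
  simp only [← toggleEquiv_val hF] at this
  exact this

/-! ### Programs with an oracle -/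

theorem OCode.exists_eval_eq {f : ℕ →. ℕ} (hf : Nat.Partrec f) :
    ∃ c : OCode, ∀ g, c.eval g = f := by
  induction hf with
  | zero => exact ⟨zero, fun _ => rfl⟩
  | succ => exact ⟨succ, fun _ => rfl⟩
  | left => exact ⟨left, fun _ => rfl⟩
  | right => exact ⟨right, fun _ => rfl⟩
  | pair _ _ h₁ h₂ =>
    obtain ⟨c₁, h₁⟩ := h₁
    obtain ⟨c₂, h₂⟩ := h₂
    exact ⟨pair c₁ c₂, fun g => by simp only [eval, h₁, h₂]; rfl⟩
  | comp _ _ h₁ h₂ =>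
    obtain ⟨c₁, h₁⟩ := h₁
    obtain ⟨c₂, h₂⟩ := h₂
    exact ⟨comp c₁ c₂, fun g => by simp only [eval, h₁, h₂]; rfl⟩
  | prec _ _ h₁ h₂ =>
    obtain ⟨c₁, h₁⟩ := h₁
    obtain ⟨c₂, h₂⟩ := h₂
    exact ⟨prec c₁ c₂, fun g => by simp only [eval, h₁, h₂]; rfl⟩
  | rfind _ h =>
    obtain ⟨c, h⟩ := h
    exact ⟨rfind c, fun g => by simp only [eval, h]; rfl⟩

theorem OCode.exists_eval_eq_some {f : ℕ → ℕ} (hf : Primrec f) :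
    ∃ c : OCode, ∀ g n, c.eval g n = Part.some (f n) := by
  obtain ⟨c, hc⟩ := OCode.exists_eval_eq (Nat.Partrec.of_primrec (Primrec.nat_iff.1 hf))
  exact ⟨c, fun g n => by rw [hc]; rfl⟩

theorem OCode.eval_comp_of_eq {g : ℕ →. ℕ} {c d : OCode} {n m : ℕ}
    (h : d.eval g n = Part.some m) : (comp c d).eval g n = c.eval g m := by
  simp only [eval, h]
  exact Part.bind_some _ _

theorem OCode.eval_pair_of_eq {g : ℕ →. ℕ} {c d : OCode} {n a b : ℕ}
    (h₁ : c.eval g n = Part.some a) (h₂ : d.eval g n = Part.some b) :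
    (pair c d).eval g n = Part.some (Nat.pair a b) := by
  simp [eval, h₁, h₂, Seq.seq]

theorem OCode.eval_prec_of_eq {g : ℕ →. ℕ} {c d : OCode} {a : ℕ} {f : ℕ → ℕ}
    (h₁ : c.eval g a = Part.some (f 0))
    (h₂ : ∀ n, d.eval g (Nat.pair a (Nat.pair n (f n))) = Part.some (f (n + 1))) (n : ℕ) :
    (prec c d).eval g (Nat.pair a n) = Part.some (f n) := by
  simp only [eval, Nat.unpair_pair]
  induction n with
  | zero => exact h₁
  | succ n ih =>
    simp only [ih]
    simp [h₂]

theorem encode_comp (c d : OCode) : Encodable.encode (OCode.comp c d) =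
    2 * (2 * Nat.pair (Encodable.encode c) (Encodable.encode d) + 1) + 5 := rfl

theorem encode_pair (c d : OCode) : Encodable.encode (OCode.pair c d) =
    2 * (2 * Nat.pair (Encodable.encode c) (Encodable.encode d)) + 5 := rfl

theorem encode_prec (c d : OCode) : Encodable.encode (OCode.prec c d) =
    (2 * (2 * Nat.pair (Encodable.encode c) (Encodable.encode d)) + 1) + 5 := rfl

theorem exists_oracleEval_eq {g : ℕ →. ℕ} {D : Set ℕ} (h : TuringReducible g (charFun D)) :
    ∃ c, oracleEval c D = g := by
  obtain ⟨c, hc⟩ := OCode.exists_eval_iff.2 h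
  exact ⟨Encodable.encode c, by rw [oracleEval, Denumerable.ofNat_encode, hc]⟩

theorem turingReducible_oracleEval (c : ℕ) (D : Set ℕ) :
    TuringReducible (oracleEval c D) (charFun D) :=
  OCode.exists_eval_iff.1 ⟨_, rfl⟩

/-! ### Paths from embeddings -/

/-- A child of the node `m` in the set of nodes given by `z`, if there is one. -/
def childIn (m z : ℕ) : ℕ :=
  ((List.range z.unpair.2).filterMap fun i =>
    if digit z.unpair.2 i = 1 ∧ parent i = m then some i else none).headI

@[fun_prop] theorem primrec_childIn {α : Type*} [Primcodable α] {f g : α → ℕ} (hf : Primrec f)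
    (hg : Primrec g) : Primrec fun a => childIn (f a) (g a) := by
  unfold childIn
  fun_prop

theorem childIn_spec {m z : ℕ} (h : digitCount (fun i => parent i = m) z.unpair.2 ≠ 0) :
    digit z.unpair.2 (childIn m z) = 1 ∧ parent (childIn m z) = m := by
  obtain ⟨i, hi, him⟩ := exists_of_digitCount_ne_zero h
  let l := (List.range z.unpair.2).filterMap fun i =>
    if digit z.unpair.2 i = 1 ∧ parent i = m then some i else none
  have hl : ∀ {i}, i ∈ l ↔ i < z.unpair.2 ∧ digit z.unpair.2 i = 1 ∧ parent i = m := by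
    simp [l, List.mem_filterMap]
  obtain ⟨j, l', hj⟩ := List.exists_cons_of_ne_nil
    (List.ne_nil_of_mem (hl.2 ⟨lt_of_digit_eq_one hi, hi, him⟩))
  have hmem : l.headI ∈ l := by simp [hj]
  exact (hl.1 hmem).2

/-- The image of the sequence of empty node sets under an embedding of the structures coding the
`e`-th tree: a sequence of sets of nodes, one at each level, each of which is the projection of
the next one modulo 2, and the first of which is odd. -/
structure IsOddThread (e : ℕ) (X : ℕ → ℕ) : Prop where
  isNodeSet : ∀ n, IsNodeSet e (X n)
  level : ∀ n, (X n).unpair.1 = n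
  odd : digitCount (fun _ => True) (X 0).unpair.2 % 2 = 1
  projection : ∀ n j, digit (X n).unpair.2 j =
    digitCount (fun i => parent i = j) (X (n + 1)).unpair.2 % 2

theorem isNodeSet_pair_zero (e n : ℕ) : IsNodeSet e (Nat.pair n 0) :=
  isNodeSet_iff.2 fun m hm => by simp [digit] at hm

theorem isOddThread_of_embedding {e : ℕ} (h : treeStr 0 e ↪[treeSig.lang] treeStr 1 e) :
    IsOddThread e fun n => (h ⟨Nat.pair n 0, isNodeSet_pair_zero e n⟩).1 := by
  have nodeRel : ∀ {k n : ℕ} (_ : treeSig.rel k = some n) (v : Fin n → ℕ),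
      NodeRel 0 k (List.ofFn fun i => Nat.pair (v i) 0) → NodeRel 1 k
        (List.ofFn fun i => (h ⟨Nat.pair (v i) 0, isNodeSet_pair_zero e (v i)⟩).1) :=
    fun {k n} hk v hv => (h.map_rel (n := n) ⟨k, hk⟩
      fun i => ⟨Nat.pair (v i) 0, isNodeSet_pair_zero e (v i)⟩).2 hv
  have digitCount_zero : ∀ Q, digitCount Q 0 = 0 := fun Q => by simp [digitCount, digit]
  refine ⟨fun n => (h _).2, fun n => ?_, ?_, fun n => ?_⟩
  · simpa [NodeRel] using nodeRel (k := n + 2) (n := 1) (by simp [treeSig]) (fun _ => n)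
      (by simp [NodeRel])
  · simpa [NodeRel] using nodeRel (k := 0) (n := 1) (by simp [treeSig]) (fun _ => 0)
      (by simp [NodeRel, digitCount_zero])
  · have hn := nodeRel (k := 1) (n := 2) (by simp [treeSig]) ![n + 1, n]
      (by simp [NodeRel, AllMem])
    simp only [NodeRel, List.ofFn_succ, List.headI_cons, List.tail_cons, projection_iff,
      one_ne_zero, false_and, true_and, false_or, lt_irrefl, or_false] at hn
    exact hn.2

/-- The nodes chosen successively from the sets of nodes `X n`. -/
def chosenNode (X : ℕ → ℕ) (n : ℕ) : ℕ := n.rec 0 fun k m => childIn m (X (k + 1))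

/-- The path through the nodes chosen successively from the sets of nodes `X n`. -/
def chosenPath (X : ℕ → ℕ) (n : ℕ) : ℕ :=
  (Denumerable.ofNat (List ℕ) (chosenNode X (n + 1))).headI

namespace IsOddThread

variable {e : ℕ} {X : ℕ → ℕ}

theorem isNode (hX : IsOddThread e X) {n m : ℕ} (hm : digit (X n).unpair.2 m = 1) :
    IsNode e n m := by
  simpa only [hX.level] using isNodeSet_iff.1 (hX.isNodeSet n) m hm

theorem childIn_spec (hX : IsOddThread e X) {n m : ℕ} (hm : digit (X n).unpair.2 m = 1) :
    digit (X (n + 1)).unpair.2 (childIn m (X (n + 1))) = 1 ∧ parent (childIn m (X (n + 1))) = m :=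
  Collegiate.childIn_spec fun h => by simp [hX.projection, h] at hm

theorem digit_chosenNode (hX : IsOddThread e X) (n : ℕ) :
    digit (X n).unpair.2 (chosenNode X n) = 1 := by
  induction n with
  | zero =>
    obtain ⟨m, hm, -⟩ : ∃ m, digit (X 0).unpair.2 m = 1 ∧ True :=
      exists_of_digitCount_ne_zero fun h => by simpa [h] using hX.odd
    have : m = 0 := by
      rw [← Denumerable.encode_ofNat (α := List ℕ) m, List.length_eq_zero_iff.1 (hX.isNode hm).1]
      rfl
    rwa [this] at hm
  | succ n ih => exact (hX.childIn_spec ih).1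

theorem parent_chosenNode (hX : IsOddThread e X) (n : ℕ) :
    parent (chosenNode X (n + 1)) = chosenNode X n :=
  (hX.childIn_spec (hX.digit_chosenNode n)).2

theorem pathNode_chosenPath (hX : IsOddThread e X) (n : ℕ) :
    pathNode (chosenPath X) n = chosenNode X n := by
  induction n with
  | zero => rfl
  | succ n ih =>
    obtain ⟨a, l, hl⟩ := List.exists_cons_of_length_eq_add_one
      (hX.isNode (hX.digit_chosenNode (n + 1))).1
    have htail : l = (initSeg (chosenPath X) n).reverse := by
      have := ih.trans (hX.parent_chosenNode n).symm
      simpa [pathNode, parent, hl] using this.symm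
    have hhead : chosenPath X n = a := by simp [chosenPath, hl]
    rw [pathNode, initSeg_succ, List.reverse_append, ← htail, hhead, List.reverse_singleton,
      List.singleton_append, ← hl, Denumerable.encode_ofNat]

theorem avoids_chosenPath (hX : IsOddThread e X) : Avoids e (chosenPath X) := by
  refine avoids_iff_inTree.2 fun n => ?_
  have hn := (hX.isNode (hX.digit_chosenNode n)).2
  rwa [← hX.pathNode_chosenPath, pathNode, Denumerable.ofNat_encode, List.reverse_reverse] at hn

end IsOddThread

theorem exists_primrec_oracleEval_chosenPath : ∃ p : ℕ → ℕ, Primrec p ∧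
    ∀ (c : ℕ) (D : Set ℕ) (X : ℕ → ℕ), (∀ n, oracleEval c D (Nat.pair n 0) = Part.some (X n)) →
      ∀ n, oracleEval (p c) D n = Part.some (chosenPath X n) := by
  obtain ⟨child, hchild⟩ := OCode.exists_eval_eq_some
    (f := fun w => childIn w.unpair.1 w.unpair.2) (by fun_prop)
  obtain ⟨node, hnode⟩ := OCode.exists_eval_eq_some
    (f := fun w => w.unpair.2.unpair.2) (by fun_prop)
  obtain ⟨level, hlevel⟩ := OCode.exists_eval_eq_some
    (f := fun w => Nat.pair (w.unpair.2.unpair.1 + 1) 0) (by fun_prop)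
  obtain ⟨head, hhead⟩ := OCode.exists_eval_eq_some
    (f := fun w => (Denumerable.ofNat (List ℕ) w).headI) (by fun_prop)
  let chosen (c : OCode) : OCode := .prec .zero (.comp child (.pair node (.comp c level)))
  let code (c : OCode) : OCode := .comp head (.comp (chosen c) (.pair .zero .succ))
  refine ⟨fun c => Encodable.encode (code (Denumerable.ofNat OCode c)), ?_, fun c D X hX n => ?_⟩
  · simp only [code, chosen, encode_comp, encode_pair, encode_prec, Denumerable.encode_ofNat]
    fun_prop
  · have hchosen (n : ℕ) : (chosen (Denumerable.ofNat OCode c)).eval (charFun D) (Nat.pair 0 n) =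
        Part.some (chosenNode X n) := by
      refine OCode.eval_prec_of_eq (f := chosenNode X) rfl (fun n => ?_) n
      rw [OCode.eval_comp_of_eq (OCode.eval_pair_of_eq (hnode _ _)
        ((OCode.eval_comp_of_eq (hlevel _ _)).trans (hX _))), hchild]
      simp [chosenNode]
    rw [oracleEval, Denumerable.ofNat_encode, OCode.eval_comp_of_eq ((OCode.eval_comp_of_eq
      (OCode.eval_pair_of_eq (a := 0) (b := n + 1) rfl rfl)).trans (hchosen _)), hhead]
    rfl

theorem exists_pathIndex : ∃ p : ℕ → ℕ, Primrec p ∧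
    ∀ (e c : ℕ) (D : Set ℕ) (h : treeStr 0 e ↪[treeSig.lang] treeStr 1 e),
      Extends (oracleEval c D) h →
      ∃ F, Avoids e F ∧ ∀ n, oracleEval (p c) D n = Part.some (F n) := by
  obtain ⟨p, hp, hpX⟩ := exists_primrec_oracleEval_chosenPath
  exact ⟨p, hp, fun e c D h hc => ⟨_, (isOddThread_of_embedding h).avoids_chosenPath,
    hpX c D _ fun n => hc ⟨_, isNodeSet_pair_zero e n⟩⟩⟩

/-! ### Degrees that compute paths -/

/-- The degree `d` computes a member of every nonempty class. -/
def ComputesPaths (d : TuringDegree) : Prop :=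
  ∀ e, (∃ F, Avoids e F) → ∃ D : Set ℕ, degreeOf D = d ∧ ∃ (c : ℕ) (F : ℕ → ℕ), Avoids e F ∧
    ∀ n, oracleEval c D n = Part.some (F n)

/-- The degree `d` computes a member of every nonempty class, uniformly in an index of the
class. -/
def UniformlyComputesPaths (d : TuringDegree) : Prop :=
  ∃ D : Set ℕ, degreeOf D = d ∧ ∃ f : ℕ → ℕ, Computable f ∧ ∀ e, (∃ F, Avoids e F) →
    ∃ F, Avoids e F ∧ ∀ n, oracleEval (f e) D n = Part.some (F n)

theorem computesPaths_of_treeStr {d : TuringDegree}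
    (h : ∀ e, Nonempty (treeStr 0 e ≃[treeSig.lang] treeStr 1 e) →
      ∃ h : treeStr 0 e ↪[treeSig.lang] treeStr 1 e, Computes d h) : ComputesPaths d := by
  obtain ⟨p, -, hp⟩ := exists_pathIndex
  intro e he
  obtain ⟨h, D, hD, g, hg, hgh⟩ := h e (nonempty_treeStr_equiv he)
  obtain ⟨c, rfl⟩ := exists_oracleEval_eq hg
  obtain ⟨F, hF⟩ := hp e c D h hgh
  exact ⟨D, hD, p c, F, hF⟩

theorem isComputableStructure_treeStr (flip e : ℕ) : IsComputableStructure (treeStr flip e) := by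
  obtain ⟨g, -, hg⟩ := exists_treeIndex
  exact ⟨_, hg flip e⟩

theorem HighForIsomorphism.computesPaths {d : TuringDegree} (h : HighForIsomorphism d) :
    ComputesPaths d := by
  refine computesPaths_of_treeStr fun e he => ?_
  obtain ⟨f, hf⟩ := h _ _ _ (isComputableStructure_treeStr 0 e)
    (isComputableStructure_treeStr 1 e) he
  exact ⟨f.toEmbedding, hf⟩

theorem IsCollegiate.computesPaths {α : Ordinal.{0}} {d : TuringDegree} (h : IsCollegiate α d) :
    ComputesPaths d := by
  refine computesPaths_of_treeStr fun e he => ?_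
  obtain ⟨f⟩ := he
  obtain ⟨f, -, hf⟩ := h 0 (zero_le (a := α)) _ _ _ (isComputableStructure_treeStr 0 e)
    (isComputableStructure_treeStr 1 e) ⟨f.toEmbedding, isSigmaElementary_zero _⟩
  exact ⟨f, hf⟩

theorem uniformlyComputesPaths_of_treeStr {d : TuringDegree} {D : Set ℕ} (hD : degreeOf D = d)
    {f : ℕ → ℕ → ℕ} (hf : Computable₂ f)
    (h : ∀ e i j, IsIndex i (treeStr 0 e) → IsIndex j (treeStr 1 e) →
      Nonempty (treeStr 0 e ≃[treeSig.lang] treeStr 1 e) →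
      ∃ h : treeStr 0 e ↪[treeSig.lang] treeStr 1 e, Extends (oracleEval (f i j) D) h) :
    UniformlyComputesPaths d := by
  obtain ⟨p, hp, hpe⟩ := exists_pathIndex
  obtain ⟨g, hg, hge⟩ := exists_treeIndex
  refine ⟨D, hD, fun e => p (f (g (0, e)) (g (1, e))), ?_, fun e he => ?_⟩
  · exact hp.to_comp.comp (hf.comp (hg.comp (by fun_prop)).to_comp (hg.comp (by fun_prop)).to_comp)
  · obtain ⟨h, hh⟩ := h e _ _ (hge 0 e) (hge 1 e) (nonempty_treeStr_equiv he)
    exact hpe e _ D h hh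

theorem UniformlyHighForIsomorphism.uniformlyComputesPaths {d : TuringDegree}
    (h : UniformlyHighForIsomorphism d) : UniformlyComputesPaths d := by
  obtain ⟨D, hD, f, hf, h⟩ := h
  refine uniformlyComputesPaths_of_treeStr hD hf fun e i j hi hj he => ?_
  obtain ⟨g, hg⟩ := h _ _ _ i j hi hj he
  exact ⟨g.toEmbedding, hg⟩

theorem LevelwiseUniformlyCollegiate.uniformlyComputesPaths {α : Ordinal.{0}} {d : TuringDegree}
    (h : LevelwiseUniformlyCollegiate α d) : UniformlyComputesPaths d := by
  obtain ⟨D, hD, f, hf, h⟩ := h 0 (zero_le (a := α))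
  refine uniformlyComputesPaths_of_treeStr hD hf fun e i j hi hj he => ?_
  obtain ⟨g⟩ := he
  obtain ⟨g, -, hg⟩ := h _ _ _ i j hi hj ⟨g.toEmbedding, isSigmaElementary_zero _⟩
  exact ⟨g, hg⟩

/-! ### Computing the results of tests -/

section TestResult

variable {S : Signature} {i j : ℕ} {P Q : NatStructure S}

/-- The test `t` can be applied to lists of length `n`: the indices and the arity are right. -/
def TestApplies (S : Signature) (n : ℕ) (t : Test) : Prop :=
  t.1 = 0 ∨ (∀ i ∈ t.2.2.2, i < n) ∧
    ((t.1 = 1 ∧ S.rel t.2.1 = some t.2.2.2.length) ∨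
      (1 < t.1 ∧ S.fn t.2.1 = some t.2.2.2.length))

theorem Holds.testApplies {M : Type} [S.lang.Structure M] {u : List M} {t : Test}
    (h : Holds S u t) : TestApplies S u.length t := by
  obtain ⟨kd, k, w, l⟩ := t
  match kd with
  | 0 => exact Or.inl rfl
  | 1 =>
    obtain ⟨hl, hk, -⟩ := h
    exact Or.inr ⟨hl, Or.inl ⟨rfl, by rw [hk, length_select_eq_iff.2 hl]⟩⟩
  | n + 2 =>
    obtain ⟨hl, p, -, hk, -⟩ := h
    exact Or.inr ⟨hl, Or.inr ⟨by simp, by rw [hk, length_select_eq_iff.2 hl]⟩⟩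

/-- The computable structure with index `i` gives the test `t` on the list `u` the result `v`, where
`1` stands for true and `0` for false. -/
def TestResult (i : ℕ) (u : List ℕ) (t : Test) (v : ℕ) : Prop :=
  (t.1 = 0 ∧ v = if u[t.2.1]? = u[t.2.2.1]? then 1 else 0) ∨
  (t.1 = 1 ∧ (select u t.2.2.2).length = t.2.2.2.length ∧
    phi i (Nat.pair 1 t.2.1) = Part.some (Encodable.encode (some t.2.2.2.length)) ∧
    phi i (Nat.pair 3 (Nat.pair t.2.1 (Encodable.encode (select u t.2.2.2)))) = Part.some v) ∨
  (1 < t.1 ∧ (select u t.2.2.2).length = t.2.2.2.length ∧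
    phi i (Nat.pair 2 t.2.1) = Part.some (Encodable.encode (some t.2.2.2.length)) ∧
    ∃ p, phi i (Nat.pair 4 (Nat.pair t.2.1 (Encodable.encode (select u t.2.2.2)))) = Part.some p ∧
      v = if u[t.2.2.1]? = some p then 1 else 0)

open Classical in
theorem IsIndex.phi_relHolds (hi : IsIndex i P) {k : ℕ} {r : List P}
    (hk : S.rel k = some r.length) :
    phi i (Nat.pair 3 (Nat.pair k (Encodable.encode (r.map Subtype.val)))) =
      Part.some (if RelHolds S k r then 1 else 0) := by
  have h := hi.2.2.2.1 r.length (Signature.relSym hk) r.get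
  have hr : (List.ofFn fun i => (r.get i : ℕ)) = r.map Subtype.val := by
    rw [← Function.comp_def Subtype.val r.get, ← List.map_ofFn, List.ofFn_get]
  have hR : RelHolds S k r ↔ Structure.RelMap (Signature.relSym hk) r.get :=
    ⟨fun ⟨_, h⟩ => h, fun h => ⟨hk, h⟩⟩
  rw [hr] at h
  simp only [hR]
  exact h

theorem IsIndex.exists_phi_fnValue (hi : IsIndex i P) {k : ℕ} {r : List P}
    (hk : S.fn k = some r.length) : ∃ p : P,
    phi i (Nat.pair 4 (Nat.pair k (Encodable.encode (r.map Subtype.val)))) = Part.some p.1 ∧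
      ∀ p', FnValue S k r p' ↔ p = p' := by
  have h := hi.2.2.2.2 r.length (Signature.fnSym hk) r.get
  have hr : (List.ofFn fun i => (r.get i : ℕ)) = r.map Subtype.val := by
    rw [← Function.comp_def Subtype.val r.get, ← List.map_ofFn, List.ofFn_get]
  rw [hr] at h
  exact ⟨_, h, fun p' => ⟨fun ⟨_, h⟩ => h, fun h => ⟨hk, h⟩⟩⟩

theorem getElem?_map_val_eq_iff {u : List P} {k w : ℕ} :
    (u.map Subtype.val)[k]? = (u.map Subtype.val)[w]? ↔ u[k]? = u[w]? := by
  simp only [List.getElem?_map, (Option.map_injective Subtype.val_injective).eq_iff]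

theorem getElem?_map_val_eq_some_iff {u : List P} {w : ℕ} {p : P} :
    (u.map Subtype.val)[w]? = some p.1 ↔ u[w]? = some p := by
  rw [List.getElem?_map, ← Option.map_some, (Option.map_injective Subtype.val_injective).eq_iff]

theorem length_select_map_val_eq_iff {u : List P} {l : List ℕ} :
    (select (u.map Subtype.val) l).length = l.length ↔ ∀ i ∈ l, i < u.length := by
  rw [length_select_eq_iff, List.length_map]

theorem IsIndex.phi_rel_iff (hi : IsIndex i P) {k n : ℕ} :
    phi i (Nat.pair 1 k) = Part.some (Encodable.encode (some n)) ↔ S.rel k = some n := by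
  rw [hi.2.1, Part.some_inj, Encodable.encode_inj]

theorem IsIndex.phi_fn_iff (hi : IsIndex i P) {k n : ℕ} :
    phi i (Nat.pair 2 k) = Part.some (Encodable.encode (some n)) ↔ S.fn k = some n := by
  rw [hi.2.2.1, Part.some_inj, Encodable.encode_inj]

open Classical in
theorem IsIndex.testResult_iff (hi : IsIndex i P) {u : List P} {t : Test} {v : ℕ} :
    TestResult i (u.map Subtype.val) t v ↔
      TestApplies S u.length t ∧ v = if Holds S u t then 1 else 0 := by
  obtain ⟨kd, k, w, l⟩ := t
  match kd with
  | 0 =>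
    simp only [TestResult, TestApplies, Holds, getElem?_map_val_eq_iff, zero_ne_one, not_lt_zero,
      false_and, or_false, true_and, true_or]
    by_cases h : u[k]? = u[w]? <;> simp only [h, if_true, if_false]
  | 1 =>
    have key : (∀ i ∈ l, i < u.length) → S.rel k = some l.length →
        phi i (Nat.pair 3 (Nat.pair k (Encodable.encode (select (u.map Subtype.val) l)))) =
          Part.some (if Holds S u (1, k, w, l) then 1 else 0) := fun hl hk => by
      rw [select_map, hi.phi_relHolds (by rw [hk, length_select_eq_iff.2 hl])]
      simp only [show Holds S u (1, k, w, l) ↔ RelHolds S k (select u l) from and_iff_right hl]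
    simp only [TestResult, TestApplies, one_ne_zero, false_and, lt_irrefl, or_false, false_or,
      true_and, length_select_map_val_eq_iff, hi.phi_rel_iff, ← and_assoc]
    refine and_congr_right fun ⟨hl, hk⟩ => ?_
    rw [key hl hk, Part.some_inj, eq_comm]
  | n + 2 =>
    simp only [TestResult, TestApplies, Nat.add_eq_zero_iff, OfNat.ofNat_ne_zero, and_false,
      false_and, show n + 2 ≠ 1 by lia, show 1 < n + 2 by lia, false_or, true_and,
      length_select_map_val_eq_iff, hi.phi_fn_iff, ← and_assoc]
    refine and_congr_right fun ⟨hl, hk⟩ => ?_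
    obtain ⟨p, hp, hpv⟩ := hi.exists_phi_fnValue (r := select u l)
      (by rw [hk, length_select_eq_iff.2 hl])
    have hH : Holds S u (n + 2, k, w, l) ↔ u[w]? = some p := by
      simp only [Holds, hpv]
      exact ⟨fun ⟨_, _, h, h'⟩ => h' ▸ h, fun h => ⟨hl, p, h, rfl⟩⟩
    simp only [select_map, hp, Part.some_inj, exists_eq_left', getElem?_map_val_eq_some_iff, hH]

/-- The structures with indices `i` and `j` give the tests with codes below `N` the same results on
`u` and `u'`. -/
def IndexAgree (i j N : ℕ) (u u' : List ℕ) : Prop :=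
  ∀ (t : Test) (v v' : ℕ), Encodable.encode t < N → TestResult i u t v → TestResult j u' t v' →
    v = v'

theorem indexAgree_iff_agree (hi : IsIndex i P) (hj : IsIndex j Q) {N : ℕ} {u : List P}
    {u' : List Q} (hl : u.length = u'.length) :
    IndexAgree i j N (u.map Subtype.val) (u'.map Subtype.val) ↔ Agree S N u u' := by
  classical
  simp only [IndexAgree, hi.testResult_iff, hj.testResult_iff]
  constructor
  · intro h t ht
    by_contra hne
    have happ : TestApplies S u.length t := by
      by_cases hu : Holds S u t
      · exact hu.testApplies
      · exact hl ▸ ((not_iff.1 hne).1 hu).testApplies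
    have := h t _ _ ht ⟨happ, rfl⟩ ⟨hl ▸ happ, rfl⟩
    split_ifs at this <;> tauto
  · rintro h t v v' ht ⟨-, rfl⟩ ⟨-, rfl⟩
    simp only [h t ht]

end TestResult

section Universe

variable {S : Signature} {i : ℕ} {P : NatStructure S}

/-- The structure with index `i` declares all members of `l` to be elements. -/
def InUniverse (i : ℕ) (l : List ℕ) : Prop := ∀ z ∈ l, phi i (Nat.pair 0 z) = Part.some 1

/-- The structure with index `i` declares no member of `l` to be a non-element. For an index this is
equivalent to `InUniverse`, but it is a `Π⁰₁` condition rather than a `Σ⁰₁` condition. -/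
def NotOutside (i : ℕ) (l : List ℕ) : Prop := ∀ z ∈ l, ¬ phi i (Nat.pair 0 z) = Part.some 0

theorem IsIndex.phi_eq_one_iff (hi : IsIndex i P) {z : ℕ} :
    phi i (Nat.pair 0 z) = Part.some 1 ↔ z ∈ P.carrier := by
  classical
  rw [hi.1]
  by_cases h : z ∈ P.carrier <;> simp [h]

theorem IsIndex.phi_eq_zero_iff (hi : IsIndex i P) {z : ℕ} :
    phi i (Nat.pair 0 z) = Part.some 0 ↔ z ∉ P.carrier := by
  classical
  rw [hi.1]
  by_cases h : z ∈ P.carrier <;> simp [h]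

theorem forall_mem_carrier_iff {l : List ℕ} :
    (∀ z ∈ l, z ∈ P.carrier) ↔ ∃ l' : List P, l'.map Subtype.val = l := by
  refine ⟨fun h => ?_, ?_⟩
  · lift l to List P.carrier using h
    exact ⟨l, rfl⟩
  · rintro ⟨l', rfl⟩ z hz
    obtain ⟨x, -, rfl⟩ := List.mem_map.1 hz
    exact x.2

theorem IsIndex.inUniverse_iff (hi : IsIndex i P) {l : List ℕ} :
    InUniverse i l ↔ ∃ l' : List P, l'.map Subtype.val = l := by
  simp only [InUniverse, hi.phi_eq_one_iff, forall_mem_carrier_iff]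

theorem IsIndex.notOutside_iff (hi : IsIndex i P) {l : List ℕ} :
    NotOutside i l ↔ ∃ l' : List P, l'.map Subtype.val = l := by
  simp only [NotOutside, hi.phi_eq_zero_iff, not_not, forall_mem_carrier_iff]

end Universe

@[fun_prop] theorem primrec_select {α : Type*} [Primcodable α] {u l : α → List ℕ}
    (hu : Primrec u) (hl : Primrec l) : Primrec fun a => select (u a) (l a) := by
  unfold select
  fun_prop

namespace IsPiClass

variable {α : Type*} [Primcodable α]

theorem not_testResult {i v : α → ℕ} {u : α → List ℕ} {t : α → Test} (hi : Primrec i)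
    (hu : Primrec u) (ht : Primrec t) (hv : Primrec v) :
    IsPiClass fun a _ => ¬ TestResult (i a) (u a) (t a) (v a) := by
  simp only [TestResult, not_or, not_and_or, not_exists]
  refine .and (of_primrecPred (by fun_prop)) (.and ?_ ?_)
  · refine .or (of_primrecPred (by fun_prop)) (.or (of_primrecPred (by fun_prop)) (.or ?_ ?_))
    all_goals exact not_phi_eq (by fun_prop) (by fun_prop) (by fun_prop)
  · refine .or (of_primrecPred (by fun_prop)) (.or (of_primrecPred (by fun_prop)) (.or ?_ ?_))
    · exact not_phi_eq (by fun_prop) (by fun_prop) (by fun_prop)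
    · exact all (.or (not_phi_eq (by fun_prop) (by fun_prop) (by fun_prop))
        (of_primrecPred (by fun_prop)))

theorem indexAgree {i j N : α → ℕ} {u u' : α → List ℕ} (hi : Primrec i) (hj : Primrec j)
    (hN : Primrec N) (hu : Primrec u) (hu' : Primrec u') :
    IsPiClass fun a _ => IndexAgree (i a) (j a) (N a) (u a) (u' a) := by
  unfold IndexAgree
  refine all (all (all (imp (of_primrecPred (by fun_prop)) (imp ?_ (imp ?_
    (of_primrecPred (by fun_prop)))))))
  all_goals exact not_testResult (by fun_prop) (by fun_prop) (by fun_prop) (by fun_prop)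

theorem not_inUniverse {i : α → ℕ} {l : α → List ℕ} (hi : Primrec i) (hl : Primrec l) :
    IsPiClass fun a _ => ¬ InUniverse (i a) (l a) := by
  simp only [InUniverse, forall_mem_phi_eq_some_iff, not_exists]
  exact all (of_primrecPred (by fun_prop))

theorem notOutside {i : α → ℕ} {l : α → List ℕ} (hi : Primrec i) (hl : Primrec l) :
    IsPiClass fun a _ => NotOutside (i a) (l a) := by
  refine (all (R := fun a st _ => AllMem (l a) fun z => ¬ phiSteps st (i a) (Nat.pair 0 z) = some 0)
    (of_primrecPred (by fun_prop))).congr fun a _ => ?_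
  simp only [NotOutside, AllMem, phi_eq_some_iff, not_exists]
  exact ⟨fun h st z hz => h z hz st, fun h z hz st => h st z hz⟩

end IsPiClass

/-! ### Strategies in the back-and-forth game -/

/-- A position `(x, s, u, u')` of the back-and-forth game: the level `x`, which is `0` for the top
and `y + 1` for the element `y` of a linear order, a side `s`, a tuple `u` of the structure on that
side and a tuple `u'` of the other structure. -/
abbrev Position : Type := ℕ × Bool × List ℕ × List ℕ

/-- A move `(y, d, N)` at a position: the element `y` that gives the next level, a tuple `d` of the
structure on the other side, and a bound `N` for the tests that the response has to pass. -/
abbrev Move : Type := ℕ × List ℕ × ℕ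

/-- The argument at which a strategy has the image of `z` under the embedding. -/
def imageKey (z : ℕ) : ℕ := Nat.pair 0 z

/-- The argument at which a strategy has the response to the move `m` at `q`. The value is `0` if
there is no response, and `Encodable.encode c + 1` if it is the tuple `c`. -/
def responseKey (q : Position) (m : Move) : ℕ := Nat.pair 1 (Encodable.encode (q, m))

/-- The argument at which a strategy has the preimage of `z` under the embedding. -/
def preimageKey (z : ℕ) : ℕ := Nat.pair 2 z

/-- The index of the structure on a side. -/
def sideIndex (i j : ℕ) (s : Bool) : ℕ := if s = true then i else j

/-- The level `y + 1` is below the level `x`, in the linear order with index `b`. -/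
def LevelLT (b y x : ℕ) : Prop :=
  phi b (Nat.pair 0 y) = Part.some 1 ∧ (x = 0 ∨ phi b (Nat.pair 0 (x - 1)) = Part.some 1 ∧
    phi b (Nat.pair 1 (Nat.pair y (x - 1))) = Part.some 1)

/-- `m` is a legal move at `q`. -/
def LegalMove (b i j : ℕ) (q : Position) (m : Move) : Prop :=
  LevelLT b m.1 q.1 ∧ InUniverse (sideIndex i j !q.2.1) m.2.1

/-- `c` is a right response to the move `m` at `q`. -/
def RightResponse (i j : ℕ) (q : Position) (m : Move) (c : List ℕ) : Prop :=
  c.length = m.2.1.length ∧ NotOutside (sideIndex i j q.2.1) c ∧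
    IndexAgree (sideIndex i j !q.2.1) (sideIndex i j q.2.1) m.2.2 (q.2.2.2 ++ m.2.1)
      (q.2.2.1 ++ c)

/-- The position after the move `m` at `q` and the response `c`. -/
def nextPosition (q : Position) (m : Move) (c : List ℕ) : Position :=
  (m.1 + 1, !q.2.1, q.2.2.2 ++ m.2.1, q.2.2.1 ++ c)

/-- The strategy `F` claims to win from the position `q`: it responds to all moves. -/
def Claims (F : ℕ → ℕ) (q : Position) : Prop := ∀ m, ¬ F (responseKey q m) = 0

/-- The responses of the strategy `F` to legal moves are right and lead to claimed positions. -/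
def GoodResponses (b i j : ℕ) (F : ℕ → ℕ) : Prop :=
  ∀ q m c, LegalMove b i j q m → F (responseKey q m) = Encodable.encode c + 1 →
    RightResponse i j q m c ∧ Claims F (nextPosition q m c)

/-- The images given by `F` are those under an embedding. -/
def GoodImages (i j : ℕ) (F : ℕ → ℕ) : Prop :=
  ∀ l, InUniverse i l → NotOutside j ((l.map imageKey).map F) ∧
    ∀ N, IndexAgree i j N l ((l.map imageKey).map F)

/-- The preimages given by `F` are preimages under the map given by `F`. -/
def GoodPreimages (i j : ℕ) (F : ℕ → ℕ) : Prop :=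
  ∀ z, InUniverse j [z] → NotOutside i [F (preimageKey z)] ∧
    F (imageKey (F (preimageKey z))) = z

/-- `F` claims the positions given by the tuples of the first structure and their images. -/
def ClaimsImages (i : ℕ) (F : ℕ → ℕ) : Prop :=
  ∀ l, InUniverse i l → Claims F (0, true, l, (l.map imageKey).map F) ∧
    Claims F (0, false, (l.map imageKey).map F, l)

section Primrec

variable {α : Type*} [Primcodable α]

@[fun_prop] theorem primrec_imageKey {f : α → ℕ} (hf : Primrec f) :
    Primrec fun a => imageKey (f a) := by
  unfold imageKey
  fun_prop

@[fun_prop] theorem primrec_responseKey {f : α → Position} {g : α → Move} (hf : Primrec f)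
    (hg : Primrec g) : Primrec fun a => responseKey (f a) (g a) := by
  unfold responseKey
  fun_prop

@[fun_prop] theorem primrec_preimageKey {f : α → ℕ} (hf : Primrec f) :
    Primrec fun a => preimageKey (f a) := by
  unfold preimageKey
  fun_prop

@[fun_prop] theorem primrec_sideIndex {f g : α → ℕ} {s : α → Bool} (hf : Primrec f)
    (hg : Primrec g) (hs : Primrec s) : Primrec fun a => sideIndex (f a) (g a) (s a) := by
  unfold sideIndex
  fun_prop

@[fun_prop] theorem primrec_nextPosition {q : α → Position} {m : α → Move} {c : α → List ℕ}
    (hq : Primrec q) (hm : Primrec m) (hc : Primrec c) :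
    Primrec fun a => nextPosition (q a) (m a) (c a) := by
  unfold nextPosition
  fun_prop

end Primrec

namespace IsPiClass

variable {α : Type*} [Primcodable α] {b i j : α → ℕ} {q : α → Position} {m : α → Move}
  {c : α → List ℕ}

theorem not_legalMove (hb : Primrec b) (hi : Primrec i) (hj : Primrec j) (hq : Primrec q)
    (hm : Primrec m) : IsPiClass fun a _ => ¬ LegalMove (b a) (i a) (j a) (q a) (m a) := by
  simp only [LegalMove, LevelLT, not_and_or, not_or]
  refine .or (.or ?_ (.and (of_primrecPred (by fun_prop)) (.or ?_ ?_))) ?_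
  · exact not_phi_eq (by fun_prop) (by fun_prop) (by fun_prop)
  · exact not_phi_eq (by fun_prop) (by fun_prop) (by fun_prop)
  · exact not_phi_eq (by fun_prop) (by fun_prop) (by fun_prop)
  · exact not_inUniverse (by fun_prop) (by fun_prop)

theorem rightResponse (hi : Primrec i) (hj : Primrec j) (hq : Primrec q) (hm : Primrec m)
    (hc : Primrec c) : IsPiClass fun a _ => RightResponse (i a) (j a) (q a) (m a) (c a) := by
  refine .and (of_primrecPred (by fun_prop)) (.and (notOutside (by fun_prop) (by fun_prop)) ?_)
  exact indexAgree (by fun_prop) (by fun_prop) (by fun_prop) (by fun_prop) (by fun_prop)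

theorem claims (hq : Primrec q) : IsPiClass fun a F => Claims F (q a) :=
  all (not_apply_eq (by fun_prop) (by fun_prop))

theorem goodResponses (hb : Primrec b) (hi : Primrec i) (hj : Primrec j) :
    IsPiClass fun a => GoodResponses (b a) (i a) (j a) := by
  refine all (all (all (imp ?_ (imp (not_apply_eq (by fun_prop) (by fun_prop)) (.and ?_ ?_)))))
  · exact not_legalMove (by fun_prop) (by fun_prop) (by fun_prop) (by fun_prop) (by fun_prop)
  · exact rightResponse (by fun_prop) (by fun_prop) (by fun_prop) (by fun_prop) (by fun_prop)
  · exact claims (by fun_prop)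

theorem goodImages (hi : Primrec i) (hj : Primrec j) :
    IsPiClass fun a => GoodImages (i a) (j a) := by
  refine all (imp (not_inUniverse (by fun_prop) (by fun_prop)) ?_)
  refine map_apply (R := fun (p : α × List ℕ) l' _ => NotOutside (j p.1) l' ∧
    ∀ N, IndexAgree (i p.1) (j p.1) N p.2 l') (.and ?_ (all ?_)) (by fun_prop)
  · exact notOutside (by fun_prop) (by fun_prop)
  · exact indexAgree (by fun_prop) (by fun_prop) (by fun_prop) (by fun_prop) (by fun_prop)

theorem goodPreimages (hi : Primrec i) (hj : Primrec j) :
    IsPiClass fun a => GoodPreimages (i a) (j a) := by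
  refine all (imp (not_inUniverse (by fun_prop) (by fun_prop)) ?_)
  refine apply (R := fun (p : α × ℕ) x F => NotOutside (i p.1) [x] ∧ F (imageKey x) = p.2)
    (.and (notOutside (by fun_prop) (by fun_prop)) ?_) (by fun_prop)
  exact apply (R := fun (p : (α × ℕ) × ℕ) y _ => y = p.1.2)
    (of_primrecPred (by fun_prop)) (by fun_prop)

theorem claimsImages (hi : Primrec i) : IsPiClass fun a => ClaimsImages (i a) := by
  refine all (imp (not_inUniverse (by fun_prop) (by fun_prop)) ?_)
  exact map_apply (R := fun (p : α × List ℕ) l' F => Claims F (0, true, p.2, l') ∧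
    Claims F (0, false, l', p.2)) (.and (claims (by fun_prop)) (claims (by fun_prop))) (by fun_prop)

end IsPiClass

variable {S : Signature}

theorem exists_ofFn_eq {β : Type*} {m : ℕ} {l : List β} (h : l.length = m) :
    ∃ f : Fin m → β, List.ofFn f = l := by
  subst h
  exact ⟨l.get, List.ofFn_get l⟩

/-! ### Levels -/

/-- `lev` assigns ordinals to the levels: the ordinals of the levels below a level are the ordinals
below its own. -/
def IsLevelMap (b : ℕ) (lev : ℕ → Ordinal.{0}) : Prop :=
  (∀ y x, LevelLT b y x → lev (y + 1) < lev x) ∧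
    ∀ x, ∀ γ < lev x, ∃ y, LevelLT b y x ∧ lev (y + 1) = γ

section LevelMap

variable {b : ℕ} {T : Set ℕ} {r : T → T → Prop}

open Classical in
/-- The ordinals of the levels for a well-order of a set of natural numbers: the order type for the
top, and the order type of the initial segment for an element. The value at the level of a
non-element, which is not reached from the top, is `0`. -/
def levelOrdinal (r : T → T → Prop) [IsWellOrder T r] : ℕ → Ordinal.{0}
  | 0 => Ordinal.type r
  | x + 1 => if h : x ∈ T then Ordinal.typein r ⟨x, h⟩ else 0

theorem levelOrdinal_succ [IsWellOrder T r] (x : T) :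
    levelOrdinal r (x + 1) = Ordinal.typein r x := by
  simp [levelOrdinal]

theorem levelLT_zero_iff
    (hT : ∀ x, phi b (Nat.pair 0 x) = Part.some 1 ↔ x ∈ T) {y : ℕ} : LevelLT b y 0 ↔ y ∈ T := by
  simp [LevelLT, hT]

theorem levelLT_succ_iff (hT : ∀ x, phi b (Nat.pair 0 x) = Part.some 1 ↔ x ∈ T)
    (hr : ∀ x y : T, phi b (Nat.pair 1 (Nat.pair x y)) = Part.some 1 ↔ r x y) {y x : ℕ} :
    LevelLT b y (x + 1) ↔ ∃ (hy : y ∈ T) (hx : x ∈ T), r ⟨y, hy⟩ ⟨x, hx⟩ := by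
  simp only [LevelLT, hT, Nat.add_eq_zero_iff, one_ne_zero, and_false, false_or,
    Nat.add_sub_cancel]
  exact ⟨fun ⟨hy, hx, h⟩ => ⟨hy, hx, (hr ⟨y, hy⟩ ⟨x, hx⟩).1 h⟩,
    fun ⟨hy, hx, h⟩ => ⟨hy, hx, (hr ⟨y, hy⟩ ⟨x, hx⟩).2 h⟩⟩

theorem isLevelMap_levelOrdinal [IsWellOrder T r]
    (hT : ∀ x, phi b (Nat.pair 0 x) = Part.some 1 ↔ x ∈ T)
    (hr : ∀ x y : T, phi b (Nat.pair 1 (Nat.pair x y)) = Part.some 1 ↔ r x y) :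
    IsLevelMap b (levelOrdinal r) := by
  refine ⟨fun y x h => ?_, fun x γ hγ => ?_⟩
  · cases x with
    | zero =>
      lift y to T using (levelLT_zero_iff hT).1 h
      exact (levelOrdinal_succ y).trans_lt (Ordinal.typein_lt_type r y)
    | succ x =>
      obtain ⟨hy, hx, hyx⟩ := (levelLT_succ_iff hT hr).1 h
      rw [levelOrdinal_succ ⟨y, hy⟩, levelOrdinal_succ ⟨x, hx⟩]
      exact (Ordinal.typein_lt_typein r).2 hyx
  · cases x with
    | zero =>
      obtain ⟨y, rfl⟩ := Ordinal.typein_surj r hγ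
      exact ⟨y, (levelLT_zero_iff hT).2 y.2, levelOrdinal_succ y⟩
    | succ x =>
      have hx : x ∈ T := by
        by_contra hx
        simp [levelOrdinal, hx] at hγ
      rw [levelOrdinal_succ ⟨x, hx⟩] at hγ
      obtain ⟨y, rfl⟩ := Ordinal.typein_surj r (hγ.trans (Ordinal.typein_lt_type r _))
      exact ⟨y, (levelLT_succ_iff hT hr).2 ⟨y.2, hx, (Ordinal.typein_lt_typein r).1 hγ⟩,
        levelOrdinal_succ y⟩

theorem CodesOrdinal.exists_isLevelMap {β : Ordinal.{0}} (h : CodesOrdinal b β) :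
    ∃ lev, IsLevelMap b lev ∧ lev 0 = β := by
  obtain ⟨T, r, _, rfl, hT, hr⟩ := h
  refine ⟨levelOrdinal r, isLevelMap_levelOrdinal (fun x => ?_) fun x y => ?_, rfl⟩
  · rw [hT]
    by_cases h : x ∈ T <;> simp [h]
  · rw [hr]
    by_cases h : r x y <;> simp [h]

end LevelMap

/-! ### Claimed positions are correct -/

theorem GoodResponses.exists_response {b i j : ℕ} {F : ℕ → ℕ} (h : GoodResponses b i j F)
    {s : Bool} {P Q : NatStructure S} (hP : IsIndex (sideIndex i j s) P)
    (hQ : IsIndex (sideIndex i j !s) Q) {x y : ℕ} (hxy : LevelLT b y x) {a : List P} {a' : List Q}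
    (hl : a.length = a'.length) (hc : Claims F (x, s, a.map Subtype.val, a'.map Subtype.val))
    (d : List Q) (N : ℕ) : ∃ c : List P, c.length = d.length ∧ Agree S N (a' ++ d) (a ++ c) ∧
      Claims F (y + 1, !s, (a' ++ d).map Subtype.val, (a ++ c).map Subtype.val) := by
  let q : Position := (x, s, a.map Subtype.val, a'.map Subtype.val)
  let m : Move := (y, d.map Subtype.val, N)
  obtain ⟨c', hc'⟩ := Nat.exists_eq_succ_of_ne_zero (hc m)
  obtain ⟨⟨hcl, hcu, hA⟩, hnext⟩ := h q m (Denumerable.ofNat _ c')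
    ⟨hxy, hQ.inUniverse_iff.2 ⟨d, rfl⟩⟩ (by rw [Denumerable.encode_ofNat]; exact hc')
  obtain ⟨c, hce⟩ := hP.notOutside_iff.1 hcu
  rw [← hce] at hcl hA hnext
  have hcl : c.length = d.length := by simpa [m] using hcl
  refine ⟨c, hcl, (indexAgree_iff_agree hQ hP (by simp [hl, hcl])).1 ?_, ?_⟩
  · simpa only [List.map_append] using hA
  · simp only [List.map_append]
    exact hnext

theorem getElem?_ofFn_append {β : Type*} {n : ℕ} (v : Fin n → β) (l : List β) (x : Fin n) :
    (List.ofFn v ++ l)[x.1]? = some (v x) := by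
  rw [List.getElem?_append_left (by simp), List.getElem?_ofFn]
  simp

section Claimed

variable {b i j : ℕ} {F : ℕ → ℕ} {P Q : NatStructure S} {x y n : ℕ} {s : Bool} {a : Fin n → P}
  {a' : Fin n → Q}

theorem GoodResponses.exists_realize (h : GoodResponses b i j F)
    (hP : IsIndex (sideIndex i j s) P) (hQ : IsIndex (sideIndex i j !s) Q) (hxy : LevelLT b y x)
    (hc : Claims F (x, s, (List.ofFn a).map Subtype.val, (List.ofFn a').map Subtype.val))
    {m : ℕ} (d : Fin m → Q) {θ : S.lang.Formula (Fin (n + m))} (hθ : θ.IsQF)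
    (hd : θ.Realize (Fin.append a' d)) : ∃ c : Fin m → P, θ.Realize (Fin.append a c) := by
  obtain ⟨q, ⟨⟨e, he⟩, -⟩, hq⟩ := exists_determines (f := Fin.val) (v := Fin.append a' d) hθ
    ⟨List.ofFn (Fin.append a' d), 0⟩
  obtain ⟨c, hcl, hA, -⟩ := h.exists_response hP hQ hxy (by simp) hc (List.ofFn d ++ e) q.tests
  obtain ⟨c₁, hc₁⟩ := exists_ofFn_eq (l := c.take m) (m := m) (by simp [hcl])
  have hac : List.ofFn a ++ c = List.ofFn (Fin.append a c₁) ++ c.drop m := by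
    rw [List.ofFn_fin_append, hc₁, List.append_assoc, List.take_append_drop]
  rw [← List.append_assoc, ← List.ofFn_fin_append, hac] at hA
  refine ⟨c₁, (hq P _ _ ⟨_, ?_, getElem?_ofFn_append _ e, ?_, getElem?_ofFn_append _ (c.drop m),
    hA⟩).1 hd⟩
  · rw [← he]
  · simp [hcl]

/-- The induction on the level trades claims for the back-and-forth relations. -/
theorem GoodResponses.piLE (h : GoodResponses b i j F) {lev : ℕ → Ordinal.{0}}
    (hlev : IsLevelMap b lev) (hx : lev x ≠ 0) (hP : IsIndex (sideIndex i j s) P)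
    (hQ : IsIndex (sideIndex i j !s) Q)
    (hc : Claims F (x, s, (List.ofFn a).map Subtype.val, (List.ofFn a').map Subtype.val)) :
    PiLE S.lang (lev x) a a' := by
  induction hγ : lev x using WellFoundedLT.induction generalizing x s P Q n with
  | ind γ ih =>
    subst hγ
    refine piLE_of_exists_response hx (fun m d θ hθ hd => ?_) fun δ hδ hδ0 m d => ?_
    · obtain ⟨y, hy, -⟩ := hlev.2 x 0 (pos_iff_ne_zero.2 hx)
      exact h.exists_realize hP hQ hy hc d hθ hd
    · obtain ⟨y, hy, rfl⟩ := hlev.2 x δ hδ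
      obtain ⟨c, hcl, -, hcc⟩ := h.exists_response hP hQ hy (by simp) hc (List.ofFn d) 0
      obtain ⟨c, rfl⟩ := exists_ofFn_eq (l := c) (m := m) (by simpa using hcl)
      rw [← List.ofFn_fin_append, ← List.ofFn_fin_append] at hcc
      exact ⟨c, ih _ hδ hδ0 hQ (by simpa using hP) hcc rfl⟩

end Claimed

/-! ### Correct positions can be claimed -/

/-- The position `q` is correct: its tuples are in the relation `≤` of the ordinal of its level, if
this is not `0`. -/
def CorrectPosition (S : Signature) (i j : ℕ) (lev : ℕ → Ordinal.{0}) (q : Position) : Prop :=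
  ∃ P Q : NatStructure S, IsIndex (sideIndex i j q.2.1) P ∧ IsIndex (sideIndex i j !q.2.1) Q ∧
    ∃ (n : ℕ) (a : Fin n → P) (a' : Fin n → Q), q.2.2.1 = (List.ofFn a).map Subtype.val ∧
      q.2.2.2 = (List.ofFn a').map Subtype.val ∧ (lev q.1 ≠ 0 → PiLE S.lang (lev q.1) a a')

theorem PiLE.exists_response_agree {M N : Type} [S.lang.Structure M] [S.lang.Structure N]
    [Countable M] {n : ℕ} {a : Fin n → M} {a' : Fin n → N} {δ γ : Ordinal.{0}}
    (h : PiLE S.lang γ a a') (hδ : δ < γ) {k : ℕ} (d : Fin k → N) (K : ℕ) : ∃ c : Fin k → M,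
      (δ ≠ 0 → PiLE S.lang δ (Fin.append a' d) (Fin.append a c)) ∧
        Agree S K (List.ofFn (Fin.append a' d)) (List.ofFn (Fin.append a c)) := by
  by_cases h0 : δ = 0
  · obtain ⟨θ, hθ, hd, hA⟩ := exists_formula_agree (S := S) K (Fin.append a' d)
    obtain ⟨c, hc⟩ := h.exists_realize (φ := .qf θ hθ) hδ (by simp [h0, InfFormula.IsPi]) hd
    exact ⟨c, fun h => absurd h0 h, hA _ hc⟩
  · obtain ⟨c, hc⟩ := h.exists_response hδ h0 d
    exact ⟨c, fun _ => hc, hc.agree _⟩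

theorem CorrectPosition.exists_response {b i j : ℕ} {lev : ℕ → Ordinal.{0}}
    (hlev : IsLevelMap b lev) {q : Position} (hq : CorrectPosition S i j lev q) {m : Move}
    (hm : LegalMove b i j q m) :
    ∃ c, RightResponse i j q m c ∧ CorrectPosition S i j lev (nextPosition q m c) := by
  obtain ⟨P, Q, hP, hQ, n, a, a', ha, ha', hle⟩ := hq
  have hlt := hlev.1 _ _ hm.1
  obtain ⟨k, d, hd⟩ := List.exists_iff_exists_tuple.1 (hQ.inUniverse_iff.1 hm.2)
  obtain ⟨c, hc, hA⟩ := (hle hlt.ne_bot).exists_response_agree hlt d m.2.2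
  refine ⟨(List.ofFn c).map Subtype.val, ⟨by simp [← hd], hP.notOutside_iff.2 ⟨_, rfl⟩, ?_⟩,
    Q, P, hQ, by simpa [nextPosition] using hP, _, Fin.append a' d, Fin.append a c, ?_, ?_, hc⟩
  · rw [← indexAgree_iff_agree hQ hP (by simp)] at hA
    simpa only [ha, ha', ← hd, List.ofFn_fin_append, List.map_append] using hA
  · simp only [nextPosition, ha', ← hd, List.ofFn_fin_append, List.map_append]
  · simp only [nextPosition, ha, List.ofFn_fin_append, List.map_append]

/-- The strategy that responds as in `CorrectPosition.exists_response`, and resigns elsewhere. -/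
theorem exists_goodResponses (S : Signature) {b : ℕ} (i j : ℕ) {lev : ℕ → Ordinal.{0}}
    (hlev : IsLevelMap b lev) (h : ℕ → ℕ) : ∃ F : ℕ → ℕ, (∀ z, F (imageKey z) = h z) ∧
      GoodResponses b i j F ∧ ∀ q, CorrectPosition S i j lev q → Claims F q := by
  have hv : ∀ (q : Position) (m : Move), ∃ v : ℕ, (CorrectPosition S i j lev q → v ≠ 0) ∧
      ∀ c, LegalMove b i j q m → v = Encodable.encode c + 1 →
        RightResponse i j q m c ∧ CorrectPosition S i j lev (nextPosition q m c) := by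
    intro q m
    by_cases hq : CorrectPosition S i j lev q
    · by_cases hm : LegalMove b i j q m
      · obtain ⟨c, hc⟩ := hq.exists_response hlev hm
        refine ⟨Encodable.encode c + 1, by simp, fun c' _ h => ?_⟩
        rw [add_left_inj, Encodable.encode_inj] at h
        exact h ▸ hc
      · exact ⟨1, by simp, fun c h => (hm h).elim⟩
    · exact ⟨0, fun h => (hq h).elim, fun c _ h => by simp at h⟩
  choose G hG₀ hG using hv
  let F : ℕ → ℕ := fun n => if n.unpair.1 = 0 then h n.unpair.2 else
    ((Encodable.decode (α := Position × Move) n.unpair.2).map fun p => G p.1 p.2).getD 0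
  have hF : ∀ q m, F (responseKey q m) = G q m := fun q m => by
    simp only [F, responseKey, Nat.unpair_pair, one_ne_zero, if_false, Encodable.encodek,
      Option.map_some, Option.getD_some]
  have hclaims : ∀ q, CorrectPosition S i j lev q → Claims F q := fun q hq m => by
    rw [hF]
    exact hG₀ q m hq
  refine ⟨F, fun z => by simp [F, imageKey], fun q m c hm hc => ?_, hclaims⟩
  rw [hF] at hc
  exact (hG q m c hm hc).imp id (hclaims _)

/-! ### Partial isomorphisms -/

section IsPartialIso

variable {M N : Type} [S.lang.Structure M] [S.lang.Structure N] {T : Set (M × N)}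

/-- The set `T` of pairs is a partial isomorphism, as far as tests can see: every list of members of
`T` is contained in a list that can be extended so that its coordinates agree on any given number of
tests. The extensions are allowed because the tests passed by a list say nothing about permutations
of the list. -/
def IsPartialIso (S : Signature) {M N : Type} [S.lang.Structure M] [S.lang.Structure N]
    (T : Set (M × N)) : Prop :=
  ∀ l : List (M × N), (∀ p ∈ l, p ∈ T) → ∃ l', l ⊆ l' ∧ ∀ K, ∃ l'', l' <+: l'' ∧
    Agree S K (l''.map Prod.fst) (l''.map Prod.snd)

namespace IsPartialIso

theorem mono {T' : Set (M × N)} (h : IsPartialIso S T) (hT : T' ⊆ T) : IsPartialIso S T' :=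
  fun l hl => h l fun p hp => hT (hl p hp)

theorem exists_holds_iff (h : IsPartialIso S T) {n : ℕ} {w : Fin n → M × N} (hw : ∀ i, w i ∈ T) :
    ∃ r : Fin n → ℕ, ∀ t : Test, ∃ (u : List M) (u' : List N), (∀ i, u[r i]? = some (w i).1) ∧
      (∀ i, u'[r i]? = some (w i).2) ∧ (Holds S u t ↔ Holds S u' t) := by
  obtain ⟨l', hl, hl'⟩ := h (List.ofFn w) (by simpa [List.mem_ofFn] using hw)
  choose r hr using fun i => List.mem_iff_getElem?.1 (hl (List.mem_ofFn.2 ⟨i, rfl⟩))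
  refine ⟨r, fun t => ?_⟩
  obtain ⟨l'', ⟨e, rfl⟩, hA⟩ := hl' (Encodable.encode t + 1)
  have hr' : ∀ i, (l' ++ e)[r i]? = some (w i) := fun i => by
    rw [List.getElem?_append_left (List.getElem?_eq_some_iff.1 (hr i)).1, hr]
  exact ⟨_, _, fun i => by simp only [List.getElem?_map, hr', Option.map_some],
    fun i => by simp only [List.getElem?_map, hr', Option.map_some], hA t (Nat.lt_succ_self _)⟩

theorem eq_iff (h : IsPartialIso S T) {p q : M × N} (hp : p ∈ T) (hq : q ∈ T) :
    p.1 = q.1 ↔ p.2 = q.2 := by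
  obtain ⟨r, hr⟩ := h.exists_holds_iff (w := ![p, q]) (by simp [Fin.forall_fin_two, hp, hq])
  obtain ⟨u, u', hu, hu', hT⟩ := hr (0, r 0, r 1, [])
  simpa [Holds, hu, hu'] using hT

theorem relMap_iff (h : IsPartialIso S T) {n : ℕ} {w : Fin n → M × N} (hw : ∀ i, w i ∈ T)
    (R : S.lang.Relations n) :
    Structure.RelMap R (fun i => (w i).1) ↔ Structure.RelMap R fun i => (w i).2 := by
  obtain ⟨r, hr⟩ := h.exists_holds_iff hw
  obtain ⟨u, u', hu, hu', hT⟩ := hr (1, R.1, 0, List.ofFn r)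
  rwa [holds_rel_iff hu, holds_rel_iff hu'] at hT

theorem funMap_eq_iff (h : IsPartialIso S T) {n : ℕ} {w : Fin n → M × N} (hw : ∀ i, w i ∈ T)
    {p : M × N} (hp : p ∈ T) (f : S.lang.Functions n) :
    Structure.funMap f (fun i => (w i).1) = p.1 ↔ Structure.funMap f (fun i => (w i).2) = p.2 := by
  obtain ⟨r, hr⟩ := h.exists_holds_iff (w := Fin.cons p w) (Fin.cases hp hw)
  obtain ⟨u, u', hu, hu', hT⟩ := hr (2, f.1, r 0, List.ofFn fun i => r i.succ)
  rw [holds_fn_iff fun i => hu i.succ, holds_fn_iff fun i => hu' i.succ, hu, hu'] at hT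
  simpa [eq_comm] using hT

theorem exists_embedding {h : M → N} (H : IsPartialIso S (Set.range fun x => (x, h x))) :
    ∃ g : M ↪[S.lang] N, ⇑g = h :=
  ⟨{ toFun := h
     inj' := fun x y hxy => (H.eq_iff ⟨x, rfl⟩ ⟨y, rfl⟩).2 hxy
     map_fun' := fun f v => ((H.funMap_eq_iff (w := fun i => (v i, h (v i))) (fun i => ⟨v i, rfl⟩)
      ⟨_, rfl⟩ f).1 rfl).symm
     map_rel' := fun R v => (H.relMap_iff (w := fun i => (v i, h (v i)))
      (fun i => ⟨v i, rfl⟩) R).symm }, rfl⟩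

end IsPartialIso

theorem exists_equiv_of_surjective {L : FirstOrder.Language} {M N : Type*} [L.Structure M]
    [L.Structure N] (g : M ↪[L] N) (hg : Function.Surjective g) : ∃ g' : M ≃[L] N, ⇑g' = g :=
  ⟨{ toEquiv := Equiv.ofBijective g ⟨g.injective, hg⟩
     map_fun' := fun f v => g.map_fun f v
     map_rel' := fun R v => g.map_rel R v }, rfl⟩

theorem IsPartialIso.nonempty_equiv (H : IsPartialIso S T) (dom : ∀ x, ∃ y, (x, y) ∈ T)
    (ran : ∀ y, ∃ x, (x, y) ∈ T) : Nonempty (M ≃[S.lang] N) := by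
  choose h hh using dom
  obtain ⟨g, rfl⟩ := (H.mono (Set.range_subset_iff.2 hh)).exists_embedding
  obtain ⟨g', -⟩ := exists_equiv_of_surjective g fun y => by
    obtain ⟨x, hx⟩ := ran y
    exact ⟨x, (H.eq_iff (hh x) hx).1 rfl⟩
  exact ⟨g'⟩

theorem isPartialIso_range_of_agree_map {h : M → N} (H : ∀ K l, Agree S K l (l.map h)) :
    IsPartialIso S (Set.range fun x => (x, h x)) := by
  refine fun l hl => ⟨l, List.Subset.refl l, fun K => ⟨l, List.prefix_rfl, ?_⟩⟩
  have hsnd : l.map Prod.snd = (l.map Prod.fst).map h := by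
    rw [List.map_map, List.map_inj_left]
    rintro p hp
    obtain ⟨x, rfl⟩ := hl p hp
    rfl
  rw [hsnd]
  exact H K _

theorem agree_map (g : M ↪[S.lang] N) (K : ℕ) (l : List M) : Agree S K l (l.map g) := by
  have h := ((isSigmaElementary_iff_piLE g).1 (isSigmaElementary_zero g) _ l.get).1.agree K
  rwa [← List.map_ofFn, List.ofFn_get] at h

end IsPartialIso

/-! ### Embeddings given by functions on the natural numbers -/

section Good

variable {i j : ℕ} {A B : NatStructure S} {F : ℕ → ℕ}

theorem IsIndex.inUniverse_singleton_iff (hi : IsIndex i A) {z : ℕ} :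
    InUniverse i [z] ↔ z ∈ A.carrier := by
  simp [InUniverse, hi.phi_eq_one_iff]

theorem IsIndex.notOutside_singleton_iff (hi : IsIndex i A) {z : ℕ} :
    NotOutside i [z] ↔ z ∈ A.carrier := by
  simp [NotOutside, hi.phi_eq_zero_iff]

theorem map_imageKey_eq {g : A → B} (hg : ∀ x, (g x).1 = F (imageKey x)) (l : List A) :
    ((l.map Subtype.val).map imageKey).map F = (l.map g).map Subtype.val := by
  simp [hg]

theorem GoodImages.exists_embedding (hi : IsIndex i A) (hj : IsIndex j B)
    (h : GoodImages i j F) : ∃ g : A ↪[S.lang] B, ∀ x, (g x).1 = F (imageKey x) := by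
  have hmem : ∀ x : A, F (imageKey x) ∈ B.carrier := fun x =>
    hj.notOutside_singleton_iff.1 (h [x] (hi.inUniverse_singleton_iff.2 x.2)).1
  let f : A → B := fun x => ⟨F (imageKey x), hmem x⟩
  obtain ⟨g, hg⟩ := (isPartialIso_range_of_agree_map (S := S) (h := f) fun K l => by
    have hA := (h _ (hi.inUniverse_iff.2 ⟨l, rfl⟩)).2 K
    rwa [map_imageKey_eq (g := f) fun _ => rfl,
      indexAgree_iff_agree hi hj (List.length_map _).symm] at hA).exists_embedding
  exact ⟨g, fun x => by rw [hg]⟩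

theorem goodImages_of_embedding (hi : IsIndex i A) (hj : IsIndex j B) (g : A ↪[S.lang] B)
    (hg : ∀ x, (g x).1 = F (imageKey x)) : GoodImages i j F := by
  intro l hl
  obtain ⟨l, rfl⟩ := hi.inUniverse_iff.1 hl
  rw [map_imageKey_eq hg]
  exact ⟨hj.notOutside_iff.2 ⟨_, rfl⟩, fun N =>
    (indexAgree_iff_agree hi hj (List.length_map _).symm).2 (agree_map g N l)⟩

theorem GoodImages.exists_equiv (hi : IsIndex i A) (hj : IsIndex j B) (h : GoodImages i j F)
    (h' : GoodPreimages i j F) : ∃ g : A ≃[S.lang] B, ∀ x, (g x).1 = F (imageKey x) := by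
  obtain ⟨g, hg⟩ := h.exists_embedding hi hj
  obtain ⟨g', hg'⟩ := exists_equiv_of_surjective g fun y => by
    obtain ⟨hx, hxy⟩ := h' y (hj.inUniverse_singleton_iff.2 y.2)
    exact ⟨⟨_, hi.notOutside_singleton_iff.1 hx⟩, Subtype.ext (by rw [hg, hxy])⟩
  exact ⟨g', fun x => by rw [hg', hg]⟩

theorem exists_goodImages_goodPreimages (hi : IsIndex i A) (hj : IsIndex j B)
    (g : A ≃[S.lang] B) : ∃ F, GoodImages i j F ∧ GoodPreimages i j F := by
  classical
  let F : ℕ → ℕ := fun n => if n.unpair.1 = 0 then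
      (if h : n.unpair.2 ∈ A.carrier then (g ⟨_, h⟩).1 else 0)
    else if h : n.unpair.2 ∈ B.carrier then (g.symm ⟨_, h⟩).1 else 0
  have image : ∀ x : A, (g x).1 = F (imageKey x) := fun x => by simp [F, imageKey]
  have preimage : ∀ y : B, F (preimageKey y) = (g.symm y).1 := fun y => by simp [F, preimageKey]
  refine ⟨F, goodImages_of_embedding hi hj g.toEmbedding image, fun z hz => ?_⟩
  lift z to B using hj.inUniverse_singleton_iff.1 hz
  rw [preimage, ← image]
  exact ⟨hi.notOutside_singleton_iff.2 (g.symm z).2, by simp⟩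

variable {b : ℕ} {β : Ordinal.{0}}

theorem GoodImages.exists_isSigmaElementary (hi : IsIndex i A) (hj : IsIndex j B)
    (hb : CodesOrdinal b β) (h : GoodImages i j F) (h' : GoodResponses b i j F)
    (h'' : ClaimsImages i F) :
    ∃ g : A ↪[S.lang] B, IsSigmaElementary β g ∧ ∀ x, (g x).1 = F (imageKey x) := by
  obtain ⟨g, hg⟩ := h.exists_embedding hi hj
  refine ⟨g, ?_, hg⟩
  rcases eq_or_ne β 0 with rfl | hβ
  · exact isSigmaElementary_zero g
  obtain ⟨lev, hlev, rfl⟩ := hb.exists_isLevelMap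
  refine (isSigmaElementary_iff_piLE g).2 fun n v => ?_
  obtain ⟨hc, hc'⟩ := h'' _ (hi.inUniverse_iff.2 ⟨List.ofFn v, rfl⟩)
  rw [map_imageKey_eq hg, List.map_ofFn (g := g)] at hc hc'
  exact ⟨h'.piLE (s := true) hlev hβ hi hj hc, h'.piLE (s := false) hlev hβ hj hi hc'⟩

theorem exists_goodImages_goodResponses_claimsImages (hi : IsIndex i A) (hj : IsIndex j B)
    (hb : CodesOrdinal b β) {g : A ↪[S.lang] B} (hg : IsSigmaElementary β g) :
    ∃ F, GoodImages i j F ∧ GoodResponses b i j F ∧ ClaimsImages i F := by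
  classical
  obtain ⟨lev, hlev, rfl⟩ := hb.exists_isLevelMap
  obtain ⟨F, hF, hF', hclaims⟩ := exists_goodResponses S i j hlev
    fun z => if h : z ∈ A.carrier then (g ⟨z, h⟩).1 else 0
  have image : ∀ x : A, (g x).1 = F (imageKey x) := fun x => by simp [hF]
  refine ⟨F, goodImages_of_embedding hi hj g image, hF', fun l hl => ?_⟩
  obtain ⟨n, v, rfl⟩ := List.exists_iff_exists_tuple.1 (hi.inUniverse_iff.1 hl)
  rw [map_imageKey_eq image, List.map_ofFn (g := g)]
  obtain ⟨hle, hle'⟩ := (isSigmaElementary_iff_piLE g).1 hg n v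
  exact ⟨hclaims _ ⟨A, B, hi, hj, n, v, g ∘ v, rfl, rfl, fun _ => hle⟩,
    hclaims _ ⟨B, A, hj, hi, n, g ∘ v, v, rfl, rfl, fun _ => hle'⟩⟩

end Good

/-! ### Embeddings from paths -/

theorem exists_imageIndex : ∃ p : ℕ → ℕ, Primrec p ∧ ∀ (c : ℕ) (D : Set ℕ) (F : ℕ → ℕ),
    (∀ n, oracleEval c D n = Part.some (F n)) →
      ∀ z, oracleEval (p c) D z = Part.some (F (imageKey z)) := by
  obtain ⟨k, hk⟩ := OCode.exists_eval_eq_some (f := imageKey) (by fun_prop)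
  refine ⟨fun c => 2 * (2 * Nat.pair c (Encodable.encode k) + 1) + 5, by fun_prop,
    fun c D F hF z => ?_⟩
  obtain ⟨c, rfl⟩ : ∃ c' : OCode, c = Encodable.encode c' := ⟨Denumerable.ofNat _ c, by simp⟩
  simp only [oracleEval, ← encode_comp, Denumerable.ofNat_encode] at hF ⊢
  rw [OCode.eval_comp_of_eq (hk _ z), hF]

theorem exists_avoids_iff_elementary : ∃ g : ℕ × ℕ × ℕ → ℕ, Primrec g ∧ ∀ b i j F,
    Avoids (g (b, i, j)) F ↔ GoodImages i j F ∧ GoodResponses b i j F ∧ ClaimsImages i F := by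
  have hi : Primrec fun a : ℕ × ℕ × ℕ => a.2.1 := by fun_prop
  have hj : Primrec fun a : ℕ × ℕ × ℕ => a.2.2 := by fun_prop
  obtain ⟨g, hg, h⟩ := ((IsPiClass.goodImages hi hj).and
    ((IsPiClass.goodResponses Primrec.fst hi hj).and (IsPiClass.claimsImages hi))).exists_avoids_iff
  exact ⟨g, hg, fun b i j => h (b, i, j)⟩

theorem exists_avoids_iff_iso : ∃ g : ℕ × ℕ → ℕ, Primrec g ∧ ∀ i j F,
    Avoids (g (i, j)) F ↔ GoodImages i j F ∧ GoodPreimages i j F := by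
  obtain ⟨g, hg, h⟩ := ((IsPiClass.goodImages Primrec.fst Primrec.snd).and
    (IsPiClass.goodPreimages Primrec.fst Primrec.snd)).exists_avoids_iff
  exact ⟨g, hg, fun i j => h (i, j)⟩

variable {d : TuringDegree} {α : Ordinal.{0}}

theorem ComputesPaths.isCollegiate (h : ComputesPaths d) (hα : IsComputableOrdinal α) :
    IsCollegiate α d := by
  rintro β hβ S A B ⟨i, hi⟩ ⟨j, hj⟩ ⟨f, hf⟩
  obtain ⟨b, hb⟩ := hα.of_le hβ
  obtain ⟨g, -, hg⟩ := exists_avoids_iff_elementary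
  obtain ⟨F, hF⟩ := exists_goodImages_goodResponses_claimsImages hi hj hb hf
  obtain ⟨D, hD, c, F, hF, hc⟩ := h (g (b, i, j)) ⟨F, (hg _ _ _ _).2 hF⟩
  obtain ⟨himages, hresponses, hclaims⟩ := (hg _ _ _ _).1 hF
  obtain ⟨f, hf, hfF⟩ := himages.exists_isSigmaElementary hi hj hb hresponses hclaims
  obtain ⟨p, -, hp⟩ := exists_imageIndex
  exact ⟨f, hf, D, hD, _, turingReducible_oracleEval (p c) D, fun x => by rw [hp c D F hc, hfF]⟩

theorem ComputesPaths.highForIsomorphism (h : ComputesPaths d) : HighForIsomorphism d := by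
  rintro S A B ⟨i, hi⟩ ⟨j, hj⟩ ⟨f⟩
  obtain ⟨g, -, hg⟩ := exists_avoids_iff_iso
  obtain ⟨F, hF⟩ := exists_goodImages_goodPreimages hi hj f
  obtain ⟨D, hD, c, F, hF, hc⟩ := h (g (i, j)) ⟨F, (hg _ _ _).2 hF⟩
  obtain ⟨himages, hpreimages⟩ := (hg _ _ _).1 hF
  obtain ⟨f, hfF⟩ := himages.exists_equiv hi hj hpreimages
  obtain ⟨p, -, hp⟩ := exists_imageIndex
  exact ⟨f, D, hD, _, turingReducible_oracleEval (p c) D, fun x => by rw [hp c D F hc, hfF]⟩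

theorem UniformlyComputesPaths.uniformlyComputablyCollegiate (h : UniformlyComputesPaths d) :
    UniformlyComputablyCollegiate d := by
  obtain ⟨D, hD, c, hc, h⟩ := h
  obtain ⟨g, hgc, hg⟩ := exists_avoids_iff_elementary
  obtain ⟨p, hpc, hp⟩ := exists_imageIndex
  refine ⟨D, hD, fun b i j => p (c (g (b, i, j))), hpc.to_comp.comp (hc.comp hgc.to_comp), ?_⟩
  rintro β b hb S A B i j hi hj ⟨f, hf⟩
  obtain ⟨F, hF⟩ := exists_goodImages_goodResponses_claimsImages hi hj hb hf
  obtain ⟨F, hF, hcF⟩ := h (g (b, i, j)) ⟨F, (hg _ _ _ _).2 hF⟩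
  obtain ⟨himages, hresponses, hclaims⟩ := (hg _ _ _ _).1 hF
  obtain ⟨f, hf, hfF⟩ := himages.exists_isSigmaElementary hi hj hb hresponses hclaims
  exact ⟨f, hf, fun x => by rw [hp _ D F hcF, hfF]⟩

theorem UniformlyComputesPaths.uniformlyHighForIsomorphism (h : UniformlyComputesPaths d) :
    UniformlyHighForIsomorphism d := by
  obtain ⟨D, hD, c, hc, h⟩ := h
  obtain ⟨g, hgc, hg⟩ := exists_avoids_iff_iso
  obtain ⟨p, hpc, hp⟩ := exists_imageIndex
  refine ⟨D, hD, fun i j => p (c (g (i, j))), hpc.to_comp.comp (hc.comp hgc.to_comp), ?_⟩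
  rintro S A B i j hi hj ⟨f⟩
  obtain ⟨F, hF⟩ := exists_goodImages_goodPreimages hi hj f
  obtain ⟨F, hF, hcF⟩ := h (g (i, j)) ⟨F, (hg _ _ _).2 hF⟩
  obtain ⟨himages, hpreimages⟩ := (hg _ _ _).1 hF
  obtain ⟨f, hfF⟩ := himages.exists_equiv hi hj hpreimages
  exact ⟨f, fun x => by rw [hp _ D F hcF, hfF]⟩

theorem UniformlyComputablyCollegiate.uniformlyCollegiate (h : UniformlyComputablyCollegiate d)
    (α : Ordinal.{0}) : UniformlyCollegiate α d := by
  obtain ⟨D, hD, f, hf, h⟩ := h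
  exact ⟨D, hD, f, hf, fun β _ => h β⟩

theorem UniformlyCollegiate.levelwiseUniformlyCollegiate (h : UniformlyCollegiate α d)
    (hα : IsComputableOrdinal α) : LevelwiseUniformlyCollegiate α d := by
  obtain ⟨D, hD, f, hf, h⟩ := h
  intro β hβ
  obtain ⟨b, hb⟩ := hα.of_le hβ
  exact ⟨D, hD, f b, hf.comp (Computable.pair (Computable.const b) Computable.id), h β hβ b hb⟩

/-! ### Computable structures that are equivalent up to the Church-Kleene ordinal -/

theorem isPartialIso_of_chain {M N : Type} [S.lang.Structure M] [S.lang.Structure N]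
    {W : ℕ → List (M × N)} (hW : ∀ k, W k <+: W (k + 1))
    (hA : ∀ k, Agree S k ((W (k + 1)).map Prod.fst) ((W (k + 1)).map Prod.snd)) :
    IsPartialIso S {p | ∃ k, p ∈ W k} := by
  have mono : ∀ {k l}, k ≤ l → W k <+: W l := fun {k l} hkl => by
    induction l, hkl using Nat.le_induction with
    | base => exact List.prefix_rfl
    | succ l _ ih => exact ih.trans (hW l)
  intro l hl
  obtain ⟨k, hk⟩ : ∃ k, l ⊆ W k := by
    induction l with
    | nil => exact ⟨0, List.nil_subset _⟩
    | cons p l ih =>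
      obtain ⟨k, hk⟩ := ih fun q hq => hl q (List.mem_cons_of_mem _ hq)
      obtain ⟨k', hk'⟩ := hl p List.mem_cons_self
      exact ⟨max k k', List.cons_subset.2 ⟨(mono (le_max_right _ _)).subset hk',
        List.Subset.trans hk (mono (le_max_left _ _)).subset⟩⟩
  exact ⟨W k, hk, fun K => ⟨W (max k K + 1), mono ((le_max_left k K).trans (Nat.le_succ _)),
    (hA _).mono (le_max_right _ _)⟩⟩

variable {A B : NatStructure S} {i j b : ℕ} {F : ℕ → ℕ}

theorem GoodResponses.exists_round (h : GoodResponses b i j F) (hi : IsIndex i A)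
    (hj : IsIndex j B) {x y z : ℕ} (hyx : LevelLT b y x) (hzy : LevelLT b z (y + 1))
    {W : List (A × B)}
    (hW : Claims F (x, true, (W.map Prod.fst).map Subtype.val, (W.map Prod.snd).map Subtype.val))
    (d : List A) (d' : List B) (k : ℕ) : ∃ W', W <+: W' ∧
      Claims F (z + 1, true, (W'.map Prod.fst).map Subtype.val,
        (W'.map Prod.snd).map Subtype.val) ∧
      d ⊆ W'.map Prod.fst ∧ d' ⊆ W'.map Prod.snd ∧
      Agree S k (W'.map Prod.fst) (W'.map Prod.snd) := by
  obtain ⟨c, hcl, -, hc⟩ := h.exists_response (s := true) hi hj hyx (by simp) hW d' 0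
  obtain ⟨c', hcl', hA, hc'⟩ := h.exists_response (s := false) hj hi hzy (by simp [hcl]) hc d k
  have hfst : (W ++ c.zip d' ++ d.zip c').map Prod.fst = W.map Prod.fst ++ c ++ d := by
    simp [List.map_fst_zip, hcl, hcl']
  have hsnd : (W ++ c.zip d' ++ d.zip c').map Prod.snd = W.map Prod.snd ++ d' ++ c' := by
    simp [List.map_snd_zip, hcl, hcl']
  refine ⟨W ++ c.zip d' ++ d.zip c', ?_, ?_⟩
  · rw [List.append_assoc]
    exact List.prefix_append _ _
  · rw [hfst, hsnd]
    exact ⟨hc', List.subset_append_right _ _,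
      List.Subset.trans (List.subset_append_right _ _) (List.subset_append_left _ _), hA⟩

theorem NatStructure.exists_list_forall_mem (P : NatStructure S) (k : ℕ) :
    ∃ l : List P, ∀ a : P, a.1 = k → a ∈ l := by
  by_cases hk : k ∈ P.carrier
  · exact ⟨[⟨k, hk⟩], fun a ha => List.mem_singleton.2 (Subtype.ext ha)⟩
  · exact ⟨[], fun a ha => (hk (ha ▸ a.2)).elim⟩

/-- The partial map is extended in round `k` by the elements `k` of both structures, which takes two
levels of the descending sequence. -/
theorem GoodResponses.nonempty_equiv (h : GoodResponses b i j F) (hi : IsIndex i A)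
    (hj : IsIndex j B) (hc : Claims F (0, true, [], [])) {x : ℕ → ℕ} (hx0 : x 0 = 0)
    (hx : ∀ k, ∃ y, x (k + 1) = y + 1 ∧ LevelLT b y (x k)) : Nonempty (A ≃[S.lang] B) := by
  classical
  let Claimed (k : ℕ) (W : List (A × B)) : Prop := Claims F (x (2 * k), true,
    (W.map Prod.fst).map Subtype.val, (W.map Prod.snd).map Subtype.val)
  have step : ∀ k W, Claimed k W → ∃ W', W <+: W' ∧ Claimed (k + 1) W' ∧
      (∀ a : A, a.1 = k → a ∈ W'.map Prod.fst) ∧ (∀ a : B, a.1 = k → a ∈ W'.map Prod.snd) ∧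
      Agree S k (W'.map Prod.fst) (W'.map Prod.snd) := by
    intro k W hW
    obtain ⟨d, hd⟩ := A.exists_list_forall_mem k
    obtain ⟨d', hd'⟩ := B.exists_list_forall_mem k
    obtain ⟨y, hy, hyx⟩ := hx (2 * k)
    obtain ⟨z, hz, hzy⟩ := hx (2 * k + 1)
    obtain ⟨W', hWW', hW', hdW', hdW'', hA⟩ := h.exists_round hi hj hyx (hy ▸ hzy) hW d d' k
    exact ⟨W', hWW', by rwa [← hz] at hW', fun a ha => hdW' (hd a ha),
      fun a ha => hdW'' (hd' a ha), hA⟩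
  choose! next hprefix hnext hdom hran hagree using step
  let W : ℕ → List (A × B) := fun k => Nat.rec [] next k
  have hW : ∀ k, Claimed k (W k) := fun k => by
    induction k with
    | zero => simpa only [Claimed, Nat.mul_zero, hx0] using! hc
    | succ k ih => exact hnext k _ ih
  refine (isPartialIso_of_chain (fun k => hprefix k _ (hW k))
    fun k => hagree k _ (hW k)).nonempty_equiv (fun a => ?_) fun a => ?_
  · obtain ⟨⟨a, c⟩, hp, rfl⟩ := List.mem_map.1 (hdom a.1 _ (hW a.1) a rfl)
    exact ⟨c, a.1 + 1, hp⟩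
  · obtain ⟨⟨c, a⟩, hp, rfl⟩ := List.mem_map.1 (hran a.1 _ (hW a.1) a rfl)
    exact ⟨c, a.1 + 1, hp⟩

theorem exists_levelLT_kbIndex {e : ℕ} (hF : Avoids e F) :
    ∃ x : ℕ → ℕ, x 0 = 0 ∧ ∀ k, ∃ y, x (k + 1) = y + 1 ∧ LevelLT (kbIndex e) y (x k) := by
  have hT := avoids_iff_inTree.1 hF
  refine ⟨fun k => Nat.casesOn k 0 fun k => Encodable.encode (initSeg F k) + 1, rfl,
    fun k => ⟨_, rfl, ?_⟩⟩
  cases k with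
  | zero => exact ⟨by simp [phi_kbIndex_zero, hT], Or.inl rfl⟩
  | succ k =>
    have : KB (initSeg F (k + 1)) (initSeg F k) := by
      rw [initSeg_succ]
      exact kb_append_singleton _ _
    exact ⟨by simp [phi_kbIndex_zero, hT],
      Or.inr (by simp [phi_kbIndex_zero, phi_kbIndex_one, hT, this])⟩

theorem nonempty_equiv_of_backForthLE (hA : IsComputableStructure A)
    (hB : IsComputableStructure B)
    (h : BackForthLE S.lang omegaOneCK A B (Fin.elim0 : Fin 0 → A) (Fin.elim0 : Fin 0 → B)) :
    Nonempty (A ≃[S.lang] B) := by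
  obtain ⟨i, hi⟩ := hA
  obtain ⟨j, hj⟩ := hB
  -- The tree `e` consists of the attempts at a strategy for the game along its own
  -- Kleene-Brouwer order.
  obtain ⟨e, he⟩ := ((IsPiClass.goodResponses primrec_kbIndex (Primrec.const i)
    (Primrec.const j)).and (IsPiClass.claims
      (Primrec.const ((0, true, [], []) : Position)))).exists_avoids_self_iff
  obtain ⟨F, hF⟩ : ∃ F, Avoids e F := by
    by_contra hne
    obtain ⟨β, hβ⟩ := exists_codesOrdinal_kbIndex hne
    have hlt : β < omegaOneCK := IsComputableOrdinal.lt_omegaOneCK ⟨_, hβ⟩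
    obtain ⟨lev, hlev, rfl⟩ := hβ.exists_isLevelMap
    obtain ⟨F, -, hF, hclaims⟩ := exists_goodResponses S i j hlev id
    exact hne ⟨F, (he F).2 ⟨hF, hclaims _ ⟨A, B, hi, hj, 0, Fin.elim0, Fin.elim0, by simp, by simp,
      fun _ => (h.piLE (pos_of_gt hlt).ne').mono hlt.le⟩⟩⟩
  obtain ⟨x, hx0, hx⟩ := exists_levelLT_kbIndex hF
  obtain ⟨hresponses, hclaims⟩ := (he F).1 hF
  exact hresponses.nonempty_equiv hi hj hclaims hx0 hx

end Collegiate

end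

theorem mainTheorem5 :
    (∀ α : Ordinal.{0}, Collegiate.IsComputableOrdinal α →
      ∀ d : TuringDegree, d ∈ Set.range Collegiate.degreeOf →
        [Collegiate.IsCollegiate α d,
          Collegiate.IsComputablyCollegiate d,
          Collegiate.HighForIsomorphism d].TFAE ∧
        [Collegiate.UniformlyCollegiate α d,
          Collegiate.LevelwiseUniformlyCollegiate α d,
          Collegiate.UniformlyComputablyCollegiate d,
          ∀ γ : Ordinal.{0}, Collegiate.IsComputableOrdinal γ →
            Collegiate.UniformlyCollegiate γ d,
          ∀ γ : Ordinal.{0}, Collegiate.IsComputableOrdinal γ →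
            Collegiate.LevelwiseUniformlyCollegiate γ d,
          Collegiate.UniformlyHighForIsomorphism d].TFAE) ∧
    (∀ (S : Collegiate.Signature) (A B : Collegiate.NatStructure S),
      Collegiate.IsComputableStructure A → Collegiate.IsComputableStructure B →
      Collegiate.BackForthEquiv S.lang Collegiate.omegaOneCK A B →
      Nonempty (A ≃[S.lang] B)) := by
  refine ⟨fun α hα d _ => ⟨?_, ?_⟩, fun S A B hA hB h =>
    Collegiate.nonempty_equiv_of_backForthLE hA hB h.1⟩
  · tfae_have 1 → 3 := fun h => h.computesPaths.highForIsomorphism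
    tfae_have 3 → 2 := fun h γ hγ => h.computesPaths.isCollegiate hγ
    tfae_have 2 → 1 := fun h => h α hα
    tfae_finish
  · tfae_have 1 → 2 := fun h => h.levelwiseUniformlyCollegiate hα
    tfae_have 2 → 6 := fun h => h.uniformlyComputesPaths.uniformlyHighForIsomorphism
    tfae_have 6 → 3 := fun h => h.uniformlyComputesPaths.uniformlyComputablyCollegiate
    tfae_have 3 → 4 := fun h γ _ => h.uniformlyCollegiate γ
    tfae_have 4 → 5 := fun h γ hγ => (h γ hγ).levelwiseUniformlyCollegiate hγ
    tfae_have 5 → 2 := fun h => h α hα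
    tfae_have 4 → 1 := fun h => h α hα
    tfae_finish
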